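/- Let $V,E$ be arbitrary sets and let $\Gamma=(V,E,a,b,\gamma_l,\gamma_r)$ be a metric graph: $a,b\colon E\to[-\infty,\infty]$ with $a_e<b_e$ for all $e\in E$, each edge $e$ is identified with the interval $(a_e,b_e)\subseteq\mathbb R$, $E_l:=\{e\in E: a_e>-\infty\}$, $E_r:=\{e\in E: b_e<\infty\}$, and $\gamma_l\colon E_l\to V$, $\gamma_r\colon E_r\to V$ are maps. Assume $\inf_{e\in E}(b_e-a_e)>0$. Let $(\alpha_e)_{e\in E}$ in $(0,\infty)$ be bounded and bounded away from zero, and let $(\beta_e)_{e\in E}$ in $\mathbb R$ be bounded. Let $\mathcal H_\Gamma=\bigoplus_{e\in E}L_2(a_e,b_e)$ (complex Hilbert space direct sum) and let $\hat A$ be the maximal operator in $\mathcal H_\Gamma$, $$D(\hat A)=\bigoplus_{e\in E}W_2^3(a_e,b_e),\qquad (\hat Au)_e=\alpha_e u_e'''+\beta_e u_e'.$$ For $u\in D(\hat A)$ put $\mathrm{Tr}_l u=\bigl((u_e^{(k)}(a_e+))_{e\in E_l}\bigr)_{k=0,1,2}\in\ell_2(E_l)^3$ and $\mathrm{Tr}_r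 u=\bigl((u_e^{(k)}(b_e-))_{e\in E_r}\bigr)_{k=0,1,2}\in\ell_2(E_r)^3$. For a linear operator $L$ from $\ell_2(E_r)^3$ to $\ell_2(E_l)^3$ with domain $D(L)$, let $A_L$ be the restriction of $\hat A$ to $$D(A_L)=\{u\in D(\hat A):\ \mathrm{Tr}_r u\in D(L),\ L\,\mathrm{Tr}_r u=\mathrm{Tr}_l u\}.$$ For $s\in\{l,r\}$ let $\mathcal K_s$ be $\ell_2(E_s)^3$ equipped with the indefinite inner product $\langle x\mid y\rangle_s=(B_s x\mid y)_{\ell_2(E_s)^3}$ (linear in $x$), where $$B_s=\begin{pmatrix}-\beta_s&0&-\alpha_s\\0&\alpha_s&0\\-\alpha_s&0&0\end{pmatrix}$$ and $\alpha_s,\beta_s$ denote multiplication by $(\alpha_e)_{e\in E_s}$, $(\beta_e)_{e\in E_s}$. An operator $M$ from $\mathcal K_s$ to $\mathcal K_t$ is called $(\mathcal K_s,\mathcal K_t)$-contractive if $\langle Mx\mid Mx\rangle_t\le\langle x\mid x\rangle_s$ for all $x\in D(M)$. For densely defined $L$ from $\mathcal K_r$ to $\mathcal K_l$, the Krein adjoint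 $L^\sharp$ is the operator from $\mathcal K_l$ to $\mathcal K_r$ whose domain consists of all $y$ for which there is a (necessarily unique) $z\in\mathcal K_r$ with $\langle Lx\mid y\rangle_l=\langle x\mid z\rangle_r$ for all $x\in D(L)$, and $L^\sharp y:=z$. **Theorem.** Let $L$ be a densely defined closed linear operator from $\ell_2(E_r)^3$ to $\ell_2(E_l)^3$. Then $A_L$ is the generator of a $C_0$-semigroup of contractions on $\mathcal H_\Gamma$ if and only if $L$ is $(\mathcal K_r,\mathcal K_l)$-contractive and $L^\sharp$ is $(\mathcal K_l,\mathcal K_r)$-contractive. -/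

import Mathlib

open MeasureTheory Filter Topology
open scoped NNReal ENNReal ContDiff

noncomputable section

/-! ## Metric graphs and coefficients -/

/-- A metric graph with vertex set `V` and edge set `E` (both arbitrary). The edge `e` is identified
with the interval `(a e, b e)`, where `-∞ ≤ a e < b e ≤ ∞`. The maps `γl`, `γr` assign to an edge
with finite starting (termination) point its starting (termination) vertex. -/
structure MetricGraph (V E : Type*) where
  a : E → EReal
  b : E → EReal
  lt : ∀ e, a e < b e
  γl : {e : E // ⊥ < a e} → V
  γr : {e : E // b e < ⊤} → V

/-- Coefficients of the Airy operator: `α` positive, bounded and bounded away from zero;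
`β` real and bounded. -/
structure AiryCoefficients (E : Type*) where
  α : E → ℝ
  β : E → ℝ
  α_lower : ∃ c : ℝ, 0 < c ∧ ∀ e, c ≤ α e
  α_upper : ∃ C : ℝ, ∀ e, α e ≤ C
  β_bounded : ∃ C : ℝ, ∀ e, |β e| ≤ C

namespace AiryCoefficients

variable {E : Type*} (c : AiryCoefficients E)

theorem α_pos (e : E) : 0 < c.α e := by
  obtain ⟨k, hk, h⟩ := c.α_lower
  exact hk.trans_le (h e)

theorem α_bounded : ∃ C : ℝ, ∀ e, |c.α e| ≤ C := by
  obtain ⟨C, hC⟩ := c.α_upper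
  exact ⟨C, fun e => by rw [abs_of_pos (c.α_pos e)]; exact hC e⟩

end AiryCoefficients

namespace MetricGraph

variable {V E : Type*} (Γ : MetricGraph V E)

/-- Edges with finite starting point. -/
abbrev El : Type _ := {e : E // ⊥ < Γ.a e}

/-- Edges with finite termination point. -/
abbrev Er : Type _ := {e : E // Γ.b e < ⊤}

/-- The open interval `(a e, b e) ⊆ ℝ`. -/
def edge (e : E) : Set ℝ := {x : ℝ | Γ.a e < (x : EReal) ∧ (x : EReal) < Γ.b e}

theorem isOpen_edge (e : E) : IsOpen (Γ.edge e) :=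
  (isOpen_lt continuous_const continuous_coe_real_ereal).inter
    (isOpen_lt continuous_coe_real_ereal continuous_const)

/-- The edge lengths are bounded below by a positive number: `inf_e (b e - a e) > 0`. -/
def HasPositiveEdgeLength : Prop := 0 < ⨅ e, (Γ.b e - Γ.a e)

/-- The Hilbert space `⨁_e L₂(a e, b e)`. -/
abbrev H : Type _ := lp (fun e : E => Lp ℂ 2 (volume.restrict (Γ.edge e))) 2

end MetricGraph

/-- The Hilbert space `ℓ₂(ι)³`. -/
abbrev L2Cube (ι : Type*) : Type _ := PiLp 2 (fun _ : Fin 3 => lp (fun _ : ι => ℂ) 2)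

/-! ## Weak derivatives, traces, the maximal operator -/

/-- `v` is the weak derivative of `u` on the open set `I ⊆ ℝ`, for `u, v ∈ L₂(I)`. -/
def IsWeakDeriv {I : Set ℝ} (u v : Lp ℂ 2 (volume.restrict I)) : Prop :=
  ∀ φ : ℝ → ℝ, ContDiff ℝ ∞ φ → HasCompactSupport φ → tsupport φ ⊆ I →
    ∫ x in I, deriv φ x • u x = -∫ x in I, φ x • v x

/-- `t` is the one-sided limit, along `l`, of the continuous representative of `u ∈ L₂(I)`. -/
def HasBoundaryValue {I : Set ℝ} (l : Filter ℝ) (u : Lp ℂ 2 (volume.restrict I)) (t : ℂ) : Prop :=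
  ∃ g : ℝ → ℂ, ContinuousOn g I ∧ u =ᵐ[volume.restrict I] g ∧ Tendsto g l (𝓝 t)

section WeakDeriv

variable {I : Set ℝ}

theorem integrable_test_smul (u : Lp ℂ 2 (volume.restrict I)) {φ : ℝ → ℝ}
    (h1 : Continuous φ) (h2 : HasCompactSupport φ) :
    Integrable (fun x => φ x • u x) (volume.restrict I) :=
  ((Lp.memLp u).locallyIntegrable (by norm_num)).integrable_smul_left_of_hasCompactSupport h1 h2

theorem IsWeakDeriv.add {u v u' v' : Lp ℂ 2 (volume.restrict I)}
    (h : IsWeakDeriv u v) (h' : IsWeakDeriv u' v') : IsWeakDeriv (u + u') (v + v') := by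
  intro φ h1 h2 h3
  have hd : Continuous (deriv φ) := h1.continuous_deriv (by simp)
  have e1 : ∫ x in I, deriv φ x • (u + u' : Lp ℂ 2 (volume.restrict I)) x
      = ∫ x in I, (deriv φ x • u x + deriv φ x • u' x) := by
    refine integral_congr_ae ?_
    filter_upwards [Lp.coeFn_add u u'] with x hx
    rw [hx, Pi.add_apply, smul_add]
  have e2 : ∫ x in I, φ x • (v + v' : Lp ℂ 2 (volume.restrict I)) x
      = ∫ x in I, (φ x • v x + φ x • v' x) := by
    refine integral_congr_ae ?_
    filter_upwards [Lp.coeFn_add v v'] with x hx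
    rw [hx, Pi.add_apply, smul_add]
  rw [e1, e2, integral_add (integrable_test_smul u hd h2.deriv)
    (integrable_test_smul u' hd h2.deriv), integral_add (integrable_test_smul v h1.continuous h2)
    (integrable_test_smul v' h1.continuous h2), h φ h1 h2 h3, h' φ h1 h2 h3]
  ring

theorem IsWeakDeriv.smul {u v : Lp ℂ 2 (volume.restrict I)} (k : ℂ)
    (h : IsWeakDeriv u v) : IsWeakDeriv (k • u) (k • v) := by
  intro φ h1 h2 h3
  have e1 : ∫ x in I, deriv φ x • (k • u : Lp ℂ 2 (volume.restrict I)) x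
      = ∫ x in I, k • (deriv φ x • u x) := by
    refine integral_congr_ae ?_
    filter_upwards [Lp.coeFn_smul k u] with x hx
    rw [hx, Pi.smul_apply, smul_comm]
  have e2 : ∫ x in I, φ x • (k • v : Lp ℂ 2 (volume.restrict I)) x
      = ∫ x in I, k • (φ x • v x) := by
    refine integral_congr_ae ?_
    filter_upwards [Lp.coeFn_smul k v] with x hx
    rw [hx, Pi.smul_apply, smul_comm]
  rw [e1, e2, integral_smul, integral_smul, h φ h1 h2 h3, smul_neg]

theorem IsWeakDeriv.zero : IsWeakDeriv (0 : Lp ℂ 2 (volume.restrict I)) 0 := by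
  have hz : ∀ ψ : ℝ → ℝ, ∫ x in I, ψ x • (0 : Lp ℂ 2 (volume.restrict I)) x = 0 := by
    intro ψ
    refine integral_eq_zero_of_ae ?_
    filter_upwards [Lp.coeFn_zero ℂ 2 (volume.restrict I)] with x hx
    rw [hx]; simp
  intro φ _ _ _
  rw [hz, hz, neg_zero]

/-- The weak derivative is unique. -/
theorem IsWeakDeriv.eq_zero (hI : IsOpen I) {v : Lp ℂ 2 (volume.restrict I)}
    (h : IsWeakDeriv 0 v) : v = 0 := by
  have hloc : LocallyIntegrableOn v I volume :=
    locallyIntegrableOn_of_locallyIntegrable_restrict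
      ((Lp.memLp v).locallyIntegrable (by norm_num))
  have hae := hI.ae_eq_zero_of_integral_contDiff_smul_eq_zero hloc (fun φ h1 h2 h3 => by
    have h0 : ∫ x in I, deriv φ x • (0 : Lp ℂ 2 (volume.restrict I)) x = 0 := by
      refine integral_eq_zero_of_ae ?_
      filter_upwards [Lp.coeFn_zero ℂ 2 (volume.restrict I)] with x hx
      rw [hx]; simp
    have := h φ h1 h2 h3
    rw [h0] at this
    rw [← setIntegral_eq_integral_of_forall_compl_eq_zero (s := I)]
    · exact (neg_eq_zero.1 this.symm)
    · intro x hx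
      rw [image_eq_zero_of_notMem_tsupport (fun hx' => hx (h3 hx')), zero_smul])
  refine Lp.ext ?_
  have : ∀ᵐ x ∂(volume.restrict I), v x = 0 := (ae_restrict_iff' hI.measurableSet).2 hae
  filter_upwards [this, Lp.coeFn_zero ℂ 2 (volume.restrict I)] with x hx hx'
  rw [hx, hx']; rfl

theorem HasBoundaryValue.add {l : Filter ℝ} {u u' : Lp ℂ 2 (volume.restrict I)} {t t' : ℂ}
    (h : HasBoundaryValue l u t) (h' : HasBoundaryValue l u' t') :
    HasBoundaryValue l (u + u') (t + t') := by
  obtain ⟨g, h1, h2, h3⟩ := h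
  obtain ⟨g', h1', h2', h3'⟩ := h'
  refine ⟨g + g', h1.add h1', ?_, h3.add h3'⟩
  exact (Lp.coeFn_add u u').trans (h2.add h2')

theorem HasBoundaryValue.smul {l : Filter ℝ} {u : Lp ℂ 2 (volume.restrict I)} {t : ℂ} (k : ℂ)
    (h : HasBoundaryValue l u t) : HasBoundaryValue l (k • u) (k • t) := by
  obtain ⟨g, h1, h2, h3⟩ := h
  refine ⟨k • g, h1.const_smul k, ?_, h3.const_smul k⟩
  exact (Lp.coeFn_smul k u).trans (h2.const_smul k)

theorem HasBoundaryValue.zero {l : Filter ℝ} :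
    HasBoundaryValue l (0 : Lp ℂ 2 (volume.restrict I)) 0 :=
  ⟨fun _ => 0, continuousOn_const, Lp.coeFn_zero ℂ 2 _, tendsto_const_nhds⟩

end WeakDeriv

namespace MetricGraph

variable {V E : Type*} (Γ : MetricGraph V E)

variable {Γ} in
theorem H.add_apply (u v : Γ.H) (e : E) : (u + v) e = u e + v e := by
  rw [lp.coeFn_add, Pi.add_apply]

variable {Γ} in
theorem H.smul_apply (k : ℂ) (u : Γ.H) (e : E) : (k • u) e = k • u e := by
  rw [lp.coeFn_smul, Pi.smul_apply]

variable {Γ} in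
theorem H.zero_apply (e : E) : (0 : Γ.H) e = 0 := by
  rw [lp.coeFn_zero, Pi.zero_apply]

/-- `v = u'` edgewise in the weak sense, with `u, v ∈ ⨁_e L₂(a e, b e)`. -/
def IsDeriv (u v : Γ.H) : Prop := ∀ e, IsWeakDeriv (u e) (v e)

variable {Γ} in
theorem IsDeriv.zero : Γ.IsDeriv 0 0 := fun e => by
  rw [H.zero_apply]; exact IsWeakDeriv.zero

variable {Γ} in
theorem IsDeriv.add {u v u' v' : Γ.H} (h : Γ.IsDeriv u v) (h' : Γ.IsDeriv u' v') :
    Γ.IsDeriv (u + u') (v + v') := fun e => by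
  rw [H.add_apply, H.add_apply]; exact (h e).add (h' e)

variable {Γ} in
theorem IsDeriv.smul {u v : Γ.H} (k : ℂ) (h : Γ.IsDeriv u v) :
    Γ.IsDeriv (k • u) (k • v) := fun e => by
  rw [H.smul_apply, H.smul_apply]; exact (h e).smul k

variable {Γ} in
theorem IsDeriv.eq_zero {v : Γ.H} (h : Γ.IsDeriv 0 v) : v = 0 := by
  apply lp.ext
  funext e
  have := h e
  rw [H.zero_apply] at this
  exact (this.eq_zero (Γ.isOpen_edge e)).trans (H.zero_apply e).symm

/-- `u` and its first three weak derivatives `u₁, u₂, u₃` all lie in `⨁_e L₂(a e, b e)`, that is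
`u ∈ ⨁_e W₂³(a e, b e)`, and `f e = α e u₃ e + β e u₁ e`. -/
def IsMax (c : AiryCoefficients E) (u f : Γ.H) : Prop :=
  ∃ u₁ u₂ u₃ : Γ.H, Γ.IsDeriv u u₁ ∧ Γ.IsDeriv u₁ u₂ ∧ Γ.IsDeriv u₂ u₃ ∧
    ∀ e, f e = (c.α e : ℂ) • u₃ e + (c.β e : ℂ) • u₁ e

/-- The graph of the maximal operator. -/
def maxGraph (c : AiryCoefficients E) : Submodule ℂ (Γ.H × Γ.H) where
  carrier := {p | Γ.IsMax c p.1 p.2}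
  zero_mem' := ⟨0, 0, 0, IsDeriv.zero, IsDeriv.zero, IsDeriv.zero, fun e => by
    simp only [Prod.snd_zero, H.zero_apply, smul_zero, add_zero]⟩
  add_mem' := by
    rintro ⟨u, f⟩ ⟨v, g⟩ ⟨u₁, u₂, u₃, h1, h2, h3, h4⟩ ⟨v₁, v₂, v₃, k1, k2, k3, k4⟩
    refine ⟨u₁ + v₁, u₂ + v₂, u₃ + v₃, h1.add k1, h2.add k2, h3.add k3, fun e => ?_⟩
    simp only at h4 k4
    simp only [Prod.mk_add_mk, H.add_apply, h4, k4, smul_add]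
    exact add_add_add_comm _ _ _ _
  smul_mem' := by
    rintro k ⟨u, f⟩ ⟨u₁, u₂, u₃, h1, h2, h3, h4⟩
    refine ⟨k • u₁, k • u₂, k • u₃, h1.smul k, h2.smul k, h3.smul k, fun e => ?_⟩
    simp only at h4
    simp only [Prod.smul_mk, H.smul_apply, h4, smul_add]
    rw [smul_comm k (c.α e : ℂ), smul_comm k (c.β e : ℂ)]

theorem maxGraph_single (c : AiryCoefficients E) (p : Γ.H × Γ.H) (hp : p ∈ Γ.maxGraph c)
    (h : p.1 = 0) : p.2 = 0 := by
  obtain ⟨u, f⟩ := p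
  obtain ⟨u₁, u₂, u₃, h1, h2, h3, h4⟩ := hp
  simp only at h h1 h4 ⊢
  subst h
  have e1 : u₁ = 0 := h1.eq_zero
  subst e1
  have e2 : u₂ = 0 := h2.eq_zero
  subst e2
  have e3 : u₃ = 0 := h3.eq_zero
  subst e3
  apply lp.ext
  funext e
  rw [h4 e]
  simp only [H.zero_apply, smul_zero, add_zero]

/-- The maximal operator `Â u = α u''' + β u'` with domain `⨁_e W₂³(a e, b e)`. -/
def maxOperator (c : AiryCoefficients E) : Γ.H →ₗ.[ℂ] Γ.H := (Γ.maxGraph c).toLinearPMap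

theorem maxOperator_graph (c : AiryCoefficients E) : (Γ.maxOperator c).graph = Γ.maxGraph c :=
  Submodule.toLinearPMap_graph_eq _ (Γ.maxGraph_single c)

/-- `x` is the vector `(u(b e -))_e` of left limits at the finite termination points. -/
def IsTraceR (u : Γ.H) (x : lp (fun _ : Γ.Er => ℂ) 2) : Prop :=
  ∀ e : Γ.Er, HasBoundaryValue (𝓝[<] (Γ.b e).toReal) (u e) (x e)

/-- `y` is the vector `(u(a e +))_e` of right limits at the finite starting points. -/
def IsTraceL (u : Γ.H) (y : lp (fun _ : Γ.El => ℂ) 2) : Prop :=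
  ∀ e : Γ.El, HasBoundaryValue (𝓝[>] (Γ.a e).toReal) (u e) (y e)

/-- The linear relation `u ↦ (Tr_r u, Tr_l u)`: there are `u', u''` in the Hilbert space, and
`x = (tr_r u, tr_r u', tr_r u'')`, `y = (tr_l u, tr_l u', tr_l u'')`. -/
def IsTrace (u : Γ.H) (x : L2Cube Γ.Er) (y : L2Cube Γ.El) : Prop :=
  ∃ u₁ u₂ : Γ.H, Γ.IsDeriv u u₁ ∧ Γ.IsDeriv u₁ u₂ ∧
    (Γ.IsTraceR u (x 0) ∧ Γ.IsTraceR u₁ (x 1) ∧ Γ.IsTraceR u₂ (x 2)) ∧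
    (Γ.IsTraceL u (y 0) ∧ Γ.IsTraceL u₁ (y 1) ∧ Γ.IsTraceL u₂ (y 2))

variable {Γ}

theorem IsTraceR.zero : Γ.IsTraceR 0 0 := fun e => by
  rw [H.zero_apply]; exact HasBoundaryValue.zero

theorem IsTraceR.add {u u' : Γ.H} {x x' : lp (fun _ : Γ.Er => ℂ) 2}
    (h : Γ.IsTraceR u x) (h' : Γ.IsTraceR u' x') :
    Γ.IsTraceR (u + u') (x + x') := fun e => by
  rw [H.add_apply]; exact (h e).add (h' e)

theorem IsTraceR.smul {u : Γ.H} {x : lp (fun _ : Γ.Er => ℂ) 2} (k : ℂ)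
    (h : Γ.IsTraceR u x) : Γ.IsTraceR (k • u) (k • x) := fun e => by
  rw [H.smul_apply]; exact (h e).smul k

theorem IsTraceL.zero : Γ.IsTraceL 0 0 := fun e => by
  rw [H.zero_apply]; exact HasBoundaryValue.zero

theorem IsTraceL.add {u u' : Γ.H} {x x' : lp (fun _ : Γ.El => ℂ) 2}
    (h : Γ.IsTraceL u x) (h' : Γ.IsTraceL u' x') :
    Γ.IsTraceL (u + u') (x + x') := fun e => by
  rw [H.add_apply]; exact (h e).add (h' e)

theorem IsTraceL.smul {u : Γ.H} {x : lp (fun _ : Γ.El => ℂ) 2} (k : ℂ)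
    (h : Γ.IsTraceL u x) : Γ.IsTraceL (k • u) (k • x) := fun e => by
  rw [H.smul_apply]; exact (h e).smul k

theorem IsTrace.zero : Γ.IsTrace 0 0 0 :=
  ⟨0, 0, IsDeriv.zero, IsDeriv.zero, ⟨IsTraceR.zero, IsTraceR.zero, IsTraceR.zero⟩,
    ⟨IsTraceL.zero, IsTraceL.zero, IsTraceL.zero⟩⟩

theorem IsTrace.add {u u' : Γ.H} {x x' : L2Cube Γ.Er} {y y' : L2Cube Γ.El}
    (h : Γ.IsTrace u x y) (h' : Γ.IsTrace u' x' y') :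
    Γ.IsTrace (u + u') (x + x') (y + y') := by
  obtain ⟨u₁, u₂, h1, h2, ⟨r0, r1, r2⟩, ⟨l0, l1, l2⟩⟩ := h
  obtain ⟨v₁, v₂, k1, k2, ⟨s0, s1, s2⟩, ⟨m0, m1, m2⟩⟩ := h'
  exact ⟨u₁ + v₁, u₂ + v₂, h1.add k1, h2.add k2, ⟨r0.add s0, r1.add s1, r2.add s2⟩,
    ⟨l0.add m0, l1.add m1, l2.add m2⟩⟩

theorem IsTrace.smul {u : Γ.H} {x : L2Cube Γ.Er} {y : L2Cube Γ.El} (k : ℂ)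
    (h : Γ.IsTrace u x y) : Γ.IsTrace (k • u) (k • x) (k • y) := by
  obtain ⟨u₁, u₂, h1, h2, ⟨r0, r1, r2⟩, ⟨l0, l1, l2⟩⟩ := h
  exact ⟨k • u₁, k • u₂, h1.smul k, h2.smul k, ⟨r0.smul k, r1.smul k, r2.smul k⟩,
    ⟨l0.smul k, l1.smul k, l2.smul k⟩⟩

/-- All `u` with `Tr_r u ∈ D(L)` and `L (Tr_r u) = Tr_l u`. -/
def boundaryCondition (L : L2Cube Γ.Er →ₗ.[ℂ] L2Cube Γ.El) : Submodule ℂ Γ.H where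
  carrier := {u | ∃ x : L.domain, Γ.IsTrace u x (L x)}
  zero_mem' := ⟨0, by simpa using (IsTrace.zero : Γ.IsTrace 0 0 0)⟩
  add_mem' := by
    rintro u v ⟨x, hx⟩ ⟨y, hy⟩
    exact ⟨x + y, by rw [LinearPMap.map_add]; exact hx.add hy⟩
  smul_mem' := by
    rintro k u ⟨x, hx⟩
    exact ⟨k • x, by rw [LinearPMap.map_smul]; exact hx.smul k⟩

/-- The operator `A_L`: the restriction of the maximal operator `Â` to
`{u ∈ D(Â) | Tr_r u ∈ D(L), L (Tr_r u) = Tr_l u}`. -/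
def airyOperator (c : AiryCoefficients E) (L : L2Cube Γ.Er →ₗ.[ℂ] L2Cube Γ.El) :
    Γ.H →ₗ.[ℂ] Γ.H :=
  (Γ.maxOperator c).domRestrict (boundaryCondition L)

end MetricGraph

/-! ## Indefinite inner products given by a Gram operator -/

section Krein

variable {K K' : Type*} [NormedAddCommGroup K] [InnerProductSpace ℂ K]
  [NormedAddCommGroup K'] [InnerProductSpace ℂ K']

/-- The form `⟨x | y⟩ = (B x | y)`, linear in `x` and conjugate linear in `y`. -/
def kreinForm (B : K →ₗ[ℂ] K) (x y : K) : ℂ := inner ℂ y (B x)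

/-- The graph of the adjoint `L^♯` of `L` with respect to the forms given by `B` and `B'`: all
`(y, z)` with `⟨L x | y⟩ = ⟨x | z⟩` for all `x ∈ D(L)`. -/
def kreinAdjointGraph (B : K →ₗ[ℂ] K) (B' : K' →ₗ[ℂ] K') (L : K →ₗ.[ℂ] K') :
    Submodule ℂ (K' × K) where
  carrier := {p | ∀ x : L.domain, kreinForm B' (L x) p.1 = kreinForm B x p.2}
  zero_mem' := fun x => by simp [kreinForm]
  add_mem' := fun hp hq x => by
    have h1 := hp x
    have h2 := hq x
    simp only [kreinForm, Prod.fst_add, Prod.snd_add, inner_add_left] at h1 h2 ⊢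
    rw [h1, h2]
  smul_mem' := fun k p hp x => by
    have h1 := hp x
    simp only [kreinForm, Prod.smul_fst, Prod.smul_snd, inner_smul_left] at h1 ⊢
    rw [h1]

/-- The adjoint `L^♯` of `L` with respect to the forms given by `B` and `B'`. -/
def kreinAdjoint (B : K →ₗ[ℂ] K) (B' : K' →ₗ[ℂ] K') (L : K →ₗ.[ℂ] K') : K' →ₗ.[ℂ] K :=
  (kreinAdjointGraph B B' L).toLinearPMap

theorem kreinAdjoint_graph {B : K →ₗ[ℂ] K} {B' : K' →ₗ[ℂ] K'} {L : K →ₗ.[ℂ] K'}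
    (hs : B.IsSymmetric) (hi : Function.Injective B) (hL : Dense (L.domain : Set K)) :
    (kreinAdjoint B B' L).graph = kreinAdjointGraph B B' L := by
  refine Submodule.toLinearPMap_graph_eq _ fun p hp h0 => ?_
  refine hi ?_
  rw [map_zero]
  refine hL.eq_zero_of_inner_left ℂ fun v hv => ?_
  have := hp ⟨v, hv⟩
  rw [h0] at this
  simp only [kreinForm, inner_zero_left] at this
  rw [hs p.2 v]
  exact this.symm

/-- `L` is a contraction with respect to the forms given by `B` and `B'`:
`⟨L x | L x⟩ ≤ ⟨x | x⟩` for all `x ∈ D(L)`. -/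
def IsKreinContraction (B : K →ₗ[ℂ] K) (B' : K' →ₗ[ℂ] K') (L : K →ₗ.[ℂ] K') : Prop :=
  ∀ x : L.domain, (kreinForm B' (L x) (L x)).re ≤ (kreinForm B (x : K) (x : K)).re

end Krein

/-! ## The boundary Krein spaces -/

section Boundary

variable {ι E : Type*}

/-- Multiplication by a bounded real function on `ℓ₂(ι)`. -/
def mulOp (m : ι → ℝ) (hm : ∃ C : ℝ, ∀ i, |m i| ≤ C) :
    lp (fun _ : ι => ℂ) 2 →ₗ[ℂ] lp (fun _ : ι => ℂ) 2 where
  toFun x := ⟨fun i => (m i : ℂ) * x i, by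
    obtain ⟨C, hC⟩ := hm
    refine ((lp.memℓp x).const_smul (C : ℂ)).mono' ?_
    intro i
    simp only [Pi.smul_apply, norm_mul, norm_smul, Complex.norm_real, Real.norm_eq_abs]
    exact mul_le_mul_of_nonneg_right ((hC i).trans (le_abs_self C)) (norm_nonneg _)⟩
  map_add' x y := by
    apply lp.ext; funext i
    exact mul_add _ _ _
  map_smul' k x := by
    apply lp.ext; funext i
    exact mul_left_comm _ _ _

theorem mulOp_apply (m : ι → ℝ) (hm : ∃ C : ℝ, ∀ i, |m i| ≤ C) (x : lp (fun _ : ι => ℂ) 2)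
    (i : ι) : mulOp m hm x i = (m i : ℂ) * x i := rfl

/-- The Gram operator on `ℓ₂(ι)³` given by the block matrix
`(-β, 0, -α; 0, α, 0; -α, 0, 0)`, where `ι` is mapped to the set of edges by `s`. -/
def gramOp (c : AiryCoefficients E) (s : ι → E) : L2Cube ι →ₗ[ℂ] L2Cube ι :=
  let α := mulOp (fun i => c.α (s i)) (c.α_bounded.imp fun _ h i => h (s i))
  let β := mulOp (fun i => c.β (s i)) (c.β_bounded.imp fun _ h i => h (s i))
  { toFun := fun x => WithLp.toLp 2 ![-β (x 0) - α (x 2), α (x 1), -α (x 0)]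
    map_add' := fun x y => by
      ext j : 1
      fin_cases j <;> simp <;> abel
    map_smul' := fun k x => by
      ext j : 1
      fin_cases j <;> simp [smul_sub] }

theorem mulOp_symmetric (m : ι → ℝ) (hm : ∃ C : ℝ, ∀ i, |m i| ≤ C) :
    (mulOp m hm).IsSymmetric := by
  intro x y
  rw [lp.inner_eq_tsum, lp.inner_eq_tsum]
  refine tsum_congr fun i => ?_
  simp only [mulOp_apply, RCLike.inner_apply, map_mul, Complex.conj_ofReal]
  ring

theorem gramOp_symmetric (c : AiryCoefficients E) (s : ι → E) : (gramOp c s).IsSymmetric := by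
  intro x y
  have hs := mulOp_symmetric (fun i => c.α (s i)) (c.α_bounded.imp fun _ h i => h (s i))
  have ht := mulOp_symmetric (fun i => c.β (s i)) (c.β_bounded.imp fun _ h i => h (s i))
  simp only [PiLp.inner_apply, Fin.sum_univ_three, gramOp, LinearMap.coe_mk, AddHom.coe_mk,
    Matrix.cons_val, inner_sub_left, inner_sub_right, inner_neg_left, inner_neg_right,
    hs _ _, ht _ _]
  ring

theorem gramOp_injective (c : AiryCoefficients E) (s : ι → E) :
    Function.Injective (gramOp c s) := by
  refine (injective_iff_map_eq_zero _).2 fun x hx => ?_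
  have hα : ∀ i, (c.α (s i) : ℂ) ≠ 0 := fun i =>
    Complex.ofReal_ne_zero.2 (c.α_pos (s i)).ne'
  have hc : ∀ (j : Fin 3) (i : ι), (gramOp c s x) j i = 0 := fun j i => by rw [hx]; rfl
  have h0 : ∀ i, x 0 i = 0 := fun i => by
    simpa [gramOp, mulOp_apply, hα i] using hc 2 i
  have h1 : ∀ i, x 1 i = 0 := fun i => by
    simpa [gramOp, mulOp_apply, hα i] using hc 1 i
  have h2 : ∀ i, x 2 i = 0 := fun i => by
    simpa [gramOp, mulOp_apply, hα i, h0 i] using hc 0 i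
  ext j : 1
  apply lp.ext
  funext i
  fin_cases j
  · exact h0 i
  · exact h1 i
  · exact h2 i

end Boundary

namespace MetricGraph

variable {V E : Type*} (Γ : MetricGraph V E)

/-- The Gram operator `B_l` of the Krein space `𝒦_l` on `ℓ₂(E_l)³`. -/
def Bl (c : AiryCoefficients E) : L2Cube Γ.El →ₗ[ℂ] L2Cube Γ.El := gramOp c Subtype.val

/-- The Gram operator `B_r` of the Krein space `𝒦_r` on `ℓ₂(E_r)³`. -/
def Br (c : AiryCoefficients E) : L2Cube Γ.Er →ₗ[ℂ] L2Cube Γ.Er := gramOp c Subtype.val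

end MetricGraph

/-! ## Semigroups -/

/-- A `C₀`-semigroup of contractions on a complex normed space. -/
structure ContractionSemigroup (X : Type*) [NormedAddCommGroup X] [NormedSpace ℂ X] where
  T : ℝ≥0 → X →L[ℂ] X
  map_zero : T 0 = ContinuousLinearMap.id ℂ X
  map_add : ∀ s t, T (s + t) = (T s).comp (T t)
  continuous_orbit : ∀ x, Continuous fun t => T t x
  norm_le_one : ∀ t, ‖T t‖ ≤ 1

/-- `A` is the generator of the semigroup `S`: `x ∈ D(A)` and `A x = y` if and only if
`(T(t) x - x) / t → y` as `t → 0+`. -/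
def ContractionSemigroup.IsGenerator {X : Type*} [NormedAddCommGroup X] [NormedSpace ℂ X]
    (S : ContractionSemigroup X) (A : X →ₗ.[ℂ] X) : Prop :=
  ∀ x y : X, (x, y) ∈ A.graph ↔
    Tendsto (fun t : ℝ≥0 => ((t : ℝ) : ℂ)⁻¹ • (S.T t x - x)) (𝓝[>] 0) (𝓝 y)

/-- `A` is the generator of a `C₀`-semigroup of contractions. -/
def GeneratesContractionSemigroup {X : Type*} [NormedAddCommGroup X] [NormedSpace ℂ X]
    (A : X →ₗ.[ℂ] X) : Prop :=
  ∃ S : ContractionSemigroup X, S.IsGenerator A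

end

/-! Three integrations by parts for the third-order term and one for the first-order term, on every
edge, give the Lagrange identity (Âu | v) + (u | Âv) = ⟨Tr_l u | Tr_l v⟩_l − ⟨Tr_r u | Tr_r v⟩_r
(`IsMax.lagrange`). The Gram matrices are exactly what the boundary terms dictate. On the diagonal,
2 Re (Âu | u) = ⟨Tr_l u | Tr_l u⟩_l − ⟨Tr_r u | Tr_r u⟩_r. Every pair of vectors in ℓ₂(E_r)³ ×
ℓ₂(E_l)³ is the trace of some u in D(Â) (`exists_isMax_isTrace`), so A_L is dissipative exactly when
L is contractive.

The identity also shows that the adjoint of A_L is the restriction of −Â to those v with Tr_l v in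
D(L^♯) and L^♯ Tr_l v = Tr_r v (`adjoint_airyOperator` gives one inclusion,
`inner_add_inner_eq_zero` the other). Because of the sign of −Â, the adjoint is dissipative exactly
when L^♯ is contractive. The theorem thus becomes the criterion that a closed densely defined
operator generates a contraction semigroup if and only if it and its adjoint are dissipative. That
criterion is proved by Yosida approximation (`generatesContractionSemigroup`), a range argument
(`exists_smul_sub_eq`), and a direct estimate for the adjoint of a generator
(`re_inner_adjoint_nonpos`).

The analytic core is the regularity statement `isMax_of_isWeakAirySolution`: if α v''' + β v' = w
holds only in the distributional sense, then v lies in ⨁ W₂³. Bounds for v' and v'' are needed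
uniformly over all edges. They come from testing the equation with short one-sided convolutions of
test functions, which fit into every edge because the lengths are bounded below. The same lower
bound puts the traces into ℓ₂. -/

noncomputable section

/-! ### Exponentials of bounded dissipative operators. -/

section Exponential

variable {H : Type*} [NormedAddCommGroup H] [InnerProductSpace ℂ H] [CompleteSpace H]

theorem exp_smul_add (B : H →L[ℂ] H) (s t : ℝ) :
    NormedSpace.exp ((s + t) • B) = NormedSpace.exp (s • B) * NormedSpace.exp (t • B) := by
  let _ : NormedAlgebra ℚ (H →L[ℂ] H) := NormedAlgebra.restrictScalars ℚ ℂ _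
  rw [add_smul, NormedSpace.exp_add_of_commute]
  exact ((Commute.refl B).smul_left s).smul_right t

theorem hasDerivAt_exp_smul_apply (B : H →L[ℂ] H) (x : H) (t : ℝ) :
    HasDerivAt (fun s : ℝ => NormedSpace.exp (s • B) x) (NormedSpace.exp (t • B) (B x)) t := by
  have h := hasDerivAt_exp_smul_const B t
  exact ((ContinuousLinearMap.apply ℂ H x).restrictScalars ℝ).hasFDerivAt.comp_hasDerivAt t h

theorem hasDerivAt_exp_smul_apply' (B : H →L[ℂ] H) (x : H) (t : ℝ) :
    HasDerivAt (fun s : ℝ => NormedSpace.exp (s • B) x) (B (NormedSpace.exp (t • B) x)) t := by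
  have h := hasDerivAt_exp_smul_const' B t
  exact ((ContinuousLinearMap.apply ℂ H x).restrictScalars ℝ).hasFDerivAt.comp_hasDerivAt t h

/-- The squared norm along the orbit u has derivative 2 Re (B u | u) ≤ 0. -/
theorem norm_exp_smul_apply_le (B : H →L[ℂ] H) (hB : ∀ x, (inner ℂ x (B x)).re ≤ 0) (x : H)
    {t : ℝ} (ht : 0 ≤ t) : ‖NormedSpace.exp (t • B) x‖ ≤ ‖x‖ := by
  let _ : InnerProductSpace ℝ H := InnerProductSpace.rclikeToReal ℂ H
  have hd : ∀ s : ℝ, HasDerivAt (fun s : ℝ => ‖NormedSpace.exp (s • B) x‖ ^ 2)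
      (2 * inner ℝ (NormedSpace.exp (s • B) x) (B (NormedSpace.exp (s • B) x))) s :=
    fun s => (hasDerivAt_exp_smul_apply' B x s).norm_sq
  have hanti : Antitone (fun s : ℝ => ‖NormedSpace.exp (s • B) x‖ ^ 2) := by
    refine antitone_of_deriv_nonpos (fun s => (hd s).differentiableAt) fun s => ?_
    rw [(hd s).deriv]
    have := hB (NormedSpace.exp (s • B) x)
    have h2 : inner ℝ (NormedSpace.exp (s • B) x) (B (NormedSpace.exp (s • B) x)) ≤ 0 := this
    linarith
  have := hanti ht
  simp only [zero_smul, NormedSpace.exp_zero, one_apply_eq_self] at this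
  exact (sq_le_sq₀ (norm_nonneg _) (norm_nonneg _)).1 this

theorem commute_exp_smul {B C : H →L[ℂ] H} (h : Commute B C) (t : ℝ) :
    Commute C (NormedSpace.exp (t • B)) :=
  (Commute.exp_right (h.symm.smul_right t) )

/-- The curve s ↦ e^{sB} e^{(t−s)C} x joins e^{tC} x to e^{tB} x. By commutativity its derivative is
e^{sB} e^{(t−s)C} (B − C) x, and both exponentials are contractions. -/
theorem norm_exp_smul_sub_exp_smul_le {B C : H →L[ℂ] H} (hB : ∀ x, (inner ℂ x (B x)).re ≤ 0)
    (hC : ∀ x, (inner ℂ x (C x)).re ≤ 0) (h : Commute B C) (x : H) {t : ℝ} (ht : 0 ≤ t) :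
    ‖NormedSpace.exp (t • B) x - NormedSpace.exp (t • C) x‖ ≤ t * ‖B x - C x‖ := by
  have hd : ∀ s : ℝ, HasDerivAt
      (fun s : ℝ => NormedSpace.exp (s • B) (NormedSpace.exp ((t - s) • C) x))
      (NormedSpace.exp (s • B) (NormedSpace.exp ((t - s) • C) (B x - C x))) s := by
    intro s
    have h1 := hasDerivAt_exp_smul_const B s
    have h2 : HasDerivAt (fun s : ℝ => NormedSpace.exp ((t - s) • C))
        (-(NormedSpace.exp ((t - s) • C) * C)) s := by
      have := (hasDerivAt_exp_smul_const C (t - s)).scomp s ((hasDerivAt_id s).const_sub t)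
      simpa [Function.comp_def] using this
    have h3 := h1.mul h2
    have h4 := ((ContinuousLinearMap.apply ℂ H x).restrictScalars ℝ).hasFDerivAt.comp_hasDerivAt
      s h3
    have hc : Commute B (NormedSpace.exp ((t - s) • C)) := commute_exp_smul h.symm _
    convert! h4 using 1
    simp only [ContinuousLinearMap.coe_restrictScalars', ContinuousLinearMap.apply_apply]
    rw [mul_assoc, hc.eq, mul_neg, ← sub_eq_add_neg, ← mul_sub, ← mul_sub]
    rfl
  have := norm_image_sub_le_of_norm_deriv_le_segment' (a := 0) (b := t) (C := ‖B x - C x‖)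
    (fun s _ => (hd s).hasDerivWithinAt) (fun s hs => ?_) t ⟨ht, le_rfl⟩
  · simpa [mul_comm] using this
  · exact (norm_exp_smul_apply_le B hB _ hs.1).trans
      (norm_exp_smul_apply_le C hC _ (by linarith [hs.2]))

end Exponential

/-! ### Dissipative operators and their resolvents. -/

section Dissipative

variable {H : Type*} [NormedAddCommGroup H] [InnerProductSpace ℂ H]

/-- `Re (A x | x) ≤ 0` on the domain of `A`. -/
def LinearPMap.Dissipative (A : H →ₗ.[ℂ] H) : Prop :=
  ∀ x : A.domain, (inner ℂ (x : H) (A x)).re ≤ 0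

/-- Pair `r x - A x` with `x` and apply the Cauchy–Schwarz inequality. -/
theorem LinearPMap.Dissipative.mul_norm_le {A : H →ₗ.[ℂ] H} (hA : A.Dissipative) (r : ℝ)
    (x : A.domain) : r * ‖(x : H)‖ ≤ ‖(r : ℂ) • (x : H) - A x‖ := by
  by_cases hx : ‖(x : H)‖ = 0
  · rw [hx, mul_zero]; exact norm_nonneg _
  have h1 : r * ‖(x : H)‖ ^ 2 ≤ (inner ℂ (x : H) ((r : ℂ) • (x : H) - A x)).re := by
    rw [inner_sub_right, inner_smul_right, Complex.sub_re, inner_self_eq_norm_sq_to_K]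
    have := hA x
    have h0 : ((r : ℂ) * (‖(x : H)‖ : ℂ) ^ 2).re = r * ‖(x : H)‖ ^ 2 := by
      rw [← Complex.ofReal_pow, ← Complex.ofReal_mul, Complex.ofReal_re]
    erw [h0]
    linarith
  have h2 := (Complex.re_le_norm _).trans (norm_inner_le_norm (𝕜 := ℂ) (x : H) ((r : ℂ) • (x : H) - A x))
  have h3 : 0 < ‖(x : H)‖ := lt_of_le_of_ne (norm_nonneg _) (Ne.symm hx)
  nlinarith

/-- The operators `J = r (r - A)⁻¹`. -/
theorem LinearPMap.Dissipative.exists_resolvent {A : H →ₗ.[ℂ] H} (hA : A.Dissipative) {r : ℝ}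
    (hr : 0 < r) (hs : ∀ y, ∃ x : A.domain, (r : ℂ) • (x : H) - A x = y) :
    ∃ J : H →L[ℂ] H, (∀ y, ‖J y‖ ≤ ‖y‖) ∧
      (∀ y, ∃ x : A.domain, (x : H) = J y ∧ A x = (r : ℂ) • (J y - y)) ∧
      ∀ x : A.domain, J ((r : ℂ) • (x : H) - A x) = (r : ℂ) • (x : H) := by
  have hrc : (r : ℂ) ≠ 0 := by exact_mod_cast hr.ne'
  let f : A.domain →ₗ[ℂ] H := (r : ℂ) • A.domain.subtype - A.toFun
  have hf : ∀ x : A.domain, f x = (r : ℂ) • (x : H) - A x := fun x => rfl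
  have hinj : Function.Injective f := by
    refine (injective_iff_map_eq_zero f).2 fun x hx => ?_
    have := hA.mul_norm_le r x
    rw [← hf, hx, norm_zero] at this
    have h0 : ‖(x : H)‖ = 0 := le_antisymm (by nlinarith) (norm_nonneg _)
    exact Subtype.ext (norm_eq_zero.1 h0)
  let e := LinearEquiv.ofBijective f ⟨hinj, hs⟩
  have he : ∀ y, f (e.symm y) = y := fun y => e.apply_symm_apply y
  have he' : ∀ x, e.symm (f x) = x := fun x => e.symm_apply_apply x
  let J0 : H →ₗ[ℂ] H := (r : ℂ) • (A.domain.subtype ∘ₗ e.symm.toLinearMap)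
  have hJ0 : ∀ y, J0 y = (r : ℂ) • ((e.symm y : A.domain) : H) := fun y => rfl
  have hb : ∀ y, ‖J0 y‖ ≤ 1 * ‖y‖ := fun y => by
    have := hA.mul_norm_le r (e.symm y)
    rw [← hf, he] at this
    rw [hJ0, norm_smul, one_mul, Complex.norm_real, Real.norm_of_nonneg hr.le]
    exact this
  refine ⟨J0.mkContinuous 1 hb, fun y => by simpa using hb y, fun y => ?_, fun x => ?_⟩
  · refine ⟨(r : ℂ) • e.symm y, rfl, ?_⟩
    rw [LinearPMap.map_smul]
    congr 1
    have := he y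
    rw [hf] at this
    rw [LinearMap.mkContinuous_apply, hJ0]
    nth_rewrite 3 [← this]
    abel
  · rw [LinearMap.mkContinuous_apply, hJ0, ← hf, he']

end Dissipative

section Resolvent

variable {H : Type*} [NormedAddCommGroup H] [InnerProductSpace ℂ H]

theorem resolvent_commute {A : H →ₗ.[ℂ] H} {r s : ℝ} (hr : r ≠ 0) (hs : s ≠ 0) {J K : H →L[ℂ] H}
    (hJ : ∀ y, ∃ x : A.domain, (x : H) = J y ∧ A x = (r : ℂ) • (J y - y))
    (hK : ∀ y, ∃ x : A.domain, (x : H) = K y ∧ A x = (s : ℂ) • (K y - y))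
    (hJ' : ∀ x : A.domain, J ((r : ℂ) • (x : H) - A x) = (r : ℂ) • (x : H))
    (hK' : ∀ x : A.domain, K ((s : ℂ) • (x : H) - A x) = (s : ℂ) • (x : H)) (y : H) :
    J (K y) = K (J y) := by
  have hrc : (r : ℂ) ≠ 0 := by exact_mod_cast hr
  have hsc : (s : ℂ) ≠ 0 := by exact_mod_cast hs
  obtain ⟨z, hz, hAz⟩ := hK y
  obtain ⟨u, hu, hAu⟩ := hJ (K y)
  have hAu' : A u = (r : ℂ) • ((u : H) - z) := by rw [hAu, hu, hz]
  have hAz' : A z = (s : ℂ) • ((z : H) - y) := by rw [hAz, hz]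
  -- Here u = J K y and z = K y. The vector p = s⁻¹ (s − A) u is what `K` maps to u. It lies in D(A)
  -- because A u = r (u − z), and (r − A) p = r y identifies it as `J y`.
  let p : A.domain := (s : ℂ)⁻¹ • ((s : ℂ) • u - (r : ℂ) • (u - z))
  have hp : (p : H) = (s : ℂ)⁻¹ • ((s : ℂ) • (u : H) - A u) := by
    rw [hAu']; rfl
  have hAp : A p = (s : ℂ)⁻¹ • ((s : ℂ) • A u - (r : ℂ) • (A u - A z)) := by
    simp only [p, LinearPMap.map_smul, LinearPMap.map_sub]
  have h1 : (r : ℂ) • (p : H) - A p = (r : ℂ) • y := by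
    rw [hp, hAp, hAz']
    have : (r : ℂ) • y = (s : ℂ)⁻¹ • ((s : ℂ) • (r : ℂ) • y) := by
      rw [inv_smul_smul₀ hsc]
    rw [this, smul_comm (r : ℂ) (s : ℂ)⁻¹, ← smul_sub]
    congr 1
    rw [hAu']
    module
  have h2 : J y = p := by
    have := hJ' p
    rw [h1, map_smul] at this
    exact smul_right_injective H hrc this
  have h3 := hK' u
  rw [h2, hp, map_smul, h3, inv_smul_smul₀ hsc, hu]

end Resolvent

/-! ### Yosida approximation and the Lumer–Phillips theorem. -/

section Density

variable {F G : Type*} [NormedAddCommGroup F] [NormedSpace ℂ F]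

theorem cauchySeq_of_dense {T : ℕ → F →L[ℂ] F} (hT : ∀ n x, ‖T n x‖ ≤ ‖x‖) {D : Set F}
    (hD : Dense D) (h : ∀ x ∈ D, CauchySeq fun n => T n x) (x : F) : CauchySeq fun n => T n x := by
  refine Metric.cauchySeq_iff'.2 fun ε hε => ?_
  obtain ⟨y, hy, hxy⟩ := hD.exists_dist_lt x (show 0 < ε / 3 by positivity)
  obtain ⟨N, hN⟩ := Metric.cauchySeq_iff'.1 (h y hy) (ε / 3) (by positivity)
  refine ⟨N, fun n hn => ?_⟩
  have h1 : ∀ n, dist (T n x) (T n y) ≤ dist x y := fun n => by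
    rw [dist_eq_norm, dist_eq_norm, ← map_sub]; exact hT n _
  have h2 := h1 N
  rw [dist_comm] at h2
  have := dist_triangle4 (T n x) (T n y) (T N y) (T N x)
  linarith [hN n hn, h1 n]

theorem eventually_small_of_dense {ι : Type*} {l : Filter ι} {T : ι → F →L[ℂ] F}
    (hT : ∀ᶠ i in l, ∀ x, ‖T i x‖ ≤ ‖x‖) {D : Set F} (hD : Dense D)
    (h : ∀ x ∈ D, Tendsto (fun i => T i x) l (𝓝 x)) (x : F) :
    Tendsto (fun i => T i x) l (𝓝 x) := by
  refine Metric.tendsto_nhds.2 fun ε hε => ?_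
  obtain ⟨y, hy, hxy⟩ := hD.exists_dist_lt x (show 0 < ε / 3 by positivity)
  filter_upwards [Metric.tendsto_nhds.1 (h y hy) (ε / 3) (by positivity), hT] with i hi hTi
  have h1 : dist (T i x) (T i y) ≤ dist x y := by
    rw [dist_eq_norm, dist_eq_norm, ← map_sub]; exact hTi _
  rw [dist_comm] at hxy
  have := dist_triangle4 (T i x) (T i y) y x
  rw [dist_comm x y] at h1
  linarith

end Density

namespace ContractionSemigroup

variable {H : Type*} [NormedAddCommGroup H] [InnerProductSpace ℂ H]

theorem norm_apply_le (S : ContractionSemigroup H) (t : ℝ≥0) (x : H) : ‖S.T t x‖ ≤ ‖x‖ := by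
  simpa using (S.T t).le_of_opNorm_le (S.norm_le_one t) x

theorem re_inner_nonpos_of_tendsto (S : ContractionSemigroup H) {x y : H}
    (h : Tendsto (fun t : ℝ≥0 => ((t : ℝ) : ℂ)⁻¹ • (S.T t x - x)) (𝓝[>] 0) (𝓝 y)) :
    (inner ℂ x y).re ≤ 0 := by
  have h1 : Tendsto (fun t : ℝ≥0 => (inner ℂ x (((t : ℝ) : ℂ)⁻¹ • (S.T t x - x))).re) (𝓝[>] 0)
      (𝓝 (inner ℂ x y).re) :=
    (Complex.continuous_re.tendsto _).comp (tendsto_const_nhds.inner h)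
  refine le_of_tendsto h1 (Eventually.of_forall fun t => ?_)
  rw [inner_smul_right, ← Complex.ofReal_inv, Complex.re_ofReal_mul]
  refine mul_nonpos_of_nonneg_of_nonpos (by positivity) ?_
  rw [inner_sub_right, Complex.sub_re]
  have h2 := (Complex.re_le_norm _).trans (norm_inner_le_norm (𝕜 := ℂ) x (S.T t x))
  have h3 := S.norm_apply_le t x
  have h4 : (inner ℂ x x).re = ‖x‖ * ‖x‖ := by
    have := inner_self_eq_norm_mul_norm (𝕜 := ℂ) x
    exact this
  rw [h4]
  nlinarith [norm_nonneg x]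

end ContractionSemigroup

section HilleYosida

variable {H : Type*} [NormedAddCommGroup H] [InnerProductSpace ℂ H]

/-- The bounded approximations of a dissipative operator. -/
theorem LinearPMap.Dissipative.exists_approximation {A : H →ₗ.[ℂ] H} (hA : A.Dissipative)
    (hD : Dense (A.domain : Set H))
    (hs : ∀ r : ℝ, 0 < r → ∀ y, ∃ x : A.domain, (r : ℂ) • (x : H) - A x = y) :
    ∃ B : ℕ → H →L[ℂ] H, (∀ n x, (inner ℂ x (B n x)).re ≤ 0) ∧ (∀ m n, Commute (B m) (B n)) ∧
      (∀ n (x : A.domain), ‖B n x‖ ≤ ‖A x‖) ∧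
      ∀ x : A.domain, Tendsto (fun n => B n x) atTop (𝓝 (A x)) := by
  have hpos : ∀ n : ℕ, (0 : ℝ) < n + 1 := fun n => by positivity
  choose J hJ1 hJ2 hJ3 using fun n : ℕ => hA.exists_resolvent (hpos n) (hs _ (hpos n))
  let B : ℕ → H →L[ℂ] H := fun n => (((n + 1 : ℝ) : ℝ) : ℂ) • (J n - 1)
  have hB : ∀ n x, B n x = (((n + 1 : ℝ) : ℝ) : ℂ) • (J n x - x) := fun n x => rfl
  -- On D(A) the Yosida approximation r (J − 1), with r = n + 1, equals J A. Hence it is bounded by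
  -- `‖A x‖` and converges to `A x` as soon as `J n` tends strongly to the identity.
  have hBA : ∀ n (x : A.domain), B n x = J n (A x) := fun n x => by
    have := hJ3 n x
    rw [_root_.map_sub, _root_.map_smul] at this
    rw [hB, smul_sub, ← this, sub_sub_cancel]
  have hJlim : ∀ y, Tendsto (fun n => J n y) atTop (𝓝 y) := by
    refine eventually_small_of_dense (Eventually.of_forall hJ1) hD fun x hx => ?_
    rw [tendsto_iff_norm_sub_tendsto_zero]
    -- For x in D(A), (n + 1) (J_n x − x) = J_n A x gives ‖J_n x − x‖ ≤ ‖A x‖ / (n + 1).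
    have h0 : Tendsto (fun n : ℕ => (1 / ((n : ℝ) + 1)) * ‖A ⟨x, hx⟩‖) atTop (𝓝 0) := by
      simpa using (tendsto_one_div_add_atTop_nhds_zero_nat (𝕜 := ℝ)).mul_const ‖A ⟨x, hx⟩‖
    refine squeeze_zero (fun n => norm_nonneg _) (fun n => ?_) h0
    have h1 := hBA n ⟨x, hx⟩
    have h2 := hJ1 n (A ⟨x, hx⟩)
    rw [← h1, hB, norm_smul, Complex.norm_real, Real.norm_of_nonneg (hpos n).le] at h2
    rw [one_div, ← div_eq_inv_mul, le_div_iff₀ (hpos n), mul_comm]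
    exact h2
  refine ⟨B, fun n x => ?_, fun m n => ?_, fun n x => ?_, fun x => ?_⟩
  · rw [hB, inner_smul_right, Complex.re_ofReal_mul]
    refine mul_nonpos_of_nonneg_of_nonpos (hpos n).le ?_
    rw [inner_sub_right, Complex.sub_re]
    have h2 := (Complex.re_le_norm _).trans (norm_inner_le_norm (𝕜 := ℂ) x (J n x))
    have h4 : (inner ℂ x x).re = ‖x‖ * ‖x‖ := inner_self_eq_norm_mul_norm (𝕜 := ℂ) x
    rw [h4]
    nlinarith [norm_nonneg x, hJ1 n x]
  · have hc : Commute (J m) (J n) := ContinuousLinearMap.ext fun y =>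
      resolvent_commute (hpos m).ne' (hpos n).ne' (hJ2 m) (hJ2 n) (hJ3 m) (hJ3 n) y
    exact (((hc.sub_left (Commute.one_left _)).sub_right (Commute.one_right _)).smul_left
      _).smul_right _
  · rw [hBA]; exact hJ1 n _
  · simp only [hBA]; exact hJlim _

variable [CompleteSpace H]

/-- On `D` the bound t ‖B_m x − B_n x‖ makes the exponentials Cauchy, and contractivity carries this
to all of `H`. The continuity at t = 0, uniform in n, gives strong continuity here and is needed
again to differentiate the limit semigroup. -/
theorem exists_limit_semigroup {B : ℕ → H →L[ℂ] H} (hB : ∀ n x, (inner ℂ x (B n x)).re ≤ 0)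
    (hc : ∀ m n, Commute (B m) (B n)) {D : Set H} (hD : Dense D)
    (hlim : ∀ x ∈ D, CauchySeq fun n => B n x)
    (hbound : ∀ x ∈ D, ∃ C, ∀ n, ‖B n x‖ ≤ C) :
    ∃ S : ContractionSemigroup H, (∀ (t : ℝ≥0) x,
      Tendsto (fun n => NormedSpace.exp ((t : ℝ) • B n) x) atTop (𝓝 (S.T t x))) ∧
      ∀ x, ∀ ε > 0, ∃ δ > 0, ∀ n, ∀ t : ℝ, 0 ≤ t → t < δ →
        ‖NormedSpace.exp (t • B n) x - x‖ ≤ ε := by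
  have hbd : ∀ (t : ℝ≥0) n x, ‖NormedSpace.exp ((t : ℝ) • B n) x‖ ≤ ‖x‖ := fun t n x =>
    norm_exp_smul_apply_le (B n) (hB n) x t.2
  have hcauchy : ∀ (t : ℝ≥0) x, CauchySeq fun n => NormedSpace.exp ((t : ℝ) • B n) x := by
    intro t
    refine cauchySeq_of_dense (hbd t) hD fun x hx => ?_
    refine Metric.cauchySeq_iff'.2 fun ε hε => ?_
    obtain ⟨N, hN⟩ := Metric.cauchySeq_iff'.1 (hlim x hx) (ε / (t + 1)) (by positivity)
    refine ⟨N, fun n hn => ?_⟩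
    rw [dist_eq_norm]
    refine (norm_exp_smul_sub_exp_smul_le (hB n) (hB N) (hc n N) x t.2).trans_lt ?_
    have h1 := hN n hn
    rw [dist_eq_norm, lt_div_iff₀ (by positivity)] at h1
    have h2 : (0 : ℝ) ≤ t := t.2
    have h3 : ((t : ℝ≥0) : ℝ) * ‖B n x - B N x‖ ≤ ‖B n x - B N x‖ * (t + 1) := by
      nlinarith [norm_nonneg (B n x - B N x)]
    exact h3.trans_lt h1
  choose T hT using fun t x => cauchySeq_tendsto_of_complete (hcauchy t x)
  let T' : ℝ≥0 → H →L[ℂ] H := fun t => LinearMap.mkContinuous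
    { toFun := T t
      map_add' := fun x y => tendsto_nhds_unique (hT t (x + y))
        (by simpa only [map_add] using (hT t x).add (hT t y))
      map_smul' := fun k x => tendsto_nhds_unique (hT t (k • x))
        (by simpa only [_root_.map_smul, RingHom.id_apply] using (hT t x).const_smul k) } 1
      (fun x => by
        rw [one_mul]
        exact le_of_tendsto (hT t x).norm (Eventually.of_forall fun n => hbd t n x))
  have hT' : ∀ (t : ℝ≥0) x, Tendsto (fun n => NormedSpace.exp ((t : ℝ) • B n) x) atTop (𝓝 (T' t x)) := hT
  have hT'le : ∀ t x, ‖T' t x‖ ≤ ‖x‖ := fun t x =>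
    le_of_tendsto (hT t x).norm (Eventually.of_forall fun n => hbd t n x)
  have hsmall : ∀ x, ∀ ε > 0, ∃ δ > 0, ∀ n, ∀ t : ℝ, 0 ≤ t → t < δ →
      ‖NormedSpace.exp (t • B n) x - x‖ ≤ ε := by
    intro x ε hε
    obtain ⟨y, hy, hxy⟩ := hD.exists_dist_lt x (show 0 < ε / 3 by positivity)
    rw [dist_eq_norm] at hxy
    obtain ⟨C, hC⟩ := hbound y hy
    have hC0 : 0 ≤ C := (norm_nonneg _).trans (hC 0)
    refine ⟨ε / 3 / (C + 1), by positivity, fun n t ht0 ht => ?_⟩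
    -- Comparison with the zero generator, whose semigroup is the identity, gives ‖e^{tB} y − y‖ ≤ t
    -- ‖B y‖.
    have h1 := norm_exp_smul_sub_exp_smul_le (hB n) (C := 0) (by simp) (Commute.zero_right _) y ht0
    simp only [smul_zero, NormedSpace.exp_zero, one_apply_eq_self,
      zero_apply, sub_zero] at h1
    have h2 : t * ‖B n y‖ ≤ ε / 3 := by
      rw [lt_div_iff₀ (by positivity)] at ht
      nlinarith [hC n, norm_nonneg (B n y)]
    have h3 := norm_exp_smul_apply_le (B n) (hB n) (x - y) ht0
    have h4 : NormedSpace.exp (t • B n) x - x = NormedSpace.exp (t • B n) (x - y)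
        + (NormedSpace.exp (t • B n) y - y) - (x - y) := by rw [_root_.map_sub]; abel
    rw [h4]
    refine (norm_sub_le _ _).trans ((add_le_add_left (norm_add_le _ _) _).trans ?_)
    linarith
  have hadd : ∀ s t, T' (s + t) = (T' s).comp (T' t) := by
    intro s t
    refine ContinuousLinearMap.ext fun x => tendsto_nhds_unique (hT' (s + t) x) ?_
    rw [ContinuousLinearMap.comp_apply]
    have h1 : Tendsto (fun n => NormedSpace.exp ((s : ℝ) • B n)
        (NormedSpace.exp ((t : ℝ) • B n) x - T' t x)) atTop (𝓝 0) := by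
      have := tendsto_iff_norm_sub_tendsto_zero.1 (hT' t x)
      exact squeeze_zero_norm (fun n => hbd s n _) this
    have h2 := h1.add (hT' s (T' t x))
    rw [zero_add] at h2
    refine h2.congr fun n => ?_
    rw [NNReal.coe_add, exp_smul_add, mul_apply_eq_comp, _root_.map_sub, sub_add_cancel]
  have hT'small : ∀ x, ∀ ε > 0, ∃ δ > 0, ∀ t : ℝ≥0, (t : ℝ) < δ → ‖T' t x - x‖ ≤ ε := by
    intro x ε hε
    obtain ⟨δ, hδ, h⟩ := hsmall x ε hε
    exact ⟨δ, hδ, fun t ht => le_of_tendsto ((hT' t x).sub_const x).norm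
      (Eventually.of_forall fun n => h n t t.2 ht)⟩
  have hdiff : ∀ (s h : ℝ≥0) x, ‖T' (s + h) x - T' s x‖ ≤ ‖T' h x - x‖ := fun s h x => by
    rw [hadd, ContinuousLinearMap.comp_apply, ← _root_.map_sub]
    exact hT'le _ _
  refine ⟨⟨T', ?_, hadd, ?_, fun t => ?_⟩, hT', hsmall⟩
  · refine ContinuousLinearMap.ext fun x => tendsto_nhds_unique (hT' 0 x) ?_
    simp
  · intro x
    refine Metric.continuous_iff.2 fun t ε hε => ?_
    obtain ⟨δ, hδ, h⟩ := hT'small x (ε / 2) (by positivity)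
    refine ⟨δ, hδ, fun s hs => ?_⟩
    rw [NNReal.dist_eq] at hs
    rw [dist_eq_norm]
    rcases le_total t s with hts | hts
    · obtain ⟨k, rfl⟩ := exists_add_of_le hts
      have : ((k : ℝ≥0) : ℝ) < δ := by
        have := (le_abs_self _).trans_lt hs
        push_cast at this; linarith
      linarith [hdiff t k x, h k this]
    · obtain ⟨k, rfl⟩ := exists_add_of_le hts
      have : ((k : ℝ≥0) : ℝ) < δ := by
        have := (neg_abs_le _).trans_lt' (neg_lt_neg hs)
        push_cast at this; linarith
      rw [norm_sub_rev]
      linarith [hdiff s k x, h k this]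
  · exact (T' t).opNorm_le_bound zero_le_one fun x => by rw [one_mul]; exact hT'le t x

/-- Lumer-Phillips: a densely defined dissipative operator `A` with `r - A` surjective for all
`r > 0` generates a contraction semigroup. -/
theorem LinearPMap.Dissipative.generatesContractionSemigroup {A : H →ₗ.[ℂ] H}
    (hA : A.Dissipative) (hD : Dense (A.domain : Set H))
    (hs : ∀ r : ℝ, 0 < r → ∀ y, ∃ x : A.domain, (r : ℂ) • (x : H) - A x = y) :
    GeneratesContractionSemigroup A := by
  obtain ⟨B, hB, hc, hle, hlim⟩ := hA.exists_approximation hD hs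
  obtain ⟨S, hS, hsmall⟩ := exists_limit_semigroup hB hc hD
    (fun x hx => (hlim ⟨x, hx⟩).cauchySeq) (fun x hx => ⟨‖A ⟨x, hx⟩‖, fun n => hle n ⟨x, hx⟩⟩)
  have hgen : ∀ x : A.domain,
      Tendsto (fun t : ℝ≥0 => ((t : ℝ) : ℂ)⁻¹ • (S.T t x - x)) (𝓝[>] 0) (𝓝 (A x)) := by
    intro x
    refine Metric.tendsto_nhds.2 fun ε hε => ?_
    obtain ⟨δ, hδ, h⟩ := hsmall (A x) (ε / 2) (by positivity)
    have hev : ∀ᶠ t : ℝ≥0 in 𝓝[>] 0, (t : ℝ) < δ ∧ 0 < t := by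
      refine Eventually.and ?_ self_mem_nhdsWithin
      have : Tendsto (fun t : ℝ≥0 => (t : ℝ)) (𝓝[>] 0) (𝓝 0) :=
        (NNReal.continuous_coe.tendsto 0).mono_left nhdsWithin_le_nhds
      exact this.eventually (gt_mem_nhds hδ)
    filter_upwards [hev] with t ht
    have ht0 : (0 : ℝ) < t := ht.2
    -- The derivative of s ↦ e^{sB_n} x − s A x is e^{sB_n} (B_n x − A x) + (e^{sB_n} − 1) A x. The
    -- last term is at most ε/2 for s < δ uniformly in n, so the bound survives n → ∞.
    have h1 : ∀ n, ‖NormedSpace.exp ((t : ℝ) • B n) (x : H) - (t : ℝ) • A x - x‖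
        ≤ (‖B n x - A x‖ + ε / 2) * t := by
      intro n
      have hd : ∀ s : ℝ, HasDerivAt (fun s : ℝ => NormedSpace.exp (s • B n) (x : H) - s • A x)
          (NormedSpace.exp (s • B n) (B n x) - A x) s := fun s => by
        have := ((hasDerivAt_id s).smul_const (A x))
        rw [one_smul] at this
        exact (hasDerivAt_exp_smul_apply (B n) x s).sub this
      have := norm_image_sub_le_of_norm_deriv_le_segment' (a := 0) (b := t)
        (C := ‖B n x - A x‖ + ε / 2) (fun s _ => (hd s).hasDerivWithinAt) (fun s hs => ?_) t
        ⟨t.2, le_rfl⟩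
      · simpa using this
      · have h2 := norm_exp_smul_apply_le (B n) (hB n) (B n x - A x) hs.1
        have h3 := h n s hs.1 (hs.2.trans ht.1)
        have h4 : NormedSpace.exp (s • B n) (B n x) - A x
          = NormedSpace.exp (s • B n) (B n x - A x) + (NormedSpace.exp (s • B n) (A x) - A x) := by
          rw [_root_.map_sub]; abel
        rw [h4]
        exact (norm_add_le _ _).trans (add_le_add h2 h3)
    have h2 : ‖S.T t (x : H) - (t : ℝ) • A x - x‖ ≤ (0 + ε / 2) * t := by
      refine le_of_tendsto_of_tendsto' (((hS t x).sub_const _).sub_const _).norm ?_ h1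
      exact ((tendsto_iff_norm_sub_tendsto_zero.1 (hlim x)).add_const _).mul_const _
    have h3 : ((t : ℝ) : ℂ)⁻¹ • (S.T t (x : H) - x) - A x
        = ((t : ℝ) : ℂ)⁻¹ • (S.T t (x : H) - (t : ℝ) • A x - x) := by
      have h4 : ((t : ℝ) : ℂ) ≠ 0 := by exact_mod_cast ht0.ne'
      rw [← Complex.coe_smul, sub_right_comm, smul_sub _ (S.T t (x : H) - x), inv_smul_smul₀ h4]
    rw [dist_eq_norm, h3, norm_smul, norm_inv, Complex.norm_real, Real.norm_of_nonneg ht0.le,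
      inv_mul_lt_iff₀ ht0]
    nlinarith
  refine ⟨S, fun x y => ⟨fun h => ?_, fun h => ?_⟩⟩
  · obtain ⟨x', hx, hy⟩ := (LinearPMap.mem_graph_iff A).1 h
    simp only at hx hy
    rw [← hx, ← hy]
    exact hgen x'
  -- The generator of `S` cannot extend `A` properly. With x' in D(A) and x' − A x' = x − y, it maps
  -- x − x' to itself, so its dissipativity forces x = x'.
  · obtain ⟨x', hx'⟩ := hs 1 one_pos (x - y)
    rw [Complex.ofReal_one, one_smul] at hx'
    have h1 := h.sub (hgen x')
    have h2 : y - A x' = x - x' := by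
      have := congrArg (fun z => x - z - A x') hx'
      simp only [sub_sub_cancel] at this
      rw [← this]; abel
    rw [h2] at h1
    have h3 := S.re_inner_nonpos_of_tendsto (x := x - x') (y := x - x') (h1.congr fun t => by
      rw [_root_.map_sub, ← smul_sub]; congr 1; abel)
    have h4 : (inner ℂ (x - (x' : H)) (x - (x' : H))).re = ‖x - (x' : H)‖ * ‖x - (x' : H)‖ :=
      inner_self_eq_norm_mul_norm (𝕜 := ℂ) _
    rw [h4] at h3
    have h5 : ‖x - (x' : H)‖ = 0 := by nlinarith [norm_nonneg (x - (x' : H))]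
    have h6 : x = x' := sub_eq_zero.1 (norm_eq_zero.1 h5)
    rw [h6, sub_self, sub_eq_zero] at h2
    rw [h2, h6]
    exact LinearPMap.mem_graph A x'

end HilleYosida

/-! ### Range of r − A, and dissipativity of the adjoint of a generator. -/

section Range

variable {H : Type*} [NormedAddCommGroup H] [InnerProductSpace ℂ H] [CompleteSpace H]

/-- The lower bound r ‖x‖ ≤ ‖(r − A) x‖ and the closedness of `A` make the range closed; `htriv`
says that its orthogonal complement is zero. -/
theorem LinearPMap.Dissipative.exists_smul_sub_eq {A : H →ₗ.[ℂ] H} (hA : A.Dissipative)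
    (hcl : A.IsClosed) {r : ℝ} (hr : 0 < r)
    (htriv : ∀ v : H, (∀ x : A.domain, inner ℂ v ((r : ℂ) • (x : H) - A x) = 0) → v = 0) (y : H) :
    ∃ x : A.domain, (r : ℂ) • (x : H) - A x = y := by
  let f : A.domain →ₗ[ℂ] H := (r : ℂ) • A.domain.subtype - A.toFun
  have hf : ∀ x : A.domain, f x = (r : ℂ) • (x : H) - A x := fun x => rfl
  have hclosed : _root_.IsClosed (LinearMap.range f : Set H) := by
    refine IsSeqClosed.isClosed fun z p hz hp => ?_
    choose x hx using hz
    have hxc : CauchySeq fun n => (x n : H) := by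
      refine Metric.cauchySeq_iff'.2 fun ε hε => ?_
      obtain ⟨N, hN⟩ := Metric.cauchySeq_iff'.1 hp.cauchySeq (r * ε) (by positivity)
      refine ⟨N, fun n hn => ?_⟩
      have h1 := hN n hn
      have h2 := hA.mul_norm_le r (x n - x N)
      rw [← hf, _root_.map_sub, hx, hx, ← dist_eq_norm] at h2
      rw [dist_eq_norm]
      have h3 : r * ‖(x n : H) - x N‖ < r * ε := h2.trans_lt h1
      exact lt_of_mul_lt_mul_left h3 hr.le
    obtain ⟨u, hu⟩ := cauchySeq_tendsto_of_complete hxc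
    have hAx : Tendsto (fun n => A (x n)) atTop (𝓝 ((r : ℂ) • u - p)) := by
      refine ((hu.const_smul (r : ℂ)).sub hp).congr fun n => ?_
      rw [← hx n, hf, sub_sub_cancel]
    have hmem : (u, (r : ℂ) • u - p) ∈ (A.graph : Set (H × H)) :=
      _root_.IsClosed.mem_of_tendsto hcl (hu.prodMk_nhds hAx)
        (Eventually.of_forall fun n => A.mem_graph (x n))
    obtain ⟨u', h1, h2⟩ := (LinearPMap.mem_graph_iff A).1 hmem
    exact ⟨u', by rw [hf, h1, h2, sub_sub_cancel]⟩
  have : CompleteSpace (LinearMap.range f) := hclosed.completeSpace_coe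
  have htop : LinearMap.range f = ⊤ := by
    refine (Submodule.orthogonal_eq_bot_iff).1 ((Submodule.eq_bot_iff _).2 fun v hv => ?_)
    exact htriv v fun x => (Submodule.mem_orthogonal' _ _).1 hv _ ⟨x, rfl⟩
  exact (LinearMap.range_eq_top.1 htop) y

end Range

namespace ContractionSemigroup

variable {H : Type*} [NormedAddCommGroup H] [InnerProductSpace ℂ H]

theorem IsGenerator.dissipative {S : ContractionSemigroup H} {A : H →ₗ.[ℂ] H}
    (hS : S.IsGenerator A) : A.Dissipative := fun x =>
  S.re_inner_nonpos_of_tendsto ((hS x (A x)).1 (A.mem_graph x))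

theorem IsGenerator.mem_graph_orbit {S : ContractionSemigroup H} {A : H →ₗ.[ℂ] H}
    (hS : S.IsGenerator A) {x y : H} (h : (x, y) ∈ A.graph) (t : ℝ≥0) :
    (S.T t x, S.T t y) ∈ A.graph := by
  refine (hS _ _).2 ?_
  have := ((S.T t).continuous.tendsto y).comp ((hS _ _).1 h)
  refine this.congr fun s => ?_
  simp only [Function.comp_apply, map_smul, map_sub]
  rw [← ContinuousLinearMap.comp_apply (S.T s), ← ContinuousLinearMap.comp_apply (S.T t),
    ← S.map_add, ← S.map_add, add_comm]

/-- Difference quotients at t → 0+ yield right derivatives only, which suffice for the mean value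
inequality. The adjoint relation removes `A` from the derivative. -/
theorem IsGenerator.hasDerivWithinAt_inner_orbit {S : ContractionSemigroup H} {A : H →ₗ.[ℂ] H}
    (hS : S.IsGenerator A) {v w : H} (h : ∀ x : A.domain, inner ℂ v (A x) = inner ℂ w (x : H))
    (x : A.domain) {s : ℝ} (hs : 0 ≤ s) :
    HasDerivWithinAt (fun s : ℝ => inner ℂ v (S.T s.toNNReal (x : H)))
      (inner ℂ w (S.T s.toNNReal (x : H))) (Set.Ici s) s := by
  have h1 := hS.mem_graph_orbit (A.mem_graph x) s.toNNReal
  have h2 := (hS _ _).1 h1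
  obtain ⟨u, hu, hAu⟩ := (LinearPMap.mem_graph_iff A).1 h1
  have h3 : HasDerivWithinAt (fun s : ℝ => S.T s.toNNReal (x : H)) (A u) (Set.Ici s) s := by
    rw [← hasDerivWithinAt_Ioi_iff_Ici, hasDerivWithinAt_iff_tendsto_slope' (by simp)]
    have h4 : Tendsto (fun r : ℝ => (r - s).toNNReal) (𝓝[>] s) (𝓝[>] 0) := by
      refine tendsto_nhdsWithin_iff.2 ⟨?_, ?_⟩
      · have : Continuous fun r : ℝ => (r - s).toNNReal :=
          continuous_real_toNNReal.comp (continuous_id.sub continuous_const)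
        have h5 := this.tendsto s
        rw [sub_self, Real.toNNReal_zero] at h5
        exact h5.mono_left nhdsWithin_le_nhds
      · filter_upwards [self_mem_nhdsWithin] with r hr
        exact Real.toNNReal_pos.2 (sub_pos.2 hr)
    rw [hAu]
    refine (h2.comp h4).congr' ?_
    filter_upwards [self_mem_nhdsWithin] with r hr
    have hr' : 0 < r - s := sub_pos.2 hr
    have h6 : r.toNNReal = (r - s).toNNReal + s.toNNReal := by
      rw [← Real.toNNReal_add hr'.le hs, sub_add_cancel]
    rw [slope_def_module, Function.comp_apply, Real.coe_toNNReal _ hr'.le, h6, S.map_add,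
      ContinuousLinearMap.comp_apply, ← Complex.ofReal_inv, Complex.coe_smul]
  have h7 : HasDerivWithinAt (fun s : ℝ => inner ℂ v (S.T s.toNNReal (x : H)))
      (inner ℂ v (A u)) (Set.Ici s) s :=
    ((innerSL ℂ v).restrictScalars ℝ).hasFDerivAt.comp_hasDerivWithinAt s h3
  rwa [h, hu] at h7

/-- The estimate does not contain `A x`. It therefore extends by density from D(A) to arbitrary
vectors, and no adjoint semigroup has to be constructed. -/
theorem IsGenerator.norm_inner_sub_le {S : ContractionSemigroup H} {A : H →ₗ.[ℂ] H}
    (hS : S.IsGenerator A) {v w : H} (h : ∀ x : A.domain, inner ℂ v (A x) = inner ℂ w (x : H))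
    (x : A.domain) {t : ℝ≥0} {C : ℝ} (hC : ∀ s < t, ‖S.T s x - (x : H)‖ ≤ C) :
    ‖inner ℂ v (S.T t x - (x : H)) - (t : ℝ) • inner ℂ w (x : H)‖ ≤ ‖w‖ * C * t := by
  have hcont : Continuous fun s : ℝ => S.T s.toNNReal (x : H) :=
    (S.continuous_orbit x).comp continuous_real_toNNReal
  have hcont' : Continuous fun s : ℝ => inner ℂ v (S.T s.toNNReal (x : H)) :=
    continuous_const.inner hcont
  let g : ℝ → ℂ := fun s => inner ℂ v (S.T s.toNNReal (x : H)) - s • inner ℂ w (x : H)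
  have hg : ∀ s, g s = inner ℂ v (S.T s.toNNReal (x : H)) - s • inner ℂ w (x : H) := fun _ => rfl
  have hgc : Continuous g := hcont'.sub (continuous_id.smul continuous_const)
  have hderiv : ∀ s ∈ Set.Ico (0 : ℝ) t, HasDerivWithinAt g
      (inner ℂ w (S.T s.toNNReal (x : H)) - inner ℂ w (x : H)) (Set.Ici s) s := by
    intro s hs
    have h8 : HasDerivWithinAt (fun s : ℝ => s • inner ℂ w (x : H)) ((1 : ℝ) • inner ℂ w (x : H))
      (Set.Ici s) s := ((hasDerivAt_id s).smul_const (inner ℂ w (x : H))).hasDerivWithinAt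
    rw [one_smul] at h8
    exact (hS.hasDerivWithinAt_inner_orbit h x hs.1).sub h8
  have key := norm_image_sub_le_of_norm_deriv_right_le_segment (C := ‖w‖ * C)
    hgc.continuousOn hderiv (fun s hs => ?_) t ⟨t.2, le_rfl⟩
  · rw [hg, hg, Real.toNNReal_coe, Real.toNNReal_zero, S.map_zero, ContinuousLinearMap.id_apply,
      zero_smul, sub_zero, sub_zero] at key
    rw [inner_sub_right, sub_right_comm]
    exact key
  · rw [← inner_sub_right]
    refine (norm_inner_le_norm _ _).trans (mul_le_mul_of_nonneg_left (hC _ ?_) (norm_nonneg _))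
    exact (Real.toNNReal_lt_iff_lt_coe hs.1).2 hs.2

/-- The adjoint of the generator of a contraction semigroup is dissipative. -/
theorem IsGenerator.re_inner_adjoint_nonpos {S : ContractionSemigroup H} {A : H →ₗ.[ℂ] H}
    (hS : S.IsGenerator A) (hD : Dense (A.domain : Set H)) {v w : H}
    (h : ∀ x : A.domain, inner ℂ v (A x) = inner ℂ w (x : H)) : (inner ℂ v w).re ≤ 0 := by
  suffices ∀ ε > 0, (inner ℂ w v).re ≤ ‖w‖ * ε by
    rw [← inner_conj_symm, Complex.conj_re]
    refine le_of_forall_pos_le_add fun ε hε => ?_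
    refine (this (ε / (‖w‖ + 1)) (by positivity)).trans ?_
    rw [zero_add, mul_div_assoc', div_le_iff₀ (by positivity)]
    nlinarith [norm_nonneg w]
  intro ε hε
  have hcont := (S.continuous_orbit v).tendsto 0
  rw [S.map_zero, ContinuousLinearMap.id_apply] at hcont
  obtain ⟨t, ht0, ht⟩ : ∃ t : ℝ≥0, 0 < t ∧ ∀ s < t, ‖S.T s v - v‖ ≤ ε := by
    obtain ⟨δ, hδ, hd⟩ := Metric.mem_nhds_iff.1 (hcont (Metric.ball_mem_nhds v hε))
    refine ⟨⟨δ, hδ.le⟩, hδ, fun s hs => ?_⟩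
    have : s ∈ Metric.ball (0 : ℝ≥0) δ := by
      rw [Metric.mem_ball, NNReal.dist_eq, NNReal.coe_zero, sub_zero, NNReal.abs_eq]
      exact hs
    have := hd this
    rw [← dist_eq_norm]
    exact (Metric.mem_ball.1 this).le
  -- Approximate `v` by elements x_n of D(A). Contractivity costs 2 ‖x_n − v‖ in the bound for S.T s
  -- x_n − x_n, which vanishes in the limit.
  have key : ‖inner ℂ v (S.T t v - v) - (t : ℝ) • inner ℂ w v‖ ≤ ‖w‖ * ε * t := by
    obtain ⟨x, hxD, hx⟩ := mem_closure_iff_seq_limit.1 (hD v)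
    have h1 : ∀ n, ‖inner ℂ v (S.T t (x n) - x n) - (t : ℝ) • inner ℂ w (x n)‖
        ≤ ‖w‖ * (ε + 2 * ‖x n - v‖) * t := fun n => by
      refine hS.norm_inner_sub_le h ⟨x n, hxD n⟩ fun s hs => ?_
      have h2 : S.T s (x n) - x n = S.T s (x n - v) + (S.T s v - v) - (x n - v) := by
        rw [_root_.map_sub]; abel
      simp only
      rw [h2]
      have h3 := S.norm_apply_le s (x n - v)
      have h4 := ht s hs
      refine (norm_sub_le _ _).trans ((add_le_add_left (norm_add_le _ _) _).trans ?_)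
      linarith
    have h5 : Tendsto (fun n => S.T t (x n)) atTop (𝓝 (S.T t v)) :=
      ((S.T t).continuous.tendsto v).comp hx
    have h6 := tendsto_iff_norm_sub_tendsto_zero.1 hx
    have h7 := (((h6.const_mul 2).const_add ε).const_mul ‖w‖).mul_const (t : ℝ)
    rw [mul_zero, add_zero] at h7
    exact le_of_tendsto_of_tendsto' ((tendsto_const_nhds.inner (h5.sub hx)).sub
      ((tendsto_const_nhds.inner hx).const_smul _)).norm h7 h1
  -- Since the real part of the pairing of `v` with `S.T t v - v` is nonpositive, only t Re ⟨w, v⟩ ≤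
  -- ‖w‖ ε t remains.
  have h1 := (neg_le_abs _).trans ((Complex.abs_re_le_norm _).trans key)
  rw [Complex.sub_re, Complex.smul_re, inner_sub_right, Complex.sub_re] at h1
  have h2 := (Complex.re_le_norm _).trans (norm_inner_le_norm (𝕜 := ℂ) v (S.T t v))
  have h4 : (inner ℂ v v).re = ‖v‖ * ‖v‖ := inner_self_eq_norm_mul_norm (𝕜 := ℂ) v
  have h5 := S.norm_apply_le t v
  rw [h4, smul_eq_mul] at h1
  have h6 : (0 : ℝ) < t := ht0
  have h7 : (t : ℝ) * (inner ℂ w v).re ≤ t * (‖w‖ * ε) := by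
    nlinarith [norm_nonneg v, mul_le_mul_of_nonneg_left h5 (norm_nonneg v)]
  exact le_of_mul_le_mul_left h7 h6

end ContractionSemigroup

/-! ### Primitives of locally integrable functions. -/

section Primitive

/-- `F` is a primitive of the locally integrable function `V`. -/
structure IsPrimitive (F V : ℝ → ℂ) : Prop where
  locallyIntegrable : LocallyIntegrable V
  sub_eq : ∀ x y, F y - F x = ∫ t in x..y, V t

theorem MeasureTheory.LocallyIntegrable.intervalIntegrable' {V : ℝ → ℂ} (h : LocallyIntegrable V)
    (x y : ℝ) : IntervalIntegrable V volume x y :=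
  (h.integrableOn_isCompact isCompact_uIcc).intervalIntegrable

namespace IsPrimitive

variable {F G V W : ℝ → ℂ}

theorem eq_add (h : IsPrimitive F V) (m : ℝ) : F = fun x => F m + ∫ t in m..x, V t := by
  funext x
  rw [← h.sub_eq m x]; ring

theorem continuous (h : IsPrimitive F V) : Continuous F := by
  rw [h.eq_add 0]
  exact continuous_const.add (intervalIntegral.continuous_primitive
    (fun x y => h.locallyIntegrable.intervalIntegrable' x y) 0)

theorem ae_hasDerivAt (h : IsPrimitive F V) : ∀ᵐ x, HasDerivAt F (V x) x := by
  filter_upwards [LocallyIntegrable.ae_hasDerivAt_integral h.locallyIntegrable] with x hx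
  rw [h.eq_add 0]
  exact (hx 0).const_add _

/-- The increments of `F` are dominated by those of the primitive of ‖V‖. -/
theorem absolutelyContinuous (h : IsPrimitive F V) (p q : ℝ) :
    AbsolutelyContinuousOnInterval F p q := by
  have hi : ∀ x y, IntervalIntegrable (fun t => ‖V t‖) volume x y := fun x y =>
    (h.locallyIntegrable.intervalIntegrable' x y).norm
  have h1 := (hi p q).absolutelyContinuousOnInterval_intervalIntegral (c := p)
    Set.left_mem_uIcc
  refine squeeze_zero (fun _ => Finset.sum_nonneg fun _ _ => dist_nonneg) (fun E => ?_) h1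
  refine Finset.sum_le_sum fun i _ => ?_
  rw [dist_comm, dist_eq_norm, h.sub_eq, dist_comm, Real.dist_eq,
    intervalIntegral.integral_interval_sub_left (hi _ _) (hi _ _)]
  exact intervalIntegral.norm_integral_le_abs_integral_norm

theorem conj (h : IsPrimitive F V) :
    IsPrimitive (fun x => starRingEnd ℂ (F x)) (fun x => starRingEnd ℂ (V x)) where
  locallyIntegrable := fun x => by
    obtain ⟨s, hs, hV⟩ := h.locallyIntegrable x
    exact ⟨s, hs, (Complex.conjCLE.toContinuousLinearMap.integrable_comp hV)⟩
  sub_eq x y := by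
    rw [← map_sub, h.sub_eq, intervalIntegral.intervalIntegral_eq_integral_uIoc,
      intervalIntegral.intervalIntegral_eq_integral_uIoc, integral_conj]
    split_ifs <;> simp

theorem integral_eq_sub (h : IsPrimitive F V) (hV : Integrable V) {l r : ℂ}
    (hl : Tendsto F atBot (𝓝 l)) (hr : Tendsto F atTop (𝓝 r)) : ∫ x, V x = r - l := by
  have h1 := intervalIntegral_tendsto_integral hV tendsto_neg_atTop_atBot tendsto_id
  have h2 := hr.sub (hl.comp tendsto_neg_atTop_atBot)
  refine tendsto_nhds_unique h1 (h2.congr fun x => ?_)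
  exact h.sub_eq _ _

theorem of_hasDerivAt (h : ∀ x, HasDerivAt F (V x) x) (hV : Continuous V) : IsPrimitive F V where
  locallyIntegrable := hV.locallyIntegrable
  sub_eq x y := (intervalIntegral.integral_eq_sub_of_hasDerivAt (fun t _ => h t)
    (hV.intervalIntegrable x y)).symm

/-- The product minus the primitive of V G + F W is absolutely continuous with derivative zero
almost everywhere, hence constant. -/
theorem mul (hF : IsPrimitive F V) (hG : IsPrimitive G W) :
    IsPrimitive (fun x => F x * G x) (fun x => V x * G x + F x * W x) := by
  have h1 : LocallyIntegrable (fun x => V x * G x + F x * W x) := by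
    have h2 : LocallyIntegrable (fun x => V x * G x) := by
      rw [← locallyIntegrableOn_univ] at *
      exact (locallyIntegrableOn_univ.2 hF.locallyIntegrable).mul_continuousOn
        hG.continuous.continuousOn isOpen_univ.isLocallyClosed
    have h3 : LocallyIntegrable (fun x => F x * W x) := by
      rw [← locallyIntegrableOn_univ] at *
      exact (locallyIntegrableOn_univ.2 hG.locallyIntegrable).continuousOn_mul
        hF.continuous.continuousOn isOpen_univ.isLocallyClosed
    exact h2.add h3
  refine ⟨h1, fun x y => ?_⟩
  let N : ℝ → ℂ := fun z => ∫ t in x..z, (V t * G t + F t * W t)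
  have hN : IsPrimitive N (fun x => V x * G x + F x * W x) := ⟨h1, fun p q =>
    intervalIntegral.integral_interval_sub_left (h1.intervalIntegrable' _ _)
      (h1.intervalIntegrable' _ _)⟩
  have hac : AbsolutelyContinuousOnInterval (fun z => F z • G z - N z) x y :=
    ((hF.absolutelyContinuous x y).smul (hG.absolutelyContinuous x y)).sub
      (hN.absolutelyContinuous x y)
  obtain ⟨C, hC⟩ := hac.const_of_ae_hasDerivAt_zero (by
    filter_upwards [hF.ae_hasDerivAt, hG.ae_hasDerivAt, hN.ae_hasDerivAt] with z h1 h2 h3 _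
    have := (h1.mul h2).sub h3
    rw [sub_self] at this
    exact this)
  have hx := hC x Set.left_mem_uIcc
  have hy := hC y Set.right_mem_uIcc
  have hNx : N x = 0 := intervalIntegral.integral_same
  rw [hNx, smul_eq_mul] at hx
  rw [smul_eq_mul] at hy
  have : F y * G y - F x * G x = N y := by linear_combination hy - hx
  exact this

/-- A bound for a primitive in terms of `L₂`-norms. -/
theorem norm_sq_le (h : IsPrimitive F V) {p q : ℝ} (hpq : p < q)
    (hV : IntervalIntegrable (fun t => ‖V t‖ ^ 2) volume p q) {x : ℝ} (hx : x ∈ Set.Icc p q) :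
    ‖F x‖ ^ 2 ≤ 2 / (q - p) * (∫ t in p..q, ‖F t‖ ^ 2) + 2 * (q - p) * ∫ t in p..q, ‖V t‖ ^ 2 := by
  have hi : ∀ x y, IntervalIntegrable (fun t => ‖V t‖) volume x y := fun x y =>
    (h.locallyIntegrable.intervalIntegrable' x y).norm
  have hd : 0 < q - p := sub_pos.2 hpq
  set M := ∫ t in p..q, ‖V t‖ with hM
  set K := ∫ t in p..q, ‖V t‖ ^ 2 with hK
  have hM0 : 0 ≤ M := intervalIntegral.integral_nonneg hpq.le fun _ _ => norm_nonneg _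
  have hCS : M ^ 2 ≤ (q - p) * K := by
    -- Cauchy–Schwarz in the form that the variance of ‖V‖ is nonnegative.
    have h1 : 0 ≤ ∫ t in p..q, (‖V t‖ - M / (q - p)) ^ 2 :=
      intervalIntegral.integral_nonneg hpq.le fun _ _ => sq_nonneg _
    have h2 : ∫ t in p..q, (‖V t‖ - M / (q - p)) ^ 2
        = K - 2 * (M / (q - p)) * M + (q - p) * (M / (q - p)) ^ 2 := by
      have : ∀ t, (‖V t‖ - M / (q - p)) ^ 2
        = ‖V t‖ ^ 2 - 2 * (M / (q - p)) * ‖V t‖ + (M / (q - p)) ^ 2 := fun t => by ring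
      simp_rw [this]
      rw [intervalIntegral.integral_add (hV.sub ((hi p q).const_mul _)) (by simp),
        intervalIntegral.integral_sub hV ((hi p q).const_mul _),
        intervalIntegral.integral_const_mul, intervalIntegral.integral_const, smul_eq_mul]
    have h3 : (q - p) * (K - 2 * (M / (q - p)) * M + (q - p) * (M / (q - p)) ^ 2)
        = (q - p) * K - M ^ 2 := by field_simp; ring
    rw [h2] at h1
    nlinarith [mul_nonneg hd.le h1]
  -- From ‖F x‖ ≤ ‖F s‖ + M; averaging over s in [p, q] then produces both constants of the claim.
  have hpt : ∀ s ∈ Set.Icc p q, ‖F x‖ ^ 2 ≤ 2 * ‖F s‖ ^ 2 + 2 * ((q - p) * K) := by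
    intro s hs
    have h1 : ‖F x - F s‖ ≤ M := by
      rw [h.sub_eq]
      refine intervalIntegral.norm_integral_le_integral_norm_uIoc.trans ?_
      rw [hM, intervalIntegral.integral_of_le hpq.le]
      refine setIntegral_mono_set (hi p q).1 (ae_of_all _ fun _ => norm_nonneg _)
        (LE.le.eventuallyLE ?_)
      rw [Set.uIoc]
      exact Set.Ioc_subset_Ioc (le_min hs.1 hx.1) (max_le hs.2 hx.2)
    have h2 : ‖F x‖ ≤ ‖F s‖ + M := by
      have := norm_add_le (F s) (F x - F s)
      rw [add_sub_cancel] at this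
      linarith
    nlinarith [norm_nonneg (F x), norm_nonneg (F s), sq_nonneg (‖F s‖ - M)]
  have hFc : Continuous fun t => ‖F t‖ ^ 2 := h.continuous.norm.pow 2
  have hint := intervalIntegral.integral_mono_on (μ := volume) (a := p) (b := q)
    (f := fun _ => ‖F x‖ ^ 2) (g := fun s => 2 * ‖F s‖ ^ 2 + 2 * ((q - p) * K)) hpq.le
    (continuous_const.intervalIntegrable p q)
    (((hFc.const_mul 2).add continuous_const).intervalIntegrable p q) hpt
  rw [intervalIntegral.integral_const, intervalIntegral.integral_add
    ((hFc.const_mul 2).intervalIntegrable p q) (continuous_const.intervalIntegrable p q),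
    intervalIntegral.integral_const_mul, intervalIntegral.integral_const, smul_eq_mul,
    smul_eq_mul] at hint
  have h4 : 2 / (q - p) * (∫ t in p..q, ‖F t‖ ^ 2) + 2 * (q - p) * K
      = (2 * (∫ t in p..q, ‖F t‖ ^ 2) + (q - p) * (2 * ((q - p) * K))) / (q - p) := by
    field_simp
  rw [h4, le_div_iff₀ hd, mul_comm]
  exact hint

end IsPrimitive

end Primitive

/-! ### The du Bois-Reymond lemma and continuous representatives. -/

section DuBoisReymond

variable {I : Set ℝ}

theorem exists_Icc_of_isCompact {K : Set ℝ} (hK : IsCompact K)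
    (hne : K.Nonempty) (hKI : K ⊆ I) : ∃ p q, p ∈ I ∧ q ∈ I ∧ p ≤ q ∧ K ⊆ Set.Icc p q :=
  ⟨sInf K, sSup K, hKI (hK.sInf_mem hne), hKI (hK.sSup_mem hne),
    csInf_le_csSup hne hK.bddBelow hK.bddAbove,
    fun _ hx => ⟨csInf_le hK.bddBelow hx, le_csSup hK.bddAbove hx⟩⟩

/-- A test function with integral zero is the derivative of a test function. -/
theorem exists_test_primitive (hI : I.OrdConnected) (hne : I.Nonempty) {χ : ℝ → ℝ}
    (h1 : ContDiff ℝ ∞ χ) (h2 : HasCompactSupport χ) (h3 : tsupport χ ⊆ I) (h0 : ∫ x, χ x = 0) :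
    ∃ φ : ℝ → ℝ, ContDiff ℝ ∞ φ ∧ HasCompactSupport φ ∧ tsupport φ ⊆ I ∧ deriv φ = χ := by
  obtain ⟨m, hm⟩ := hne
  -- The point m keeps the compact set nonempty when `χ` vanishes identically.
  obtain ⟨p, q, hp, hq, hpq, hsub⟩ := exists_Icc_of_isCompact (h2.isCompact.insert m)
    ⟨m, Set.mem_insert _ _⟩ (Set.insert_subset hm h3)
  have hz : ∀ x, x ∉ Set.Icc p q → χ x = 0 := fun x hx =>
    image_eq_zero_of_notMem_tsupport fun h => hx (hsub (Set.mem_insert_of_mem _ h))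
  let φ : ℝ → ℝ := fun x => ∫ t in p..x, χ t
  have hd : ∀ x, HasDerivAt φ (χ x) x := fun x =>
    intervalIntegral.integral_hasDerivAt_right (h1.continuous.intervalIntegrable _ _)
      (h1.continuous.stronglyMeasurableAtFilter _ _) h1.continuous.continuousAt
  have hderiv : deriv φ = χ := funext fun x => (hd x).deriv
  have hsupp : ∀ x, x ∉ Set.Icc p q → φ x = 0 := by
    intro x hx
    rw [Set.mem_Icc, not_and_or, not_le, not_le] at hx
    rcases hx with hx | hx
    · refine intervalIntegral.integral_zero_ae (ae_of_all _ fun t ht => ?_)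
      rw [Set.uIoc_of_ge hx.le] at ht
      -- The half-open interval contains its right end p, where `hz` says nothing; there `χ`
      -- vanishes by continuity from the left.
      rcases eq_or_lt_of_le ht.2 with rfl | ht'
      · have hev : χ =ᶠ[𝓝[<] t] fun _ => 0 := by
          filter_upwards [self_mem_nhdsWithin] with s hs
          exact hz s fun h => absurd h.1 (not_le.2 hs)
        exact tendsto_nhds_unique (h1.continuous.continuousWithinAt (s := Set.Iio t))
          (tendsto_const_nhds.congr' hev.symm)
      · exact hz t fun h => absurd h.1 (not_le.2 ht')
    · have : φ x = ∫ t, χ t := by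
        rw [← setIntegral_eq_integral_of_forall_compl_eq_zero (s := Set.Icc p x),
          integral_Icc_eq_integral_Ioc, ← intervalIntegral.integral_of_le (hpq.trans hx.le)]
        intro t ht
        exact hz t fun h => ht ⟨h.1, h.2.trans hx.le⟩
      rw [this, h0]
  have hts : tsupport φ ⊆ Set.Icc p q :=
    closure_minimal (fun x hx => by_contra fun h => hx (hsupp x h)) isClosed_Icc
  refine ⟨φ, ?_, ?_, hts.trans (hI.out hp hq), hderiv⟩
  · rw [contDiff_infty_iff_deriv]
    exact ⟨fun x => (hd x).differentiableAt, by rwa [hderiv]⟩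
  · exact isCompact_Icc.of_isClosed_subset (isClosed_tsupport _) hts

theorem exists_test_integral_eq_one (hI : IsOpen I) (hne : I.Nonempty) :
    ∃ η : ℝ → ℝ, ContDiff ℝ ∞ η ∧ HasCompactSupport η ∧ tsupport η ⊆ I ∧ ∫ x, η x = 1 := by
  obtain ⟨m, hm⟩ := hne
  obtain ⟨ε, hε, hball⟩ := Metric.isOpen_iff.1 hI m hm
  let f : ContDiffBump m := ⟨ε / 4, ε / 2, by positivity, by linarith⟩
  refine ⟨f.normed volume, f.contDiff_normed, f.hasCompactSupport_normed, ?_, f.integral_normed⟩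
  rw [f.tsupport_normed_eq]
  refine (Metric.closedBall_subset_ball ?_).trans hball
  change ε / 2 < ε
  linarith

/-- For a fixed test function η of integral one, ψ − (∫ψ) η has integral zero and so is the
derivative of a test function. Hence ψ integrates to zero against h − c with c = ∫ η h. -/
theorem ae_eq_const_of_integral_deriv_eq_zero (hI : IsOpen I) (hI' : I.OrdConnected)
    (hne : I.Nonempty) {h : ℝ → ℂ} (hloc : LocallyIntegrable h (volume.restrict I))
    (h0 : ∀ φ : ℝ → ℝ, ContDiff ℝ ∞ φ → HasCompactSupport φ → tsupport φ ⊆ I →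
      ∫ x in I, deriv φ x • h x = 0) :
    ∃ c : ℂ, ∀ᵐ x ∂(volume.restrict I), h x = c := by
  obtain ⟨η, e1, e2, e3, e4⟩ := exists_test_integral_eq_one hI hne
  have hint : ∀ {ψ : ℝ → ℝ}, Continuous ψ → HasCompactSupport ψ →
      Integrable (fun x => ψ x • h x) (volume.restrict I) := fun h1 h2 =>
    hloc.integrable_smul_left_of_hasCompactSupport h1 h2
  let c : ℂ := ∫ x in I, η x • h x
  refine ⟨c, ?_⟩
  have hloc' : LocallyIntegrableOn (fun x => h x - c) I volume :=
    locallyIntegrableOn_of_locallyIntegrable_restrict (hloc.sub (locallyIntegrable_const c))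
  have hae := hI.ae_eq_zero_of_integral_contDiff_smul_eq_zero hloc' (fun ψ h1 h2 h3 => by
    have hψI : Integrable ψ := h1.continuous.integrable_of_hasCompactSupport h2
    have hηI : Integrable η := e1.continuous.integrable_of_hasCompactSupport e2
    let k : ℝ := ∫ x, ψ x
    let χ : ℝ → ℝ := fun x => ψ x - k * η x
    have c2 : HasCompactSupport χ := h2.sub (e2.mul_left (f := fun _ => k))
    have c3 : tsupport χ ⊆ I := (tsupport_sub _ _).trans
      (Set.union_subset h3 ((tsupport_mul_subset_right (f := fun _ => k)).trans e3))
    obtain ⟨φ, f1, f2, f3, f4⟩ := exists_test_primitive hI' hne (χ := χ)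
      (h1.sub (contDiff_const.mul e1)) c2 c3 (by
        simp only [χ]
        rw [integral_sub hψI (hηI.const_mul k), integral_const_mul, e4, mul_one, sub_self])
    have key := h0 φ f1 f2 f3
    rw [f4] at key
    have e5 : ∫ x in I, χ x • h x = (∫ x in I, ψ x • h x) - k • c := by
      have : ∀ x, χ x • h x = ψ x • h x - k • (η x • h x) := fun x => by
        simp only [χ, sub_smul, mul_smul]
      simp_rw [this]
      have h4 := integral_sub (g := fun x => k • (η x • h x)) (hint h1.continuous h2)
        ((hint e1.continuous e2).smul k)
      rw [h4, integral_smul]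
    rw [← setIntegral_eq_integral_of_forall_compl_eq_zero (s := I)]
    · simp_rw [smul_sub]
      rw [integral_sub (hint h1.continuous h2) (hψI.restrict.smul_const c), integral_smul_const]
      have hk : ∫ x in I, ψ x = k := setIntegral_eq_integral_of_forall_compl_eq_zero
        fun x hx => image_eq_zero_of_notMem_tsupport fun hx' => hx (h3 hx')
      rw [hk, ← key, e5]
    · intro x hx
      rw [image_eq_zero_of_notMem_tsupport (fun hx' => hx (h3 hx')), zero_smul])
  refine (ae_restrict_iff' hI.measurableSet).2 ?_
  filter_upwards [hae] with x hx hxI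
  exact sub_eq_zero.1 (hx hxI)

end DuBoisReymond

section EdgePrimitive

theorem HasCompactSupport.tendsto_atTop {f : ℝ → ℂ} (hf : HasCompactSupport f) :
    Tendsto f atTop (𝓝 0) := by
  have h := (hasCompactSupport_iff_eventuallyEq.1 hf)
  rw [coclosedCompact_eq_cocompact] at h
  exact tendsto_const_nhds.congr' (h.filter_mono atTop_le_cocompact).symm

theorem HasCompactSupport.tendsto_atBot {f : ℝ → ℂ} (hf : HasCompactSupport f) :
    Tendsto f atBot (𝓝 0) := by
  have h := (hasCompactSupport_iff_eventuallyEq.1 hf)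
  rw [coclosedCompact_eq_cocompact] at h
  exact tendsto_const_nhds.congr' (h.filter_mono atBot_le_cocompact).symm

variable {I : Set ℝ}

theorem memLp_indicator (hI : IsOpen I) (v : Lp ℂ 2 (volume.restrict I)) :
    MemLp (I.indicator v) 2 :=
  (memLp_indicator_iff_restrict hI.measurableSet).2 (Lp.memLp v)

theorem locallyIntegrable_indicator (hI : IsOpen I) (v : Lp ℂ 2 (volume.restrict I)) :
    LocallyIntegrable (I.indicator v) :=
  (memLp_indicator hI v).locallyIntegrable (by norm_num)

theorem isPrimitive_ofReal {φ : ℝ → ℝ} (h1 : ContDiff ℝ ∞ φ) :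
    IsPrimitive (fun x => (φ x : ℂ)) (fun x => ((deriv φ x : ℝ) : ℂ)) :=
  .of_hasDerivAt (fun x => ((h1.differentiable (by simp)) x).hasDerivAt.ofReal_comp)
    (Complex.continuous_ofReal.comp (h1.continuous_deriv (by simp)))

theorem IsPrimitive.integral_deriv_smul {F V : ℝ → ℂ} (h : IsPrimitive F V) {φ : ℝ → ℝ}
    (h1 : ContDiff ℝ ∞ φ) (h2 : HasCompactSupport φ) :
    ∫ x, deriv φ x • F x = -∫ x, φ x • V x := by
  have hP := (isPrimitive_ofReal h1).mul h
  have hc : HasCompactSupport fun x => (φ x : ℂ) * F x :=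
    (h2.comp_left (g := fun r : ℝ => (r : ℂ)) Complex.ofReal_zero).mul_right
  have i1 : Integrable fun x => deriv φ x • F x :=
    h.continuous.locallyIntegrable.integrable_smul_left_of_hasCompactSupport
      (h1.continuous_deriv (by simp)) h2.deriv
  have i2 : Integrable fun x => φ x • V x :=
    h.locallyIntegrable.integrable_smul_left_of_hasCompactSupport h1.continuous h2
  have h3 := hP.integral_eq_sub (i1.add i2) hc.tendsto_atBot hc.tendsto_atTop
  have h4 := integral_add i1 i2
  rw [sub_zero] at h3
  exact eq_neg_of_add_eq_zero_left (h4.symm.trans h3)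

theorem setIntegral_eq_of_tsupport_subset {φ : ℝ → ℝ} (h3 : tsupport φ ⊆ I) (F : ℝ → ℂ) :
    ∫ x in I, φ x • F x = ∫ x, φ x • F x :=
  setIntegral_eq_integral_of_forall_compl_eq_zero fun x hx => by
    rw [image_eq_zero_of_notMem_tsupport fun h => hx (h3 h), zero_smul]

theorem integral_smul_indicator (hI : IsOpen I) (φ : ℝ → ℝ) (v : ℝ → ℂ) :
    ∫ x, φ x • I.indicator v x = ∫ x in I, φ x • v x := by
  rw [← integral_indicator hI.measurableSet]
  congr 1
  funext x
  by_cases hx : x ∈ I <;> simp [hx]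

/-- The difference between `u` and a primitive of `v` is constant by du Bois-Reymond. Extending `v`
by zero makes `F` continuous on all of ℝ and constant beyond the ends of `I`, so boundary values can
be read off at ±∞. -/
theorem IsWeakDeriv.exists_primitive (hI : IsOpen I) (hI' : I.OrdConnected) (hne : I.Nonempty)
    {u v : Lp ℂ 2 (volume.restrict I)} (h : IsWeakDeriv u v) :
    ∃ F, IsPrimitive F (I.indicator v) ∧ u =ᵐ[volume.restrict I] F := by
  have hloc := locallyIntegrable_indicator hI v
  let F : ℝ → ℂ := fun x => ∫ t in 0..x, I.indicator v t
  have hF : IsPrimitive F (I.indicator v) := ⟨hloc, fun x y =>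
    intervalIntegral.integral_interval_sub_left (hloc.intervalIntegrable' _ _)
      (hloc.intervalIntegrable' _ _)⟩
  have hu : LocallyIntegrable u (volume.restrict I) :=
    (Lp.memLp u).locallyIntegrable (by norm_num)
  have hFl : LocallyIntegrable F (volume.restrict I) := hF.continuous.locallyIntegrable
  obtain ⟨c, hc⟩ := ae_eq_const_of_integral_deriv_eq_zero hI hI' hne (h := fun x => u x - F x)
    (hu.sub hFl) (fun φ h1 h2 h3 => by
      have hd : Continuous (deriv φ) := h1.continuous_deriv (by simp)
      simp_rw [smul_sub]
      rw [integral_sub (hu.integrable_smul_left_of_hasCompactSupport hd h2.deriv)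
        (hFl.integrable_smul_left_of_hasCompactSupport hd h2.deriv), h φ h1 h2 h3,
        setIntegral_eq_of_tsupport_subset ((tsupport_deriv_subset).trans h3),
        hF.integral_deriv_smul h1 h2, integral_smul_indicator hI, sub_self])
  refine ⟨fun x => c + F x, ⟨hloc, fun x y => ?_⟩, ?_⟩
  · rw [add_sub_add_left_eq_sub, hF.sub_eq]
  · filter_upwards [hc] with x hx
    rw [← hx, sub_add_cancel]

/-- Two continuous representatives of a function in `L₂` have the same boundary value. -/
theorem HasBoundaryValue.eq_of_continuous (hI : IsOpen I) {u : Lp ℂ 2 (volume.restrict I)}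
    {F : ℝ → ℂ} (hF : Continuous F) (hu : u =ᵐ[volume.restrict I] F) {l : Filter ℝ} [l.NeBot]
    (hl : I ∈ l) {x : ℝ} (hx : l ≤ 𝓝 x) {t : ℂ} (h : HasBoundaryValue l u t) : t = F x := by
  obtain ⟨g, h1, h2, h3⟩ := h
  have h4 : F =ᵐ[volume.restrict I] g := hu.symm.trans h2
  have h5 : Set.EqOn F g I :=
    Measure.eqOn_open_of_ae_eq h4 hI hF.continuousOn h1
  have h6 : Tendsto F l (𝓝 (F x)) := (hF.tendsto x).mono_left hx
  refine tendsto_nhds_unique h3 (h6.congr' ?_)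
  filter_upwards [hl] with y hy using h5 hy

theorem norm_sq_eq_integral (u : Lp ℂ 2 (volume.restrict I)) :
    ‖u‖ ^ 2 = ∫ x in I, ‖u x‖ ^ 2 := by
  have h1 : ‖u‖ ^ 2 = RCLike.re (inner ℂ u u) := (inner_self_eq_norm_sq (𝕜 := ℂ) u).symm
  rw [h1, L2.inner_def, ← integral_re (L2.integrable_inner u u)]
  refine integral_congr_ae (ae_of_all _ fun x => ?_)
  exact inner_self_eq_norm_sq (𝕜 := ℂ) (u x)

theorem integrable_norm_sq (u : Lp ℂ 2 (volume.restrict I)) :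
    Integrable (fun x => ‖u x‖ ^ 2) (volume.restrict I) :=
  (memLp_two_iff_integrable_sq_norm (Lp.memLp u).1).1 (Lp.memLp u)

theorem norm_sq_primitive_le {u v : Lp ℂ 2 (volume.restrict I)} {F : ℝ → ℂ}
    (hF : IsPrimitive F (I.indicator v)) (hu : u =ᵐ[volume.restrict I] F) {p q : ℝ} (hpq : p < q)
    (hsub : Set.Ioo p q ⊆ I) {x : ℝ} (hx : x ∈ Set.Icc p q) :
    ‖F x‖ ^ 2 ≤ 2 / (q - p) * (∫ t in Set.Ioo p q, ‖u t‖ ^ 2)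
      + 2 * (q - p) * ∫ t in Set.Ioo p q, ‖v t‖ ^ 2 := by
  have hle : volume.restrict (Set.Ioo p q) ≤ volume.restrict I := Measure.restrict_mono hsub le_rfl
  have e1 : ∫ t in p..q, ‖F t‖ ^ 2 = ∫ t in Set.Ioo p q, ‖u t‖ ^ 2 := by
    rw [intervalIntegral.integral_of_le hpq.le, integral_Ioc_eq_integral_Ioo]
    refine integral_congr_ae ?_
    filter_upwards [ae_mono hle hu] with t ht
    rw [ht]
  have hV : ∀ t ∈ Set.Ioo p q, ‖I.indicator v t‖ ^ 2 = ‖v t‖ ^ 2 := fun t ht => by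
    rw [Set.indicator_of_mem (hsub ht)]
  have e2 : ∫ t in p..q, ‖I.indicator v t‖ ^ 2 = ∫ t in Set.Ioo p q, ‖v t‖ ^ 2 := by
    rw [intervalIntegral.integral_of_le hpq.le, integral_Ioc_eq_integral_Ioo]
    exact setIntegral_congr_fun measurableSet_Ioo hV
  rw [← e1, ← e2]
  refine hF.norm_sq_le hpq ?_ hx
  rw [intervalIntegrable_iff_integrableOn_Ioo_of_le hpq.le]
  exact ((integrable_norm_sq v).mono_measure hle).congr
    ((ae_restrict_iff' measurableSet_Ioo).2 (ae_of_all _ fun t ht => (hV t ht).symm))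

end EdgePrimitive

/-! ### Boundary values and integration by parts on one edge. -/

section Tails

theorem tendsto_integral_Ioo_atTop {g : ℝ → ℝ} (hg : Integrable g) :
    Tendsto (fun x => ∫ t in Set.Ioo x (x + 1), g t) atTop (𝓝 0) := by
  have h1 := intervalIntegral_tendsto_integral_Ioi (0 : ℝ) hg.integrableOn tendsto_id
  have h2 := (h1.comp (tendsto_atTop_add_const_right atTop (1 : ℝ) tendsto_id)).sub h1
  rw [sub_self] at h2
  refine h2.congr fun x => ?_
  rw [Function.comp_apply, id, id, intervalIntegral.integral_interval_sub_left
    hg.intervalIntegrable hg.intervalIntegrable,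
    intervalIntegral.integral_of_le (by linarith), integral_Ioc_eq_integral_Ioo]

theorem tendsto_integral_Ioo_atBot {g : ℝ → ℝ} (hg : Integrable g) :
    Tendsto (fun x => ∫ t in Set.Ioo (x - 1) x, g t) atBot (𝓝 0) := by
  have h1 := intervalIntegral_tendsto_integral_Iic (0 : ℝ) hg.integrableOn tendsto_id
  have h2 := (h1.comp (tendsto_atBot_add_const_right atBot (-1 : ℝ) tendsto_id)).sub h1
  rw [sub_self] at h2
  refine h2.congr fun x => ?_
  have h3 := intervalIntegral.integral_add_adjacent_intervals
    (hg.intervalIntegrable (a := x + -1) (b := x)) (hg.intervalIntegrable (b := 0))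
  rw [Function.comp_apply, id, id, ← h3, add_sub_cancel_right, ← sub_eq_add_neg,
    intervalIntegral.integral_of_le (by linarith), integral_Ioc_eq_integral_Ioo]

end Tails

namespace MetricGraph

variable {V E : Type*} (Γ : MetricGraph V E)

theorem ordConnected_edge (e : E) : (Γ.edge e).OrdConnected :=
  ⟨fun _ hx _ hy _ hz => ⟨hx.1.trans_le (EReal.coe_le_coe_iff.2 hz.1),
    (EReal.coe_le_coe_iff.2 hz.2).trans_lt hy.2⟩⟩

theorem nonempty_edge (e : E) : (Γ.edge e).Nonempty := by
  obtain ⟨x, h1, h2⟩ := EReal.lt_iff_exists_real_btwn.1 (Γ.lt e)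
  exact ⟨x, h1, h2⟩

variable {Γ}

theorem coe_toReal_a {e : E} (h : ⊥ < Γ.a e) : ((Γ.a e).toReal : EReal) = Γ.a e :=
  EReal.coe_toReal ((Γ.lt e).trans_le le_top).ne h.ne'

theorem coe_toReal_b {e : E} (h : Γ.b e < ⊤) : ((Γ.b e).toReal : EReal) = Γ.b e :=
  EReal.coe_toReal h.ne (bot_le.trans_lt (Γ.lt e)).ne'

theorem edge_mem_nhdsGT {e : E} (h : ⊥ < Γ.a e) : Γ.edge e ∈ 𝓝[>] (Γ.a e).toReal := by
  have h1 : {x : ℝ | (x : EReal) < Γ.b e} ∈ 𝓝 (Γ.a e).toReal :=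
    (isOpen_lt continuous_coe_real_ereal continuous_const).mem_nhds (by
      change ((Γ.a e).toReal : EReal) < Γ.b e
      rw [coe_toReal_a h]; exact Γ.lt e)
  filter_upwards [mem_nhdsWithin_of_mem_nhds h1, self_mem_nhdsWithin] with x hx hx'
  refine ⟨?_, hx⟩
  rw [← coe_toReal_a h]
  exact EReal.coe_lt_coe_iff.2 hx'

theorem edge_mem_nhdsLT {e : E} (h : Γ.b e < ⊤) : Γ.edge e ∈ 𝓝[<] (Γ.b e).toReal := by
  have h1 : {x : ℝ | Γ.a e < (x : EReal)} ∈ 𝓝 (Γ.b e).toReal :=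
    (isOpen_lt continuous_const continuous_coe_real_ereal).mem_nhds (by
      change Γ.a e < ((Γ.b e).toReal : EReal)
      rw [coe_toReal_b h]; exact Γ.lt e)
  filter_upwards [mem_nhdsWithin_of_mem_nhds h1, self_mem_nhdsWithin] with x hx hx'
  refine ⟨hx, ?_⟩
  rw [← coe_toReal_b h]
  exact EReal.coe_lt_coe_iff.2 hx'

theorem HasPositiveEdgeLength.exists_le (h : Γ.HasPositiveEdgeLength) :
    ∃ δ : ℝ, 0 < δ ∧ ∀ e, Γ.a e + δ ≤ Γ.b e := by
  obtain ⟨δ, h1, h2⟩ := EReal.lt_iff_exists_real_btwn.1 h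
  refine ⟨δ, by exact_mod_cast h1, fun e => ?_⟩
  have h3 : (δ : EReal) ≤ Γ.b e - Γ.a e := h2.le.trans (iInf_le _ e)
  rw [add_comm]
  have hlt := Γ.lt e
  generalize Γ.a e = a at *
  generalize Γ.b e = b at *
  induction a with
  | bot => simp
  | top => exact absurd hlt (not_lt.2 le_top)
  | coe a =>
    induction b with
    | bot => exact absurd hlt (not_lt.2 bot_le)
    | top => exact le_top
    | coe b =>
      norm_cast at h3 ⊢
      linarith

theorem Ioo_left_subset_edge {e : E} {δ : ℝ} (hδ : Γ.a e + δ ≤ Γ.b e) (h : ⊥ < Γ.a e) :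
    Set.Ioo (Γ.a e).toReal ((Γ.a e).toReal + δ) ⊆ Γ.edge e := fun x hx => by
  constructor
  · rw [← coe_toReal_a h]; exact EReal.coe_lt_coe_iff.2 hx.1
  · refine lt_of_lt_of_le ?_ hδ
    rw [← coe_toReal_a h, ← EReal.coe_add]
    exact EReal.coe_lt_coe_iff.2 hx.2

theorem Ioo_right_subset_edge {e : E} {δ : ℝ} (hδ : Γ.a e + δ ≤ Γ.b e) (h : Γ.b e < ⊤) :
    Set.Ioo ((Γ.b e).toReal - δ) (Γ.b e).toReal ⊆ Γ.edge e := fun x hx => by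
  constructor
  · have h1 : Γ.a e ≤ (((Γ.b e).toReal - δ : ℝ) : EReal) := by
      rw [EReal.coe_sub, coe_toReal_b h]
      exact EReal.le_sub_iff_add_le (Or.inl (EReal.coe_ne_bot _)) (Or.inl (EReal.coe_ne_top _))
        |>.2 hδ
    exact h1.trans_lt (EReal.coe_lt_coe_iff.2 hx.1)
  · rw [← coe_toReal_b h]; exact EReal.coe_lt_coe_iff.2 hx.2

/-- `l` and `r` are the boundary values of `u` on the edge `e`, with value zero at infinite ends. -/
structure HasEdgeTrace (e : E) (u : Lp ℂ 2 (volume.restrict (Γ.edge e))) (l r : ℂ) : Prop where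
  left_infinite : Γ.a e = ⊥ → l = 0
  right_infinite : Γ.b e = ⊤ → r = 0
  left : ⊥ < Γ.a e → HasBoundaryValue (𝓝[>] (Γ.a e).toReal) u l
  right : Γ.b e < ⊤ → HasBoundaryValue (𝓝[<] (Γ.b e).toReal) u r

section Limits

variable {e : E} {u v : Lp ℂ 2 (volume.restrict (Γ.edge e))} {F : ℝ → ℂ}

/-- The pointwise bound on (x, x + 1) involves only the L₂-masses of `u` and `v` there, which tend
to zero as x → ∞. -/
theorem tendsto_atTop_of_right_infinite (hF : IsPrimitive F ((Γ.edge e).indicator v))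
    (hu : u =ᵐ[volume.restrict (Γ.edge e)] F) (h : Γ.b e = ⊤) : Tendsto F atTop (𝓝 0) := by
  obtain ⟨x₀, hx₀⟩ := Γ.nonempty_edge e
  have hm := (Γ.isOpen_edge e).measurableSet
  have h1 := tendsto_integral_Ioo_atTop ((integrable_indicator_iff hm).2 (integrable_norm_sq u))
  have h2 := tendsto_integral_Ioo_atTop ((integrable_indicator_iff hm).2 (integrable_norm_sq v))
  have h3 := (h1.const_mul 2).add (h2.const_mul 2)
  rw [mul_zero, add_zero] at h3
  have h4 : Tendsto (fun x => ‖F x‖ ^ 2) atTop (𝓝 0) := by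
    refine squeeze_zero' (Eventually.of_forall fun _ => sq_nonneg _) ?_ h3
    filter_upwards [eventually_ge_atTop x₀] with x hx
    have hsub : Set.Ioo x (x + 1) ⊆ Γ.edge e := fun t ht =>
      ⟨hx₀.1.trans (EReal.coe_lt_coe_iff.2 (hx.trans_lt ht.1)), by rw [h]; exact EReal.coe_lt_top t⟩
    have h5 := norm_sq_primitive_le hF hu (lt_add_one x) hsub (x := x) ⟨le_rfl, by linarith⟩
    have h6 : ∀ w : Lp ℂ 2 (volume.restrict (Γ.edge e)), ∫ t in Set.Ioo x (x + 1),
        (Γ.edge e).indicator (fun t => ‖w t‖ ^ 2) t = ∫ t in Set.Ioo x (x + 1), ‖w t‖ ^ 2 :=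
      fun w => setIntegral_congr_fun measurableSet_Ioo fun t ht =>
        Set.indicator_of_mem (hsub ht) _
    rw [h6, h6]
    simpa using h5
  have h7 := h4.sqrt
  simp only [Real.sqrt_sq (norm_nonneg _), Real.sqrt_zero] at h7
  exact tendsto_zero_iff_norm_tendsto_zero.2 h7

theorem tendsto_atBot_of_left_infinite (hF : IsPrimitive F ((Γ.edge e).indicator v))
    (hu : u =ᵐ[volume.restrict (Γ.edge e)] F) (h : Γ.a e = ⊥) : Tendsto F atBot (𝓝 0) := by
  obtain ⟨x₀, hx₀⟩ := Γ.nonempty_edge e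
  have hm := (Γ.isOpen_edge e).measurableSet
  have h1 := tendsto_integral_Ioo_atBot ((integrable_indicator_iff hm).2 (integrable_norm_sq u))
  have h2 := tendsto_integral_Ioo_atBot ((integrable_indicator_iff hm).2 (integrable_norm_sq v))
  have h3 := (h1.const_mul 2).add (h2.const_mul 2)
  rw [mul_zero, add_zero] at h3
  have h4 : Tendsto (fun x => ‖F x‖ ^ 2) atBot (𝓝 0) := by
    refine squeeze_zero' (Eventually.of_forall fun _ => sq_nonneg _) ?_ h3
    filter_upwards [eventually_le_atBot x₀] with x hx
    have hsub : Set.Ioo (x - 1) x ⊆ Γ.edge e := fun t ht =>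
      ⟨by rw [h]; exact EReal.bot_lt_coe t,
        (EReal.coe_lt_coe_iff.2 (ht.2.trans_le hx)).trans hx₀.2⟩
    have h5 := norm_sq_primitive_le hF hu (sub_one_lt x) hsub (x := x) ⟨by linarith, le_rfl⟩
    have h6 : ∀ w : Lp ℂ 2 (volume.restrict (Γ.edge e)), ∫ t in Set.Ioo (x - 1) x,
        (Γ.edge e).indicator (fun t => ‖w t‖ ^ 2) t = ∫ t in Set.Ioo (x - 1) x, ‖w t‖ ^ 2 :=
      fun w => setIntegral_congr_fun measurableSet_Ioo fun t ht =>
        Set.indicator_of_mem (hsub ht) _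
    rw [h6, h6]
    simpa using h5
  have h7 := h4.sqrt
  simp only [Real.sqrt_sq (norm_nonneg _), Real.sqrt_zero] at h7
  exact tendsto_zero_iff_norm_tendsto_zero.2 h7

theorem tendsto_atTop_of_right_finite (hF : IsPrimitive F ((Γ.edge e).indicator v))
    (h : Γ.b e < ⊤) : Tendsto F atTop (𝓝 (F (Γ.b e).toReal)) := by
  refine tendsto_const_nhds.congr' ?_
  filter_upwards [eventually_ge_atTop (Γ.b e).toReal] with x hx
  have h1 := hF.sub_eq (Γ.b e).toReal x
  rw [intervalIntegral.integral_zero_ae (ae_of_all _ fun t ht => ?_), sub_eq_zero] at h1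
  · exact h1.symm
  · rw [Set.uIoc_of_le hx] at ht
    refine Set.indicator_of_notMem (fun h2 => ?_) _
    have h3 := h2.2
    rw [← coe_toReal_b h] at h3
    exact absurd (EReal.coe_lt_coe_iff.1 h3) (not_lt.2 ht.1.le)

theorem tendsto_atBot_of_left_finite (hF : IsPrimitive F ((Γ.edge e).indicator v))
    (h : ⊥ < Γ.a e) : Tendsto F atBot (𝓝 (F (Γ.a e).toReal)) := by
  refine tendsto_const_nhds.congr' ?_
  filter_upwards [eventually_le_atBot (Γ.a e).toReal] with x hx
  have h1 := hF.sub_eq x (Γ.a e).toReal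
  rw [intervalIntegral.integral_zero_ae (ae_of_all _ fun t ht => ?_), sub_eq_zero] at h1
  · exact h1
  · rw [Set.uIoc_of_le hx] at ht
    refine Set.indicator_of_notMem (fun h2 => ?_) _
    have h3 := h2.1
    rw [← coe_toReal_a h] at h3
    exact absurd (EReal.coe_lt_coe_iff.1 h3) (not_lt.2 ht.2)

/-- Puts finite and infinite ends on the same footing: at a finite end `F` is eventually equal to
its boundary value, at an infinite end it decays. -/
theorem HasEdgeTrace.tendsto {l r : ℂ} (ht : HasEdgeTrace e u l r)
    (hF : IsPrimitive F ((Γ.edge e).indicator v)) (hu : u =ᵐ[volume.restrict (Γ.edge e)] F) :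
    Tendsto F atBot (𝓝 l) ∧ Tendsto F atTop (𝓝 r) := by
  constructor
  · rcases eq_bot_or_bot_lt (Γ.a e) with h | h
    · rw [ht.left_infinite h]; exact tendsto_atBot_of_left_infinite hF hu h
    · rw [(ht.left h).eq_of_continuous (Γ.isOpen_edge e) hF.continuous hu (edge_mem_nhdsGT h)
        nhdsWithin_le_nhds]
      exact tendsto_atBot_of_left_finite hF h
  · rcases eq_top_or_lt_top (Γ.b e) with h | h
    · rw [ht.right_infinite h]; exact tendsto_atTop_of_right_infinite hF hu h
    · rw [(ht.right h).eq_of_continuous (Γ.isOpen_edge e) hF.continuous hu (edge_mem_nhdsLT h)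
        nhdsWithin_le_nhds]
      exact tendsto_atTop_of_right_finite hF h

/-- Integration by parts on an edge. -/
theorem inner_add_inner_eq {u' v' : Lp ℂ 2 (volume.restrict (Γ.edge e))} {lu ru lv rv : ℂ}
    (hu : IsWeakDeriv u u') (hv : IsWeakDeriv v v') (htu : HasEdgeTrace e u lu ru)
    (htv : HasEdgeTrace e v lv rv) :
    inner ℂ v u' + inner ℂ v' u = inner ℂ rv ru - inner ℂ lv lu := by
  have ho := Γ.isOpen_edge e
  have hm := ho.measurableSet
  obtain ⟨F, hF, hFu⟩ := hu.exists_primitive ho (Γ.ordConnected_edge e) (Γ.nonempty_edge e)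
  obtain ⟨G, hG, hGv⟩ := hv.exists_primitive ho (Γ.ordConnected_edge e) (Γ.nonempty_edge e)
  obtain ⟨h1, h2⟩ := htu.tendsto hF hFu
  obtain ⟨h3, h4⟩ := htv.tendsto hG hGv
  -- F·conj G is a primitive on ℝ whose density vanishes off the edge, so its total increment is the
  -- boundary term.
  have hP := hF.mul hG.conj
  have hcongr : (fun x => (Γ.edge e).indicator u' x * starRingEnd ℂ (G x)
      + F x * starRingEnd ℂ ((Γ.edge e).indicator v' x)) =ᵐ[volume]
      (Γ.edge e).indicator fun x => inner ℂ (v x) (u' x) + inner ℂ (v' x) (u x) := by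
    filter_upwards [(ae_restrict_iff' hm).1 hFu, (ae_restrict_iff' hm).1 hGv] with x h5 h6
    by_cases hx : x ∈ Γ.edge e
    · simp only [Set.indicator_of_mem hx, RCLike.inner_apply, h5 hx, h6 hx]
    · simp [Set.indicator_of_notMem hx]
  have hint : Integrable (fun x => inner ℂ (v x) (u' x) + inner ℂ (v' x) (u x))
      (volume.restrict (Γ.edge e)) := (L2.integrable_inner v u').add (L2.integrable_inner v' u)
  have key := hP.integral_eq_sub (((integrable_indicator_iff hm).2 hint).congr hcongr.symm)
    (h1.mul ((Complex.continuous_conj.tendsto _).comp h3))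
    (h2.mul ((Complex.continuous_conj.tendsto _).comp h4))
  rw [integral_congr_ae hcongr, integral_indicator hm, integral_add (L2.integrable_inner v u')
    (L2.integrable_inner v' u)] at key
  rw [L2.inner_def, L2.inner_def, key, RCLike.inner_apply, RCLike.inner_apply]

end Limits

end MetricGraph

/-! ### Traces in ℓ₂ and the Lagrange identity on the graph. -/

namespace MetricGraph

variable {V E : Type*} {Γ : MetricGraph V E}

section TraceExistence

theorem norm_sq_le_of_right {e : E} {u v : Lp ℂ 2 (volume.restrict (Γ.edge e))} {F : ℝ → ℂ}
    (hF : IsPrimitive F ((Γ.edge e).indicator v)) (hu : u =ᵐ[volume.restrict (Γ.edge e)] F)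
    {p q : ℝ} (hpq : p < q) (hsub : Set.Ioo p q ⊆ Γ.edge e) {x : ℝ} (hx : x ∈ Set.Icc p q) :
    ‖F x‖ ^ 2 ≤ 2 / (q - p) * ‖u‖ ^ 2 + 2 * (q - p) * ‖v‖ ^ 2 := by
  have hd : 0 < q - p := sub_pos.2 hpq
  refine (norm_sq_primitive_le hF hu hpq hsub hx).trans ?_
  rw [norm_sq_eq_integral u, norm_sq_eq_integral v]
  have h : ∀ w : Lp ℂ 2 (volume.restrict (Γ.edge e)),
      ∫ t in Set.Ioo p q, ‖w t‖ ^ 2 ≤ ∫ t in Γ.edge e, ‖w t‖ ^ 2 := fun w =>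
    setIntegral_mono_set (integrable_norm_sq w) (ae_of_all _ fun _ => sq_nonneg _)
      (LE.le.eventuallyLE hsub)
  exact add_le_add (mul_le_mul_of_nonneg_left (h u) (by positivity))
    (mul_le_mul_of_nonneg_left (h v) (by positivity))

theorem memℓp_of_norm_sq_le {ι : Type*} (s : ι → E) (hs : Function.Injective s) (u v : Γ.H)
    {x : ι → ℂ} {C : ℝ} (h : ∀ i, ‖x i‖ ^ 2 ≤ C * (‖u (s i)‖ ^ 2 + ‖v (s i)‖ ^ 2)) :
    Memℓp x 2 := by
  have hsum : ∀ w : Γ.H, Summable fun e => ‖w e‖ ^ 2 := fun w => by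
    have := (lp.memℓp w).summable (by norm_num)
    simpa using this
  refine memℓp_gen ?_
  have h1 : Summable fun e => C * (‖u e‖ ^ 2 + ‖v e‖ ^ 2) := ((hsum u).add (hsum v)).mul_left C
  have h2 := h1.comp_injective hs
  have h3 : Summable fun i => ‖x i‖ ^ 2 :=
    Summable.of_nonneg_of_le (fun i => sq_nonneg _) h h2
  simpa using h3

/-- The interval of length δ inside each edge gives |u(b−)|² ≤ (2/δ + 2δ)(‖u‖² + ‖v‖²) on that edge.
The constant does not depend on the edge, so the boundary values are square summable. -/
theorem HasPositiveEdgeLength.exists_isTraceR (hΓ : Γ.HasPositiveEdgeLength) {u v : Γ.H}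
    (h : Γ.IsDeriv u v) : ∃ x, Γ.IsTraceR u x := by
  obtain ⟨δ, hδ, hle⟩ := hΓ.exists_le
  choose F hF hFu using fun e => (h e).exists_primitive (Γ.isOpen_edge e) (Γ.ordConnected_edge e)
    (Γ.nonempty_edge e)
  have hmem : Memℓp (fun e : Γ.Er => F e (Γ.b e).toReal) 2 := by
    refine memℓp_of_norm_sq_le (C := 2 / δ + 2 * δ) (Subtype.val : Γ.Er → E)
      Subtype.val_injective u v fun e => ?_
    have h1 := norm_sq_le_of_right (hF e) (hFu e) (sub_lt_self (Γ.b e).toReal hδ)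
      (Ioo_right_subset_edge (hle e) e.2) (x := (Γ.b e).toReal) ⟨by linarith, le_rfl⟩
    rw [sub_sub_cancel] at h1
    have h2 : 0 < 2 / δ := by positivity
    nlinarith [sq_nonneg ‖u e‖, sq_nonneg ‖v e‖]
  refine ⟨⟨_, hmem⟩, fun e => ⟨F e, (hF e).continuous.continuousOn, hFu e, ?_⟩⟩
  exact ((hF e).continuous.tendsto _).mono_left nhdsWithin_le_nhds

theorem HasPositiveEdgeLength.exists_isTraceL (hΓ : Γ.HasPositiveEdgeLength) {u v : Γ.H}
    (h : Γ.IsDeriv u v) : ∃ x, Γ.IsTraceL u x := by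
  obtain ⟨δ, hδ, hle⟩ := hΓ.exists_le
  choose F hF hFu using fun e => (h e).exists_primitive (Γ.isOpen_edge e) (Γ.ordConnected_edge e)
    (Γ.nonempty_edge e)
  have hmem : Memℓp (fun e : Γ.El => F e (Γ.a e).toReal) 2 := by
    refine memℓp_of_norm_sq_le (C := 2 / δ + 2 * δ) (Subtype.val : Γ.El → E)
      Subtype.val_injective u v fun e => ?_
    have h1 := norm_sq_le_of_right (hF e) (hFu e) (lt_add_of_pos_right (Γ.a e).toReal hδ)
      (Ioo_left_subset_edge (hle e) e.2) (x := (Γ.a e).toReal) ⟨le_rfl, by linarith⟩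
    rw [add_sub_cancel_left] at h1
    have h2 : 0 < 2 / δ := by positivity
    nlinarith [sq_nonneg ‖u e‖, sq_nonneg ‖v e‖]
  refine ⟨⟨_, hmem⟩, fun e => ⟨F e, (hF e).continuous.continuousOn, hFu e, ?_⟩⟩
  exact ((hF e).continuous.tendsto _).mono_left nhdsWithin_le_nhds

theorem HasPositiveEdgeLength.exists_isTrace (hΓ : Γ.HasPositiveEdgeLength)
    {u u₁ u₂ u₃ : Γ.H} (h1 : Γ.IsDeriv u u₁) (h2 : Γ.IsDeriv u₁ u₂) (h3 : Γ.IsDeriv u₂ u₃) :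
    ∃ x y, Γ.IsTrace u x y := by
  obtain ⟨x0, r0⟩ := hΓ.exists_isTraceR h1
  obtain ⟨x1, r1⟩ := hΓ.exists_isTraceR h2
  obtain ⟨x2, r2⟩ := hΓ.exists_isTraceR h3
  obtain ⟨y0, l0⟩ := hΓ.exists_isTraceL h1
  obtain ⟨y1, l1⟩ := hΓ.exists_isTraceL h2
  obtain ⟨y2, l2⟩ := hΓ.exists_isTraceL h3
  exact ⟨WithLp.toLp 2 ![x0, x1, x2], WithLp.toLp 2 ![y0, y1, y2], u₁, u₂, h1, h2,
    ⟨r0, r1, r2⟩, ⟨l0, l1, l2⟩⟩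

end TraceExistence

section Uniqueness

theorem IsDeriv.unique {u v w : Γ.H} (h : Γ.IsDeriv u v) (h' : Γ.IsDeriv u w) : v = w := by
  have h1 := h.add (h'.smul (-1))
  rw [neg_one_smul, neg_one_smul, add_neg_cancel] at h1
  exact add_neg_eq_zero.1 h1.eq_zero

end Uniqueness

section Multiplication

/-- Multiplication by a bounded real function of the edge. -/
def edgeMul (m : E → ℝ) (hm : ∃ C : ℝ, ∀ e, |m e| ≤ C) (u : Γ.H) : Γ.H :=
  ⟨fun e => (m e : ℂ) • u e, by
    obtain ⟨C, hC⟩ := hm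
    refine ((lp.memℓp u).const_smul (C : ℂ)).mono' ?_
    intro e
    simp only [Pi.smul_apply, norm_smul, Complex.norm_real, Real.norm_eq_abs]
    exact mul_le_mul_of_nonneg_right ((hC e).trans (le_abs_self C)) (norm_nonneg _)⟩

variable {m : E → ℝ} (hm : ∃ C : ℝ, ∀ e, |m e| ≤ C)

theorem edgeMul_apply (u : Γ.H) (e : E) : edgeMul m hm u e = (m e : ℂ) • u e := rfl

theorem inner_edgeMul_left (u v : Γ.H) :
    inner ℂ (edgeMul m hm u) v = inner ℂ u (edgeMul m hm v) := by
  rw [lp.inner_eq_tsum, lp.inner_eq_tsum]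
  refine tsum_congr fun e => ?_
  rw [edgeMul_apply, edgeMul_apply, inner_smul_left, inner_smul_right, Complex.conj_ofReal]

theorem IsDeriv.edgeMul {u v : Γ.H} (h : Γ.IsDeriv u v) :
    Γ.IsDeriv (edgeMul m hm u) (edgeMul m hm v) := fun e => (h e).smul _

theorem IsTraceR.edgeMul {u : Γ.H} {x : lp (fun _ : Γ.Er => ℂ) 2} (h : Γ.IsTraceR u x) :
    Γ.IsTraceR (edgeMul m hm u)
      (mulOp (fun e : Γ.Er => m e) (hm.imp fun _ h e => h e) x) := fun e => (h e).smul (m e : ℂ)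

theorem IsTraceL.edgeMul {u : Γ.H} {x : lp (fun _ : Γ.El => ℂ) 2} (h : Γ.IsTraceL u x) :
    Γ.IsTraceL (edgeMul m hm u)
      (mulOp (fun e : Γ.El => m e) (hm.imp fun _ h e => h e) x) := fun e => (h e).smul (m e : ℂ)

end Multiplication

section Lagrange

/-- Extension by zero turns sums over E_l and E_r into sums over all edges, so that the edgewise
identities can be added up. -/
theorem hasSum_inner_extend {p : E → Prop} [DecidablePred p]
    (x y : lp (fun _ : {e // p e} => ℂ) 2) :
    HasSum (fun e => inner ℂ (if h : p e then x ⟨e, h⟩ else 0) (if h : p e then y ⟨e, h⟩ else 0))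
      (inner ℂ x y) := by
  refine (Function.Injective.hasSum_iff (Subtype.val_injective (p := p)) ?_).1 ?_
  · intro e he
    have : ¬ p e := fun h => he ⟨⟨e, h⟩, rfl⟩
    simp [this]
  · have h : ((fun e => inner ℂ (if h : p e then x ⟨e, h⟩ else 0)
        (if h : p e then y ⟨e, h⟩ else 0)) ∘ Subtype.val) = fun e => inner ℂ (x e) (y e) := by
      funext e
      simp [e.2]
    rw [h]
    exact lp.hasSum_inner (𝕜 := ℂ) x y

theorem hasEdgeTrace_of_isTrace [∀ e, Decidable (⊥ < Γ.a e)] [∀ e, Decidable (Γ.b e < ⊤)]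
    {u : Γ.H} {x : lp (fun _ : Γ.Er => ℂ) 2} {y : lp (fun _ : Γ.El => ℂ) 2}
    (hx : Γ.IsTraceR u x) (hy : Γ.IsTraceL u y) (e : E) :
    HasEdgeTrace e (u e) (if h : ⊥ < Γ.a e then y ⟨e, h⟩ else 0)
      (if h : Γ.b e < ⊤ then x ⟨e, h⟩ else 0) where
  left_infinite h := dif_neg (by simp [h])
  right_infinite h := dif_neg (by simp [h])
  left h := by rw [dif_pos h]; exact hy ⟨e, h⟩
  right h := by rw [dif_pos h]; exact hx ⟨e, h⟩

/-- Integration by parts on a metric graph. -/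
theorem IsDeriv.inner_add_inner_eq {u u' v v' : Γ.H} (hu : Γ.IsDeriv u u') (hv : Γ.IsDeriv v v')
    {x x' : lp (fun _ : Γ.Er => ℂ) 2} {y y' : lp (fun _ : Γ.El => ℂ) 2}
    (hx : Γ.IsTraceR u x) (hy : Γ.IsTraceL u y) (hx' : Γ.IsTraceR v x') (hy' : Γ.IsTraceL v y') :
    inner ℂ v u' + inner ℂ v' u = inner ℂ x' x - inner ℂ y' y := by
  classical
  have h1 := (lp.hasSum_inner (𝕜 := ℂ) v u').add (lp.hasSum_inner (𝕜 := ℂ) v' u)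
  have h2 := (hasSum_inner_extend (p := fun e => Γ.b e < ⊤) x' x).sub
    (hasSum_inner_extend (p := fun e => ⊥ < Γ.a e) y' y)
  refine h1.unique ?_
  convert! h2 using 2 with e
  exact MetricGraph.inner_add_inner_eq (hu e) (hv e) (hasEdgeTrace_of_isTrace hx hy e)
    (hasEdgeTrace_of_isTrace hx' hy' e)

/-- The Lagrange identity for the maximal operator. -/
theorem IsMax.lagrange {c : AiryCoefficients E} {u f v g : Γ.H} (hu : Γ.IsMax c u f)
    (hv : Γ.IsMax c v g) {x x' : L2Cube Γ.Er} {y y' : L2Cube Γ.El} (htu : Γ.IsTrace u x y)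
    (htv : Γ.IsTrace v x' y') :
    inner ℂ v f + inner ℂ g u = kreinForm (Γ.Bl c) y y' - kreinForm (Γ.Br c) x x' := by
  obtain ⟨u₁, u₂, u₃, a1, a2, a3, a4⟩ := hu
  obtain ⟨v₁, v₂, v₃, b1, b2, b3, b4⟩ := hv
  obtain ⟨p1, p2, c1, c2, ⟨r0, r1, r2⟩, ⟨l0, l1, l2⟩⟩ := htu
  obtain ⟨q1, q2, d1, d2, ⟨s0, s1, s2⟩, ⟨m0, m1, m2⟩⟩ := htv
  obtain rfl := a1.unique c1
  obtain rfl := a2.unique c2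
  obtain rfl := b1.unique d1
  obtain rfl := b2.unique d2
  have hα := c.α_bounded
  have hβ := c.β_bounded
  have hf : f = edgeMul c.α hα u₃ + edgeMul c.β hβ u₁ := lp.ext (funext fun e => by
    rw [a4 e, H.add_apply, edgeMul_apply, edgeMul_apply])
  have hg : g = edgeMul c.α hα v₃ + edgeMul c.β hβ v₁ := lp.ext (funext fun e => by
    rw [b4 e, H.add_apply, edgeMul_apply, edgeMul_apply])
  -- The products (αu'', v), (αu', v'), (αu, v'') are taken with alternating signs, so the mixed
  -- interior terms cancel; (βu, v) supplies the first-order part.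
  have e1 := (a3.edgeMul hα).inner_add_inner_eq b1 (r2.edgeMul hα) (l2.edgeMul hα) s0 m0
  have e2 := (a2.edgeMul hα).inner_add_inner_eq b2 (r1.edgeMul hα) (l1.edgeMul hα) s1 m1
  have e3 := (a1.edgeMul hα).inner_add_inner_eq b3 (r0.edgeMul hα) (l0.edgeMul hα) s2 m2
  have e4 := (a1.edgeMul hβ).inner_add_inner_eq b1 (r0.edgeMul hβ) (l0.edgeMul hβ) s0 m0
  rw [hf, hg, inner_add_right, inner_add_left, inner_edgeMul_left, inner_edgeMul_left]
  simp only [kreinForm, Bl, Br, gramOp, LinearMap.coe_mk, AddHom.coe_mk, PiLp.inner_apply,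
    Fin.sum_univ_three, Matrix.cons_val, inner_sub_right, inner_neg_right]
  linear_combination e1 - e2 + e3 + e4

end Lagrange

end MetricGraph

/-! ### One-sided convolution of test functions and its transpose on L₂. -/

section Kernel

/-- The convolution of `φ` with the restriction of `k` to the interval between `0` and `σ`. -/
def kernelConv (σ : ℝ) (k φ : ℝ → ℝ) (s : ℝ) : ℝ := ∫ τ in 0..σ, k τ * φ (s - τ)

variable {σ : ℝ} {k φ : ℝ → ℝ}

theorem hasDerivAt_kernelConv (hk : Continuous k) (h1 : ContDiff ℝ ∞ φ) (h2 : HasCompactSupport φ)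
    (s : ℝ) : HasDerivAt (kernelConv σ k φ) (kernelConv σ k (deriv φ) s) s := by
  have hd : Continuous (deriv φ) := h1.continuous_deriv (by simp)
  obtain ⟨M, hM⟩ := h2.deriv.exists_bound_of_continuous hd
  have hφ : ∀ x, HasDerivAt φ (deriv φ x) x := fun x =>
    ((h1.differentiable (by simp)) x).hasDerivAt
  refine (intervalIntegral.hasDerivAt_integral_of_dominated_loc_of_deriv_le
    (F := fun s τ => k τ * φ (s - τ)) (F' := fun s τ => k τ * deriv φ (s - τ))
    (bound := fun τ => |k τ| * M) (s := Set.univ) univ_mem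
    (Eventually.of_forall fun x => ?_) ?_ ?_ ?_ ?_ ?_).2
  · exact (hk.mul (h1.continuous.comp (continuous_const.sub continuous_id))).aestronglyMeasurable
  · exact (hk.mul (h1.continuous.comp (continuous_const.sub continuous_id))).intervalIntegrable _ _
  · exact (hk.mul (hd.comp (continuous_const.sub continuous_id))).aestronglyMeasurable
  · refine ae_of_all _ fun τ _ x _ => ?_
    rw [norm_mul, Real.norm_eq_abs]
    exact mul_le_mul_of_nonneg_left (hM _) (abs_nonneg _)
  · exact (hk.abs.mul continuous_const).intervalIntegrable _ _
  · refine ae_of_all _ fun τ _ x _ => ?_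
    have := ((hφ (x - τ)).comp x ((hasDerivAt_id x).sub_const τ)).const_mul (k τ)
    simpa using this

theorem deriv_kernelConv (hk : Continuous k) (h1 : ContDiff ℝ ∞ φ) (h2 : HasCompactSupport φ) :
    deriv (kernelConv σ k φ) = kernelConv σ k (deriv φ) :=
  funext fun s => (hasDerivAt_kernelConv hk h1 h2 s).deriv

theorem contDiff_deriv_of_infty (h1 : ContDiff ℝ ∞ φ) : ContDiff ℝ ∞ (deriv φ) :=
  (contDiff_infty_iff_deriv.1 h1).2

theorem contDiff_kernelConv (hk : Continuous k) (h1 : ContDiff ℝ ∞ φ) (h2 : HasCompactSupport φ) :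
    ContDiff ℝ ∞ (kernelConv σ k φ) := by
  refine contDiff_infty.2 fun n => ?_
  induction n generalizing φ with
  | zero =>
    refine contDiff_zero.2 (continuous_iff_continuousAt.2 fun s => ?_)
    exact (hasDerivAt_kernelConv hk h1 h2 s).continuousAt
  | succ n ih =>
    push_cast
    refine contDiff_succ_iff_deriv.2 ⟨fun s =>
      (hasDerivAt_kernelConv hk h1 h2 s).differentiableAt, by simp, ?_⟩
    rw [deriv_kernelConv hk h1 h2]
    exact ih (contDiff_deriv_of_infty h1) h2.deriv

/-- Integration by parts in τ moves the derivative onto the kernel. Since `k` vanishes at `σ`, the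
only boundary term is at τ = 0, where the test function reappears with coefficient `k 0`. -/
theorem kernelConv_deriv (hk : ContDiff ℝ ∞ k) (hσ : k σ = 0) (h1 : ContDiff ℝ ∞ φ) (s : ℝ) :
    kernelConv σ k (deriv φ) s = kernelConv σ (deriv k) φ s + k 0 * φ s := by
  have hφ : ∀ x, HasDerivAt φ (deriv φ x) x := fun x =>
    ((h1.differentiable (by simp)) x).hasDerivAt
  have hk' : ∀ x, HasDerivAt k (deriv k x) x := fun x =>
    ((hk.differentiable (by simp)) x).hasDerivAt
  have hkd : Continuous (deriv k) := hk.continuous_deriv (by simp)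
  have hd : Continuous (deriv φ) := h1.continuous_deriv (by simp)
  have c1 : Continuous fun τ => deriv k τ * φ (s - τ) :=
    hkd.mul (h1.continuous.comp (continuous_const.sub continuous_id))
  have c2 : Continuous fun τ => k τ * deriv φ (s - τ) :=
    hk.continuous.mul (hd.comp (continuous_const.sub continuous_id))
  have h3 : ∀ τ, HasDerivAt (fun τ => k τ * φ (s - τ))
      (deriv k τ * φ (s - τ) - k τ * deriv φ (s - τ)) τ := fun τ => by
    have h4 := (hφ (s - τ)).comp τ ((hasDerivAt_id τ).const_sub s)
    have h5 := (hk' τ).mul h4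
    convert! h5 using 1
    simp [sub_eq_add_neg]
  have h4 := intervalIntegral.integral_eq_sub_of_hasDerivAt (fun τ _ => h3 τ)
    ((c1.sub c2).intervalIntegrable 0 σ)
  rw [intervalIntegral.integral_sub (c1.intervalIntegrable _ _) (c2.intervalIntegrable _ _), hσ,
    zero_mul, sub_zero, zero_sub] at h4
  unfold kernelConv
  linarith

theorem tsupport_kernelConv_subset (h2 : HasCompactSupport φ) :
    tsupport (kernelConv σ k φ) ⊆ (fun p : ℝ × ℝ => p.1 + p.2) '' (tsupport φ ×ˢ Set.uIcc 0 σ) := by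
  refine closure_minimal (fun s hs => ?_)
    ((h2.isCompact.prod isCompact_uIcc).image continuous_add).isClosed
  by_contra hcon
  refine hs (intervalIntegral.integral_zero_ae (ae_of_all _ fun τ hτ => ?_))
  have h0 : φ (s - τ) = 0 := image_eq_zero_of_notMem_tsupport fun h =>
    hcon ⟨(s - τ, τ), ⟨h, Set.uIoc_subset_uIcc hτ⟩, sub_add_cancel _ _⟩
  rw [h0, mul_zero]

theorem hasCompactSupport_kernelConv (h2 : HasCompactSupport φ) :
    HasCompactSupport (kernelConv σ k φ) :=
  ((h2.isCompact.prod isCompact_uIcc).image continuous_add).of_isClosed_subset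
    (isClosed_tsupport _) (tsupport_kernelConv_subset h2)

end Kernel

section CauchySchwarz

theorem sq_integral_norm_le {X : Type*} [MeasurableSpace X] {μ : Measure X} [IsFiniteMeasure μ]
    {f : X → ℂ} (hf : Integrable (fun x => ‖f x‖ ^ 2) μ) :
    (∫ x, ‖f x‖ ∂μ) ^ 2 ≤ μ.real Set.univ * ∫ x, ‖f x‖ ^ 2 ∂μ := by
  by_cases hf1 : Integrable (fun x => ‖f x‖) μ
  swap
  -- A non-integrable function has integral zero by convention.
  · rw [integral_undef hf1, zero_pow two_ne_zero]
    exact mul_nonneg measureReal_nonneg (integral_nonneg fun _ => sq_nonneg _)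
  set M := ∫ x, ‖f x‖ ∂μ
  set K := ∫ x, ‖f x‖ ^ 2 ∂μ
  set m := μ.real Set.univ with hm
  rcases eq_or_lt_of_le (measureReal_nonneg : 0 ≤ μ.real Set.univ) with h0 | h0
  · have : μ = 0 := by
      rw [← Measure.measure_univ_eq_zero]
      exact (measureReal_eq_zero_iff).1 h0.symm
    have hM : M = 0 := by simp [M, this]
    rw [hM, hm, ← h0]; simp
  · have h1 : 0 ≤ ∫ x, (‖f x‖ - M / m) ^ 2 ∂μ := integral_nonneg fun _ => sq_nonneg _
    have h2 : ∫ x, (‖f x‖ - M / m) ^ 2 ∂μ = K - 2 * (M / m) * M + m * (M / m) ^ 2 := by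
      have : ∀ x, (‖f x‖ - M / m) ^ 2 = ‖f x‖ ^ 2 - 2 * (M / m) * ‖f x‖ + (M / m) ^ 2 :=
        fun x => by ring
      simp_rw [this]
      have h4 : Integrable (fun x => 2 * (M / m) * ‖f x‖) μ := hf1.const_mul _
      have h5 : Integrable (fun x => ‖f x‖ ^ 2 - 2 * (M / m) * ‖f x‖) μ := hf.sub h4
      rw [integral_add h5 (integrable_const _), integral_sub hf h4, integral_const_mul,
        integral_const, smul_eq_mul]
    have h3 : m * (K - 2 * (M / m) * M + m * (M / m) ^ 2) = m * K - M ^ 2 := by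
      have : m ≠ 0 := h0.ne'
      field_simp; ring
    rw [h2] at h1
    nlinarith [mul_nonneg h0.le h1]

end CauchySchwarz

section KernelAdjoint

variable {I : Set ℝ}

/-- The substitution s = t + τ under a double integral, which transposes the convolution. -/
theorem measurePreserving_shear (μ : Measure ℝ) [SFinite μ] :
    MeasurePreserving (fun p : ℝ × ℝ => (p.1, p.2 + p.1)) (μ.prod volume) (μ.prod volume) :=
  (MeasurePreserving.id μ).skew_product (g := fun τ t => t + τ) (by fun_prop)
    (ae_of_all _ fun τ => (measurePreserving_add_right volume τ).map_eq)

/-- The transpose of `kernelConv` on `L₂`, followed by multiplication with a cutoff function. -/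
theorem exists_kernel_transpose (hI : IsOpen I) {σ M : ℝ} {k θ : ℝ → ℝ} (hk : Continuous k)
    (hM : ∀ τ, |k τ| ≤ M) (hθ : Continuous θ) (hθ1 : ∀ t, |θ t| ≤ 1)
    (v : Lp ℂ 2 (volume.restrict I)) :
    ∃ w : Lp ℂ 2 (volume.restrict I), ‖w‖ ≤ M * |σ| * ‖v‖ ∧
      ∀ φ : ℝ → ℝ, Continuous φ → HasCompactSupport φ → tsupport φ ⊆ I →
        ∫ x in I, φ x • w x = ∫ x, kernelConv σ k (fun t => θ t * φ t) x • I.indicator v x := by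
  have hM0 : 0 ≤ M := (abs_nonneg _).trans (hM 0)
  set ν : Measure ℝ := volume.restrict (Set.uIoc 0 σ) with hν
  have hνm : ν.real Set.univ = |σ| := by
    rw [hν, measureReal_restrict_apply_univ, measureReal_def, Real.volume_uIoc, sub_zero,
      ENNReal.toReal_ofReal (abs_nonneg _)]
  have : IsFiniteMeasure ν := ⟨by
    rw [hν, Measure.restrict_apply_univ]; simp [Set.uIoc]⟩
  set W : ℝ → ℂ := I.indicator v with hW
  have hWm : StronglyMeasurable W := (Lp.stronglyMeasurable v).indicator hI.measurableSet
  have hW2 : Integrable (fun s => ‖W s‖ ^ 2) :=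
    (memLp_two_iff_integrable_sq_norm (memLp_indicator hI v).1).1 (memLp_indicator hI v)
  have hWnorm : ∫ s, ‖W s‖ ^ 2 = ‖v‖ ^ 2 := by
    rw [norm_sq_eq_integral v, ← integral_indicator hI.measurableSet]
    congr 1
    funext x
    by_cases hx : x ∈ I <;> simp [hW, hx]
  -- The orientation of the integral from 0 to `σ`; both directions of shift are needed later.
  let ε : ℝ := if 0 ≤ σ then 1 else -1
  have hε : |ε| = 1 := by simp only [ε]; split_ifs <;> simp
  have hmW : StronglyMeasurable fun p : ℝ × ℝ => W (p.1 + p.2) :=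
    hWm.comp_measurable (measurable_fst.add measurable_snd)
  let C : ℝ → ℂ := fun t => (ε * θ t) • ∫ τ, k τ • W (t + τ) ∂ν
  have hCm : StronglyMeasurable C :=
    (continuous_const.mul hθ).stronglyMeasurable.smul
      (((hk.comp continuous_snd).stronglyMeasurable.smul hmW).integral_prod_right)
  have hg : Integrable (fun p : ℝ × ℝ => ‖W (p.2 + p.1)‖ ^ 2) (ν.prod volume) := by
    have h1 : Integrable (fun p : ℝ × ℝ => (1 : ℝ) * ‖W p.2‖ ^ 2) (ν.prod volume) :=
      (integrable_const (1 : ℝ)).mul_prod hW2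
    have h2 := (measurePreserving_shear ν).integrable_comp_of_integrable h1
    simpa [Function.comp_def] using h2
  have hgint : ∫ t, ∫ τ, ‖W (t + τ)‖ ^ 2 ∂ν = |σ| * ‖v‖ ^ 2 := by
    have h1 := integral_prod_symm _ hg
    have h2 := integral_prod _ hg
    have h3 : ∀ τ, ∫ t, ‖W (t + τ)‖ ^ 2 = ‖v‖ ^ 2 := fun τ => by
      rw [integral_add_right_eq_self (fun t => ‖W t‖ ^ 2) τ, hWnorm]
    simp only [h3] at h2
    rw [← h1, h2, integral_const, smul_eq_mul, hνm]
  have hgslice : ∀ t, Integrable (fun τ => ‖W (t + τ)‖ ^ 2) ν := fun t =>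
    (hW2.comp_add_left t).restrict
  -- Cauchy–Schwarz on an interval of length |σ|. Integrating over t contributes the second factor
  -- |σ|, by translation invariance.
  have hCle : ∀ t, ‖C t‖ ^ 2 ≤ M ^ 2 * |σ| * ∫ τ, ‖W (t + τ)‖ ^ 2 ∂ν := by
    intro t
    have hL : Integrable (fun τ => W (t + τ)) ν := by
      refine (memLp_one_iff_integrable.1 (MemLp.mono_exponent (q := 2) ?_ (by norm_num)))
      refine (memLp_two_iff_integrable_sq_norm ?_).2 (hgslice t)
      exact (hWm.comp_measurable (measurable_const.add measurable_id)).aestronglyMeasurable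
    have h1 : ‖C t‖ ≤ M * ∫ τ, ‖W (t + τ)‖ ∂ν := by
      simp only [C]
      rw [norm_smul, norm_mul, Real.norm_eq_abs, hε, one_mul, Real.norm_eq_abs]
      refine (mul_le_mul (hθ1 t) (norm_integral_le_integral_norm _) (norm_nonneg _)
        zero_le_one).trans ?_
      rw [one_mul, ← integral_const_mul]
      refine integral_mono_of_nonneg (ae_of_all _ fun _ => norm_nonneg _) (hL.norm.const_mul M)
        (ae_of_all _ fun τ => ?_)
      simp only [norm_smul, Real.norm_eq_abs]
      exact mul_le_mul_of_nonneg_right (hM τ) (norm_nonneg _)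
    have h2 := sq_integral_norm_le (hgslice t)
    rw [hνm] at h2
    calc ‖C t‖ ^ 2 ≤ (M * ∫ τ, ‖W (t + τ)‖ ∂ν) ^ 2 := by gcongr
      _ = M ^ 2 * (∫ τ, ‖W (t + τ)‖ ∂ν) ^ 2 := by ring
      _ ≤ M ^ 2 * (|σ| * ∫ τ, ‖W (t + τ)‖ ^ 2 ∂ν) := by gcongr
      _ = _ := by ring
  have hCint : Integrable (fun t => M ^ 2 * |σ| * ∫ τ, ‖W (t + τ)‖ ^ 2 ∂ν) :=
    hg.integral_prod_right.const_mul _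
  have hC2 : Integrable fun t => ‖C t‖ ^ 2 :=
    hCint.mono' (hCm.norm.pow 2).aestronglyMeasurable (ae_of_all _ fun t => by
      rw [Real.norm_of_nonneg (sq_nonneg _)]; exact hCle t)
  have hCL : MemLp C 2 (volume.restrict I) :=
    ((memLp_two_iff_integrable_sq_norm hCm.aestronglyMeasurable).2 hC2).restrict I
  let w : Lp ℂ 2 (volume.restrict I) := hCL.toLp
  have hw : w =ᵐ[volume.restrict I] C := hCL.coeFn_toLp
  refine ⟨w, ?_, fun φ h1 h2 h3 => ?_⟩
  · have h4 : ‖w‖ ^ 2 ≤ (M * |σ| * ‖v‖) ^ 2 := by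
      rw [norm_sq_eq_integral]
      have h5 : ∫ x in I, ‖w x‖ ^ 2 = ∫ x in I, ‖C x‖ ^ 2 := by
        refine integral_congr_ae ?_
        filter_upwards [hw] with x hx
        rw [hx]
      rw [h5]
      calc ∫ x in I, ‖C x‖ ^ 2 ≤ ∫ x, ‖C x‖ ^ 2 :=
            setIntegral_le_integral hC2 (ae_of_all _ fun _ => sq_nonneg _)
        _ ≤ ∫ t, M ^ 2 * |σ| * ∫ τ, ‖W (t + τ)‖ ^ 2 ∂ν := integral_mono hC2 hCint hCle
        _ = (M * |σ| * ‖v‖) ^ 2 := by rw [integral_const_mul, hgint]; ring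
    exact (sq_le_sq₀ (norm_nonneg _) (by positivity)).1 h4
  · have h4 : ∫ x in I, φ x • w x = ∫ x, φ x • C x := by
      rw [← setIntegral_eq_of_tsupport_subset h3]
      refine integral_congr_ae ?_
      filter_upwards [hw] with x hx
      rw [hx]
    have hcφ : Continuous fun t => θ t * φ t := hθ.mul h1
    have hsφ : HasCompactSupport fun t => θ t * φ t := h2.mul_left
    obtain ⟨B, hB⟩ := hsφ.exists_bound_of_continuous hcφ
    let f : ℝ × ℝ → ℂ := fun p => (k p.1 * (θ (p.2 - p.1) * φ (p.2 - p.1))) • W p.2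
    have hf : Integrable f (ν.prod volume) := by
      -- All shifted supports lie in this compact set, on which `W` is integrable; this justifies
      -- Fubini.
      let K := (fun p : ℝ × ℝ => p.1 + p.2) '' (tsupport (fun t => θ t * φ t) ×ˢ Set.uIcc 0 σ)
      have hK : IsCompact K := (hsφ.isCompact.prod isCompact_uIcc).image continuous_add
      have hWK : Integrable (K.indicator W) := by
        rw [integrable_indicator_iff hK.measurableSet]
        exact (locallyIntegrable_indicator hI v).integrableOn_isCompact hK
      have h5 : Integrable (fun p : ℝ × ℝ => (M * B) * ‖K.indicator W p.2‖) (ν.prod volume) :=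
        (integrable_const (M * B)).mul_prod hWK.norm
      refine h5.mono' ?_ ?_
      · have h6 : StronglyMeasurable fun p : ℝ × ℝ => k p.1 * (θ (p.2 - p.1) * φ (p.2 - p.1)) :=
          ((hk.comp continuous_fst).mul (hcφ.comp
            (continuous_snd.sub continuous_fst))).stronglyMeasurable
        exact (h6.smul (hWm.comp_measurable measurable_snd)).aestronglyMeasurable
      · have h6 : ∀ᵐ p : ℝ × ℝ ∂(ν.prod volume), p.1 ∈ Set.uIoc 0 σ :=
          Measure.quasiMeasurePreserving_fst.ae (ae_restrict_mem measurableSet_uIoc)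
        filter_upwards [h6] with p hp
        simp only [f, norm_smul]
        by_cases hpK : p.2 ∈ K
        · rw [Set.indicator_of_mem hpK, norm_mul]
          refine mul_le_mul_of_nonneg_right ?_ (norm_nonneg _)
          exact mul_le_mul (hM _) (hB _) (norm_nonneg _) hM0
        · have h7 : θ (p.2 - p.1) * φ (p.2 - p.1) = 0 := by
            by_contra hne
            refine hpK ⟨(p.2 - p.1, p.1), ⟨subset_tsupport _ hne, Set.uIoc_subset_uIcc hp⟩, ?_⟩
            simp
          simp [h7, Set.indicator_of_notMem hpK]
    have hfs := (measurePreserving_shear ν).integrable_comp_of_integrable hf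
    have e1 := integral_prod_symm _ hf
    have e2 := integral_prod_symm _ hfs
    have e3 : ∫ p, (f ∘ fun p : ℝ × ℝ => (p.1, p.2 + p.1)) p ∂(ν.prod volume)
        = ∫ p, f p ∂(ν.prod volume) := by
      have := (measurePreserving_shear ν).map_eq
      conv_rhs => rw [← this]
      rw [integral_map (measurePreserving_shear ν).aemeasurable
        (by rw [this]; exact hf.1)]
      rfl
    have e4 : ∀ x, kernelConv σ k (fun t => θ t * φ t) x • W x
        = ε • ∫ τ, f (τ, x) ∂ν := fun x => by
      simp only [f, kernelConv, intervalIntegral.intervalIntegral_eq_integral_uIoc]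
      rw [integral_smul_const, smul_assoc]
    have e5 : ∀ x, φ x • C x
        = ε • ∫ τ, (f ∘ fun p : ℝ × ℝ => (p.1, p.2 + p.1)) (τ, x) ∂ν := fun x => by
      simp only [f, C, Function.comp_apply, add_sub_cancel_right]
      rw [← integral_smul, ← integral_smul, ← integral_smul]
      congr 1
      funext τ
      simp only [smul_smul]
      congr 1
      ring
    simp only [h4, e4, e5, integral_smul]
    rw [← e1, ← e2, e3]

end KernelAdjoint

/-! ### Regularity of weak solutions, uniformly over the edges. -/

section Jets

/-- Cutoff functions with prescribed derivatives up to second order at zero. -/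
theorem exists_jet_cutoff {δ : ℝ} (hδ : 0 < δ) :
    ∃ χ : Fin 3 → ℝ → ℝ, ∀ j, ContDiff ℝ ∞ (χ j) ∧ HasCompactSupport (χ j) ∧
      tsupport (χ j) ⊆ Set.Ioo (-δ) δ ∧ χ j 0 = (if j = 0 then 1 else 0) ∧
      deriv (χ j) 0 = (if j = 1 then 1 else 0) ∧
      deriv (deriv (χ j)) 0 = (if j = 2 then 1 else 0) := by
  let f : ContDiffBump (0 : ℝ) := ⟨δ / 4, δ / 2, by positivity, by linarith⟩
  -- Taylor monomials times a bump equal to one near zero have the prescribed 2-jets.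
  let p : Fin 3 → ℝ → ℝ := ![fun _ => 1, fun x => x, fun x => x ^ 2 / 2]
  have hp : ∀ j, ContDiff ℝ ∞ (p j) := fun j => by
    fin_cases j
    · exact contDiff_const
    · exact contDiff_id
    · exact (contDiff_id.pow 2).div_const 2
  refine ⟨fun j x => p j x * f x, fun j => ⟨(hp j).mul f.contDiff, f.hasCompactSupport.mul_left,
    ?_, ?_⟩⟩
  · refine (tsupport_mul_subset_right).trans ?_
    rw [f.tsupport_eq]
    intro x hx
    rw [Metric.mem_closedBall, dist_zero_right, Real.norm_eq_abs] at hx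
    have hx' : |x| ≤ δ / 2 := hx
    rw [abs_le] at hx'
    exact ⟨by linarith [hx'.1], by linarith [hx'.2]⟩
  · have h0 : (fun x => p j x * f x) =ᶠ[𝓝 0] p j := by
      filter_upwards [f.eventuallyEq_one] with x hx
      rw [hx, Pi.one_apply, mul_one]
    have h1 := h0.deriv
    have h00 : p j 0 * f 0 = p j 0 := h0.eq_of_nhds
    beta_reduce
    rw [h00, h1.eq_of_nhds, h1.deriv_eq]
    have e1 : deriv (fun x : ℝ => x ^ 2 / 2) = fun x => x := by
      funext x
      simp
    fin_cases j <;> simp [p, e1]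

end Jets

section WeakEquation

variable {I : Set ℝ} {v w : Lp ℂ 2 (volume.restrict I)} {α β : ℝ}

/-- `v` is a weak solution of `α v''' + β v' = w`. -/
def IsWeakAirySolution (α β : ℝ) (v w : Lp ℂ 2 (volume.restrict I)) : Prop :=
  ∀ φ : ℝ → ℝ, ContDiff ℝ ∞ φ → HasCompactSupport φ → tsupport φ ⊆ I →
    (α : ℂ) * (∫ x in I, deriv (deriv (deriv φ)) x • v x) + β * (∫ x in I, deriv φ x • v x)
      = -∫ x in I, φ x • w x

/-- Test the equation with the convolution of `φ`. All derivatives fall on `k` except in the terms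
at τ = 0, so the 2-jet of `k` at zero selects which of φ, φ', φ'' survives. `hadm` keeps the shifted
support inside `I`. -/
theorem IsWeakAirySolution.kernelConv (h : IsWeakAirySolution α β v w) {σ : ℝ} {k φ : ℝ → ℝ}
    (hk : ContDiff ℝ ∞ k) (k0 : k σ = 0) (k1 : deriv k σ = 0) (k2 : deriv (deriv k) σ = 0)
    (h1 : ContDiff ℝ ∞ φ) (h2 : HasCompactSupport φ)
    (hadm : ∀ s ∈ tsupport φ, ∀ τ ∈ Set.uIcc 0 σ, s + τ ∈ I) :
    (α : ℂ) * ((∫ x in I, kernelConv σ (deriv (deriv (deriv k))) φ x • v x)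
        + deriv (deriv k) 0 * (∫ x in I, φ x • v x) + deriv k 0 * (∫ x in I, deriv φ x • v x)
        + k 0 * (∫ x in I, deriv (deriv φ) x • v x))
      + β * ((∫ x in I, kernelConv σ (deriv k) φ x • v x) + k 0 * (∫ x in I, φ x • v x))
      = -∫ x in I, kernelConv σ k φ x • w x := by
  have c1 := contDiff_deriv_of_infty h1
  have c2 := contDiff_deriv_of_infty c1
  have c3 := contDiff_deriv_of_infty c2
  have s1 := h2.deriv
  have s2 := s1.deriv
  have hk1 := contDiff_deriv_of_infty hk
  have hk2 := contDiff_deriv_of_infty hk1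
  have hk3 := contDiff_deriv_of_infty hk2
  have key := h (_root_.kernelConv σ k φ) (contDiff_kernelConv hk.continuous h1 h2)
    (hasCompactSupport_kernelConv h2) ((tsupport_kernelConv_subset h2).trans (by
      rintro _ ⟨⟨s, τ⟩, ⟨hs, hτ⟩, rfl⟩
      exact hadm s hs τ hτ))
  have d1 : deriv (_root_.kernelConv σ k φ) = fun x =>
      _root_.kernelConv σ (deriv k) φ x + k 0 * φ x := by
    rw [deriv_kernelConv hk.continuous h1 h2]
    exact funext fun x => kernelConv_deriv hk k0 h1 x
  have d3 : deriv (deriv (deriv (_root_.kernelConv σ k φ))) = fun x =>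
      _root_.kernelConv σ (deriv (deriv (deriv k))) φ x + deriv (deriv k) 0 * φ x
        + deriv k 0 * deriv φ x + k 0 * deriv (deriv φ) x := by
    rw [deriv_kernelConv hk.continuous h1 h2, deriv_kernelConv hk.continuous c1 s1,
      deriv_kernelConv hk.continuous c2 s2]
    funext x
    rw [kernelConv_deriv hk k0 c2, kernelConv_deriv hk1 k1 c1, kernelConv_deriv hk2 k2 h1]
  have hint : ∀ {ψ : ℝ → ℝ}, ContDiff ℝ ∞ ψ → HasCompactSupport ψ →
      Integrable (fun x => ψ x • v x) (volume.restrict I) := fun a b =>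
    integrable_test_smul v a.continuous b
  have i0 := hint h1 h2
  have i1 := hint c1 s1
  have i2 := hint c2 s2
  have j1 := hint (contDiff_kernelConv (σ := σ) hk1.continuous h1 h2)
    (hasCompactSupport_kernelConv h2)
  have j3 := hint (contDiff_kernelConv (σ := σ) hk3.continuous h1 h2)
    (hasCompactSupport_kernelConv h2)
  have hmul : ∀ (r : ℝ) {ψ : ℝ → ℝ}, Integrable (fun x => ψ x • v x) (volume.restrict I) →
      Integrable (fun x => (r * ψ x) • v x) (volume.restrict I) := fun r ψ hψ => by
    simp_rw [mul_smul]; exact hψ.smul r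
  have emul : ∀ (r : ℝ) (ψ : ℝ → ℝ), ∫ x in I, (r * ψ x) • v x = r * ∫ x in I, ψ x • v x :=
    fun r ψ => by simp_rw [mul_smul]; rw [integral_smul, Complex.real_smul]
  have e1 : ∫ x in I, (_root_.kernelConv σ (deriv k) φ x + k 0 * φ x) • v x
      = (∫ x in I, _root_.kernelConv σ (deriv k) φ x • v x) + k 0 * (∫ x in I, φ x • v x) := by
    simp_rw [add_smul]
    rw [integral_add j1 (hmul _ i0), emul]
  have e3 : ∫ x in I, (_root_.kernelConv σ (deriv (deriv (deriv k))) φ x + deriv (deriv k) 0 * φ x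
        + deriv k 0 * deriv φ x + k 0 * deriv (deriv φ) x) • v x
      = (∫ x in I, _root_.kernelConv σ (deriv (deriv (deriv k))) φ x • v x)
        + deriv (deriv k) 0 * (∫ x in I, φ x • v x) + deriv k 0 * (∫ x in I, deriv φ x • v x)
        + k 0 * (∫ x in I, deriv (deriv φ) x • v x) := by
    have a1 : Integrable (fun x => _root_.kernelConv σ (deriv (deriv (deriv k))) φ x • v x
        + (deriv (deriv k) 0 * φ x) • v x) (volume.restrict I) := j3.add (hmul _ i0)
    have a2 : Integrable (fun x => _root_.kernelConv σ (deriv (deriv (deriv k))) φ x • v x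
        + (deriv (deriv k) 0 * φ x) • v x + (deriv k 0 * deriv φ x) • v x) (volume.restrict I) :=
      a1.add (hmul _ i1)
    simp_rw [add_smul]
    rw [integral_add a2 (hmul _ i2), integral_add a1 (hmul _ i1), integral_add j3 (hmul _ i0),
      emul, emul, emul]
  rw [d3, e3, d1, e1] at key
  exact key

theorem exists_cutoff_mul {θ : ℝ → ℝ} (hθ : Continuous θ) (hθ1 : ∀ t, |θ t| ≤ 1)
    (v : Lp ℂ 2 (volume.restrict I)) :
    ∃ u : Lp ℂ 2 (volume.restrict I), ‖u‖ ≤ ‖v‖ ∧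
      ∀ φ : ℝ → ℝ, ∫ x in I, φ x • u x = ∫ x in I, (θ x * φ x) • v x := by
  have hm : MemLp (fun x => θ x • v x) 2 (volume.restrict I) :=
    (Lp.memLp v).mono (hθ.aestronglyMeasurable.smul (Lp.memLp v).1) (ae_of_all _ fun x => by
      rw [norm_smul]
      exact mul_le_of_le_one_left (norm_nonneg _) (hθ1 x))
  let u : Lp ℂ 2 (volume.restrict I) := hm.toLp
  have hu : u =ᵐ[volume.restrict I] fun x => θ x • v x := hm.coeFn_toLp
  refine ⟨u, Lp.norm_le_norm_of_ae_le ?_, fun φ => integral_congr_ae ?_⟩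
  · filter_upwards [hu] with x hx
    rw [hx, norm_smul]
    exact mul_le_of_le_one_left (norm_nonneg _) (hθ1 x)
  · filter_upwards [hu] with x hx
    rw [hx, smul_smul, mul_comm]

/-- With θφ as test function, the jet j = 1 isolates (θφ)' and j = 0 isolates (θφ)''. Every
remaining term is represented by an L₂-function through the transposed convolutions. The cutoff θ
restricts attention to the part of the edge where the shift by `σ` stays inside. -/
theorem IsWeakAirySolution.exists_cutoff_derivatives (hI : IsOpen I)
    (h : IsWeakAirySolution α β v w) (hα : 0 < α) {κ : ℝ} (hκα : 1 / α ≤ κ)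
    (hκβ : |β / α| ≤ κ) (hκ : 1 ≤ κ) {σ M : ℝ} {χ : Fin 3 → ℝ → ℝ}
    (hχ : ∀ j, ContDiff ℝ ∞ (χ j))
    (hχσ : ∀ j, χ j σ = 0 ∧ deriv (χ j) σ = 0 ∧ deriv (deriv (χ j)) σ = 0)
    (hχ0 : ∀ j, χ j 0 = (if j = 0 then 1 else 0) ∧ deriv (χ j) 0 = (if j = 1 then 1 else 0) ∧
      deriv (deriv (χ j)) 0 = (if j = 2 then 1 else 0))
    (hM : ∀ j τ, |χ j τ| ≤ M ∧ |deriv (χ j) τ| ≤ M ∧ |deriv (deriv (deriv (χ j))) τ| ≤ M)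
    {θ : ℝ → ℝ} (hθ : ContDiff ℝ ∞ θ) (hθ1 : ∀ t, |θ t| ≤ 1)
    (hadm : ∀ s ∈ tsupport θ, s ∈ I → ∀ τ ∈ Set.uIcc 0 σ, s + τ ∈ I) :
    ∃ v₁ v₂ : Lp ℂ 2 (volume.restrict I),
      ‖v₁‖ ≤ (2 * (M * |σ|) + 1) * κ * (‖v‖ + ‖w‖) ∧
      ‖v₂‖ ≤ (2 * (M * |σ|) + 1) * κ * (‖v‖ + ‖w‖) ∧
      ∀ φ : ℝ → ℝ, ContDiff ℝ ∞ φ → HasCompactSupport φ → tsupport φ ⊆ I →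
        ∫ x in I, deriv (fun t => θ t * φ t) x • v x = -∫ x in I, φ x • v₁ x ∧
        ∫ x in I, deriv (deriv fun t => θ t * φ t) x • v x = ∫ x in I, φ x • v₂ x := by
  have hκ0 : 0 ≤ κ := zero_le_one.trans hκ
  have hM0 : 0 ≤ M := (abs_nonneg _).trans (hM 0 0).1
  have hαc : (α : ℂ) ≠ 0 := by exact_mod_cast hα.ne'
  have hc1 : ∀ j, ContDiff ℝ ∞ (deriv (χ j)) := fun j => contDiff_deriv_of_infty (hχ j)
  have hc3 : ∀ j, ContDiff ℝ ∞ (deriv (deriv (deriv (χ j)))) := fun j =>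
    contDiff_deriv_of_infty (contDiff_deriv_of_infty (hc1 j))
  choose a ha ha' using fun j =>
    exists_kernel_transpose hI (σ := σ) (hc3 j).continuous (fun τ => (hM j τ).2.2) hθ.continuous
      hθ1 v
  choose b hb hb' using fun j =>
    exists_kernel_transpose hI (σ := σ) (hc1 j).continuous (fun τ => (hM j τ).2.1) hθ.continuous
      hθ1 v
  choose d hd hd' using fun j =>
    exists_kernel_transpose hI (σ := σ) (hχ j).continuous (fun τ => (hM j τ).1) hθ.continuous
      hθ1 w
  obtain ⟨z, hz, hz'⟩ := exists_cutoff_mul hθ.continuous hθ1 v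
  let g : Fin 3 → Lp ℂ 2 (volume.restrict I) := fun j =>
    a j + (((β / α : ℝ) : ℂ) • b j + ((1 / α : ℝ) : ℂ) • d j)
  have hg : ∀ j, ‖g j‖ ≤ 2 * (M * |σ|) * κ * (‖v‖ + ‖w‖) := fun j => by
    have n1 : ‖((β / α : ℝ) : ℂ) • b j‖ ≤ κ * (M * |σ| * ‖v‖) := by
      rw [norm_smul, Complex.norm_real, Real.norm_eq_abs]
      exact mul_le_mul hκβ (hb j) (norm_nonneg _) hκ0
    have n2 : ‖((1 / α : ℝ) : ℂ) • d j‖ ≤ κ * (M * |σ| * ‖w‖) := by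
      rw [norm_smul, Complex.norm_real, Real.norm_of_nonneg (by positivity)]
      exact mul_le_mul hκα (hd j) (norm_nonneg _) hκ0
    have n3 : ‖a j‖ ≤ κ * (M * |σ| * ‖v‖) := (ha j).trans (le_mul_of_one_le_left (by positivity) hκ)
    have n4 := (norm_add_le (a j) _).trans (add_le_add n3
      ((norm_add_le (((β / α : ℝ) : ℂ) • b j) (((1 / α : ℝ) : ℂ) • d j)).trans (add_le_add n1 n2)))
    refine n4.trans ?_
    have : 0 ≤ κ * (M * |σ| * ‖w‖) := by positivity
    linarith
  have hgi : ∀ j (φ : ℝ → ℝ), ContDiff ℝ ∞ φ → HasCompactSupport φ →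
      ∫ x in I, φ x • g j x = (∫ x in I, φ x • a j x) + ((β / α : ℝ) : ℂ) *
        (∫ x in I, φ x • b j x) + ((1 / α : ℝ) : ℂ) * (∫ x in I, φ x • d j x) := by
    intro j φ h1 h2
    have i : ∀ u : Lp ℂ 2 (volume.restrict I), Integrable (fun x => φ x • u x)
      (volume.restrict I) := fun u => integrable_test_smul u h1.continuous h2
    have e1 : ∫ x in I, φ x • g j x = ∫ x in I, (φ x • a j x + (((β / α : ℝ) : ℂ) • (φ x • b j x)
        + ((1 / α : ℝ) : ℂ) • (φ x • d j x))) := by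
      refine integral_congr_ae ?_
      filter_upwards [Lp.coeFn_add (a j) (((β / α : ℝ) : ℂ) • b j + ((1 / α : ℝ) : ℂ) • d j),
        Lp.coeFn_add (((β / α : ℝ) : ℂ) • b j) (((1 / α : ℝ) : ℂ) • d j),
        Lp.coeFn_smul ((β / α : ℝ) : ℂ) (b j), Lp.coeFn_smul ((1 / α : ℝ) : ℂ) (d j)]
        with x x1 x2 x3 x4
      simp only [g]
      rw [x1, Pi.add_apply, x2, Pi.add_apply, x3, x4, Pi.smul_apply, Pi.smul_apply, smul_add,
        smul_add, smul_comm (φ x), smul_comm (φ x)]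
    have i1 : Integrable (fun x => ((β / α : ℝ) : ℂ) • (φ x • b j x)) (volume.restrict I) :=
      (i (b j)).smul ((β / α : ℝ) : ℂ)
    have i2 : Integrable (fun x => ((1 / α : ℝ) : ℂ) • (φ x • d j x)) (volume.restrict I) :=
      (i (d j)).smul ((1 / α : ℝ) : ℂ)
    have i3 : Integrable (fun x => ((β / α : ℝ) : ℂ) • (φ x • b j x)
        + ((1 / α : ℝ) : ℂ) • (φ x • d j x)) (volume.restrict I) := i1.add i2
    rw [e1, integral_add (i _) i3, integral_add i1 i2, integral_smul, integral_smul,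
      smul_eq_mul, smul_eq_mul, add_assoc]
  have key : ∀ j (φ : ℝ → ℝ), ContDiff ℝ ∞ φ → HasCompactSupport φ → tsupport φ ⊆ I →
      (∫ x in I, φ x • g j x)
        + (deriv (deriv (χ j)) 0 * (∫ x in I, (θ x * φ x) • v x)
        + deriv (χ j) 0 * (∫ x in I, deriv (fun t => θ t * φ t) x • v x)
        + χ j 0 * (∫ x in I, deriv (deriv fun t => θ t * φ t) x • v x))
        + ((β / α : ℝ) : ℂ) * (χ j 0 * (∫ x in I, (θ x * φ x) • v x)) = 0 := by
    intro j φ h1 h2 h3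
    have e := h.kernelConv (σ := σ) (hχ j) (hχσ j).1 (hχσ j).2.1 (hχσ j).2.2 (hθ.mul h1)
      (h2.mul_left (f := θ)) (fun s hs => hadm s (tsupport_mul_subset_left hs)
        (h3 (tsupport_mul_subset_right hs)))
    rw [hgi j φ h1 h2, ha' j φ h1.continuous h2 h3, hb' j φ h1.continuous h2 h3,
      hd' j φ h1.continuous h2 h3, integral_smul_indicator hI, integral_smul_indicator hI,
      integral_smul_indicator hI]
    push_cast
    refine mul_left_cancel₀ hαc ?_
    rw [mul_zero]
    have e2 : (α : ℂ) * (β / α) = β := mul_div_cancel₀ _ hαc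
    have e3 : (α : ℂ) * (1 / α) = 1 := mul_div_cancel₀ _ hαc
    linear_combination e + ((∫ x in I, _root_.kernelConv σ (deriv (χ j)) (fun t => θ t * φ t) x • v x)
      + χ j 0 * (∫ x in I, (θ x * φ x) • v x)) * e2
      + (∫ x in I, _root_.kernelConv σ (χ j) (fun t => θ t * φ t) x • w x) * e3
  -- For j = 0 the first-order part of the equation leaves the extra term (β/α) θv, represented by
  -- z; it accounts for the summand one in the constant.
  refine ⟨g 1, -(g 0 + ((β / α : ℝ) : ℂ) • z), ?_, ?_, fun φ h1 h2 h3 => ⟨?_, ?_⟩⟩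
  · refine (hg 1).trans ?_
    gcongr
    linarith
  · have n1 : ‖((β / α : ℝ) : ℂ) • z‖ ≤ κ * ‖v‖ := by
      rw [norm_smul, Complex.norm_real, Real.norm_eq_abs]
      exact mul_le_mul hκβ hz (norm_nonneg _) hκ0
    rw [norm_neg]
    refine (norm_add_le _ _).trans ((add_le_add (hg 0) n1).trans ?_)
    have : 0 ≤ κ * ‖w‖ := by positivity
    linarith
  · have e := key 1 φ h1 h2 h3
    rw [(hχ0 1).1, (hχ0 1).2.1, (hχ0 1).2.2] at e
    simp only [Fin.isValue, one_ne_zero, if_false, if_true, Complex.ofReal_zero,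
      Complex.ofReal_one, Fin.reduceEq] at e
    linear_combination e
  · have e := key 0 φ h1 h2 h3
    rw [(hχ0 0).1, (hχ0 0).2.1, (hχ0 0).2.2] at e
    simp only [Fin.isValue, zero_ne_one, if_false, if_true, Complex.ofReal_zero,
      Complex.ofReal_one, Fin.reduceEq] at e
    have i : ∀ u : Lp ℂ 2 (volume.restrict I), Integrable (fun x => φ x • u x)
      (volume.restrict I) := fun u => integrable_test_smul u h1.continuous h2
    have e1 : ∫ x in I, φ x • (-(g 0 + ((β / α : ℝ) : ℂ) • z) : Lp ℂ 2 (volume.restrict I)) x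
        = ∫ x in I, -(φ x • g 0 x + ((β / α : ℝ) : ℂ) • (φ x • z x)) := by
      refine integral_congr_ae ?_
      filter_upwards [Lp.coeFn_neg (g 0 + ((β / α : ℝ) : ℂ) • z),
        Lp.coeFn_add (g 0) (((β / α : ℝ) : ℂ) • z), Lp.coeFn_smul ((β / α : ℝ) : ℂ) z]
        with x x1 x2 x3
      rw [x1, Pi.neg_apply, x2, Pi.add_apply, x3, Pi.smul_apply, smul_neg, smul_add,
        smul_comm (φ x)]
    have i1 : Integrable (fun x => ((β / α : ℝ) : ℂ) • (φ x • z x)) (volume.restrict I) :=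
      (i z).smul ((β / α : ℝ) : ℂ)
    rw [e1, integral_neg, integral_add (i _) i1, integral_smul, smul_eq_mul, hz']
    linear_combination e

end WeakEquation

theorem integral_test_smul_combination {I : Set ℝ} (p q : Lp ℂ 2 (volume.restrict I)) {φ : ℝ → ℝ}
    (h1 : Continuous φ) (h2 : HasCompactSupport φ) (a b : ℂ) :
    ∫ x in I, φ x • (a • p + b • q : Lp ℂ 2 (volume.restrict I)) x
      = a * (∫ x in I, φ x • p x) + b * ∫ x in I, φ x • q x := by
  have hp := integrable_test_smul p h1 h2
  have hq := integrable_test_smul q h1 h2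
  have e : ∫ x in I, φ x • (a • p + b • q : Lp ℂ 2 (volume.restrict I)) x
      = ∫ x in I, (a * (φ x • p x) + b * (φ x • q x)) := by
    refine integral_congr_ae ?_
    filter_upwards [Lp.coeFn_add (a • p) (b • q), Lp.coeFn_smul a p, Lp.coeFn_smul b q]
      with x k1 k2 k3
    rw [k1, Pi.add_apply, k2, k3, Pi.smul_apply, Pi.smul_apply, smul_add, smul_comm _ a,
      smul_comm _ b, smul_eq_mul, smul_eq_mul]
  rw [e, integral_add (hp.const_mul a) (hq.const_mul b), integral_const_mul, integral_const_mul]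

namespace MetricGraph

variable {V E : Type*} {Γ : MetricGraph V E}

/-- On the support of θ there is room to move right by δ, on that of 1 − θ room to move left. The
transition takes place between a + 2δ and a + 3δ, so that a + 4δ is still inside the edge. If a =
−∞, moving left is always possible and θ = 0. -/
theorem exists_edge_cutoff {e : E} {δ : ℝ} (hδ : 0 < δ) (hle : Γ.a e + ((5 * δ : ℝ) : EReal) ≤ Γ.b e) :
    ∃ θ : ℝ → ℝ, ContDiff ℝ ∞ θ ∧ (∀ t, 0 ≤ θ t ∧ θ t ≤ 1) ∧
      (∀ s ∈ tsupport θ, s ∈ Γ.edge e → ((s + δ : ℝ) : EReal) < Γ.b e) ∧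
      ∀ s ∈ tsupport (fun t => 1 - θ t), s ∈ Γ.edge e → Γ.a e < ((s - δ : ℝ) : EReal) := by
  rcases eq_bot_or_bot_lt (Γ.a e) with ha | ha
  · refine ⟨fun _ => 0, contDiff_const, fun t => ⟨le_rfl, zero_le_one⟩, fun s hs => ?_,
      fun s _ _ => by rw [ha]; exact EReal.bot_lt_coe _⟩
    have h0 : tsupport (fun _ : ℝ => (0 : ℝ)) = ∅ := tsupport_eq_empty_iff.2 rfl
    rw [h0] at hs
    exact absurd hs (Set.notMem_empty s)
  · set a' := (Γ.a e).toReal with ha'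
    have hac : (a' : EReal) = Γ.a e := coe_toReal_a ha
    refine ⟨fun t => 1 - Real.smoothTransition ((t - (a' + 2 * δ)) / δ),
      contDiff_const.sub (Real.smoothTransition.contDiff.comp
        ((contDiff_id.sub contDiff_const).div_const δ)), fun t =>
        ⟨sub_nonneg.2 (Real.smoothTransition.le_one _),
          sub_le_self _ (Real.smoothTransition.nonneg _)⟩, fun s hs _ => ?_, fun s hs _ => ?_⟩
    · have h1 : tsupport (fun t => 1 - Real.smoothTransition ((t - (a' + 2 * δ)) / δ))
          ⊆ Set.Iic (a' + 3 * δ) := closure_minimal (fun t ht => by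
        by_contra hcon
        rw [Set.mem_Iic, not_le] at hcon
        refine ht ?_
        beta_reduce
        rw [Real.smoothTransition.one_of_one_le, sub_self]
        rw [one_le_div hδ]; linarith) isClosed_Iic
      have h2 : s ≤ a' + 3 * δ := h1 hs
      refine lt_of_lt_of_le ?_ hle
      rw [← hac, ← EReal.coe_add]
      exact EReal.coe_lt_coe_iff.2 (by linarith)
    · have h1 : tsupport (fun t => 1 - (1 - Real.smoothTransition ((t - (a' + 2 * δ)) / δ)))
          ⊆ Set.Ici (a' + 2 * δ) := closure_minimal (fun t ht => by
        by_contra hcon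
        rw [Set.mem_Ici, not_le] at hcon
        refine ht ?_
        simp only [sub_sub_cancel]
        exact Real.smoothTransition.zero_of_nonpos
          (div_nonpos_of_nonpos_of_nonneg (by linarith) hδ.le)) isClosed_Ici
      have h2 : a' + 2 * δ ≤ s := h1 hs
      rw [← hac]
      exact EReal.coe_lt_coe_iff.2 (by linarith)

/-- Weak solutions on an edge have weak derivatives, with uniform bounds. -/
theorem exists_edge_derivatives {δ : ℝ} (hδ : 0 < δ)
    (hle : ∀ e, Γ.a e + ((5 * δ : ℝ) : EReal) ≤ Γ.b e) (κ : ℝ) (hκ : 1 ≤ κ) :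
    ∃ C : ℝ, 0 ≤ C ∧ ∀ (e : E) (α β : ℝ) (v w : Lp ℂ 2 (volume.restrict (Γ.edge e))),
      0 < α → 1 / α ≤ κ → |β / α| ≤ κ → IsWeakAirySolution α β v w →
      ∃ v₁ v₂ : Lp ℂ 2 (volume.restrict (Γ.edge e)),
        ‖v₁‖ ≤ C * (‖v‖ + ‖w‖) ∧ ‖v₂‖ ≤ C * (‖v‖ + ‖w‖) ∧
        ∀ φ : ℝ → ℝ, ContDiff ℝ ∞ φ → HasCompactSupport φ → tsupport φ ⊆ Γ.edge e →
          ∫ x in Γ.edge e, deriv φ x • v x = -∫ x in Γ.edge e, φ x • v₁ x ∧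
          ∫ x in Γ.edge e, deriv (deriv φ) x • v x = ∫ x in Γ.edge e, φ x • v₂ x := by
  obtain ⟨χ, hχ⟩ := exists_jet_cutoff hδ
  have hd1 : ∀ j, ContDiff ℝ ∞ (deriv (χ j)) := fun j => contDiff_deriv_of_infty (hχ j).1
  have hd2 : ∀ j, ContDiff ℝ ∞ (deriv (deriv (χ j))) := fun j => contDiff_deriv_of_infty (hd1 j)
  have hd3 : ∀ j, ContDiff ℝ ∞ (deriv (deriv (deriv (χ j)))) := fun j =>
    contDiff_deriv_of_infty (hd2 j)
  have hzero : ∀ σ, |σ| = δ → ∀ j, χ j σ = 0 ∧ deriv (χ j) σ = 0 ∧ deriv (deriv (χ j)) σ = 0 := by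
    intro σ hσ j
    -- The supports lie in the open interval (−δ, δ), so the kernels vanish to all orders at both
    -- ends ±δ.
    have h1 : σ ∉ tsupport (χ j) := fun h => by
      have h2 := (hχ j).2.2.1 h
      have h3 : |σ| < δ := abs_lt.2 h2
      linarith
    exact ⟨image_eq_zero_of_notMem_tsupport h1,
      image_eq_zero_of_notMem_tsupport fun h => h1 (tsupport_deriv_subset h),
      image_eq_zero_of_notMem_tsupport fun h => h1 (tsupport_deriv_subset
        (tsupport_deriv_subset h))⟩
  choose M0 hM0 using fun j => (hχ j).2.1.exists_bound_of_continuous (hχ j).1.continuous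
  choose M1 hM1 using fun j => (hχ j).2.1.deriv.exists_bound_of_continuous (hd1 j).continuous
  choose M3 hM3 using fun j =>
    (hχ j).2.1.deriv.deriv.deriv.exists_bound_of_continuous (hd3 j).continuous
  have hn0 : ∀ j, 0 ≤ M0 j := fun j => (norm_nonneg _).trans (hM0 j 0)
  have hn1 : ∀ j, 0 ≤ M1 j := fun j => (norm_nonneg _).trans (hM1 j 0)
  have hn3 : ∀ j, 0 ≤ M3 j := fun j => (norm_nonneg _).trans (hM3 j 0)
  let M : ℝ := ∑ j, (M0 j + M1 j + M3 j)
  have hMj : ∀ j, M0 j + M1 j + M3 j ≤ M := fun j =>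
    Finset.single_le_sum (f := fun j => M0 j + M1 j + M3 j)
      (fun i _ => by have := hn0 i; have := hn1 i; have := hn3 i; positivity) (Finset.mem_univ j)
  have hM : ∀ j τ, |χ j τ| ≤ M ∧ |deriv (χ j) τ| ≤ M ∧ |deriv (deriv (deriv (χ j))) τ| ≤ M := by
    intro j τ
    have := hMj j
    have := hn0 j
    have := hn1 j
    have := hn3 j
    exact ⟨(hM0 j τ).trans (by linarith), (hM1 j τ).trans (by linarith),
      (hM3 j τ).trans (by linarith)⟩
  have hMnn : 0 ≤ M := (abs_nonneg _).trans (hM 0 0).1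
  refine ⟨2 * ((2 * (M * δ) + 1) * κ), by positivity, fun e α β v w hα hκα hκβ h => ?_⟩
  obtain ⟨θ, hθ, hθ1, hr, hl⟩ := exists_edge_cutoff hδ (hle e)
  have habs : ∀ t, |θ t| ≤ 1 := fun t => by rw [abs_of_nonneg (hθ1 t).1]; exact (hθ1 t).2
  have habs' : ∀ t, |1 - θ t| ≤ 1 := fun t => by
    rw [abs_of_nonneg (sub_nonneg.2 (hθ1 t).2)]; linarith [(hθ1 t).1]
  have hθ' : ContDiff ℝ ∞ (fun t => 1 - θ t) := contDiff_const.sub hθ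
  have hI := Γ.isOpen_edge e
  obtain ⟨p₁, p₂, hp1, hp2, hp⟩ := h.exists_cutoff_derivatives hI hα hκα hκβ hκ (σ := δ)
    (fun j => (hχ j).1) (hzero δ (abs_of_pos hδ)) (fun j => (hχ j).2.2.2) hM hθ habs
    (fun s hs hsI τ hτ => by
      rw [Set.uIcc_of_le hδ.le] at hτ
      exact ⟨hsI.1.trans_le (EReal.coe_le_coe_iff.2 (by linarith [hτ.1])),
        (EReal.coe_le_coe_iff.2 (by linarith [hτ.2])).trans_lt (hr s hs hsI)⟩)
  obtain ⟨q₁, q₂, hq1, hq2, hq⟩ := h.exists_cutoff_derivatives hI hα hκα hκβ hκ (σ := -δ)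
    (fun j => (hχ j).1) (hzero (-δ) (by rw [abs_neg, abs_of_pos hδ])) (fun j => (hχ j).2.2.2) hM
    hθ' habs' (fun s hs hsI τ hτ => by
      rw [Set.uIcc_of_ge (by linarith)] at hτ
      exact ⟨(hl s hs hsI).trans_le (EReal.coe_le_coe_iff.2 (by linarith [hτ.1])),
        (EReal.coe_le_coe_iff.2 (by linarith [hτ.2])).trans_lt hsI.2⟩)
  rw [abs_of_pos hδ] at hp1 hp2
  rw [abs_neg, abs_of_pos hδ] at hq1 hq2
  refine ⟨p₁ + q₁, p₂ + q₂, (norm_add_le _ _).trans (by linarith),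
    (norm_add_le _ _).trans (by linarith), fun φ h1 h2 h3 => ?_⟩
  obtain ⟨a1, a2⟩ := hp φ h1 h2 h3
  obtain ⟨b1, b2⟩ := hq φ h1 h2 h3
  have s1 : ContDiff ℝ ∞ fun t => θ t * φ t := hθ.mul h1
  have s2 : ContDiff ℝ ∞ fun t => (1 - θ t) * φ t := hθ'.mul h1
  have k1 : HasCompactSupport fun t => θ t * φ t := h2.mul_left
  have k2 : HasCompactSupport fun t => (1 - θ t) * φ t := h2.mul_left
  -- Adding the two pieces removes the cutoffs: derivatives of θφ and (1 − θ)φ sum to derivatives of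
  -- φ.
  have hsum : φ = fun t => θ t * φ t + (1 - θ t) * φ t := by funext t; ring
  have e1 : deriv φ = fun t => deriv (fun t => θ t * φ t) t
      + deriv (fun t => (1 - θ t) * φ t) t := by
    conv_lhs => rw [hsum]
    funext t
    exact deriv_fun_add (s1.differentiable (by simp) t) (s2.differentiable (by simp) t)
  have t1 := contDiff_deriv_of_infty s1
  have t2 := contDiff_deriv_of_infty s2
  have e2 : deriv (deriv φ) = fun t => deriv (deriv fun t => θ t * φ t) t
      + deriv (deriv fun t => (1 - θ t) * φ t) t := by
    rw [e1]
    funext t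
    exact deriv_fun_add (t1.differentiable (by simp) t) (t2.differentiable (by simp) t)
  have hi : ∀ (u : Lp ℂ 2 (volume.restrict (Γ.edge e))) {ψ : ℝ → ℝ}, ContDiff ℝ ∞ ψ →
      HasCompactSupport ψ → Integrable (fun x => ψ x • u x) (volume.restrict (Γ.edge e)) :=
    fun u _ c d => integrable_test_smul u c.continuous d
  have eadd : ∀ p q : Lp ℂ 2 (volume.restrict (Γ.edge e)), ∫ x in Γ.edge e, φ x • (p + q : Lp ℂ 2 (volume.restrict (Γ.edge e))) x
      = (∫ x in Γ.edge e, φ x • p x) + ∫ x in Γ.edge e, φ x • q x := fun p q => by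
    rw [← integral_add (hi p h1 h2) (hi q h1 h2)]
    refine integral_congr_ae ?_
    filter_upwards [Lp.coeFn_add p q] with x hx
    rw [hx, Pi.add_apply, smul_add]
  rw [eadd, eadd, e2, e1]
  simp_rw [add_smul]
  rw [integral_add (hi v t1 k1.deriv) (hi v t2 k2.deriv), integral_add
    (hi v (contDiff_deriv_of_infty t1) k1.deriv.deriv)
    (hi v (contDiff_deriv_of_infty t2) k2.deriv.deriv), a1, a2, b1, b2]
  exact ⟨by ring, rfl⟩

theorem memℓp_of_norm_le {v w : Γ.H} {f : ∀ e, Lp ℂ 2 (volume.restrict (Γ.edge e))} {C : ℝ}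
    (h : ∀ e, ‖f e‖ ≤ C * (‖v e‖ + ‖w e‖)) : Memℓp f 2 := by
  have hsum : ∀ w : Γ.H, Summable fun e => ‖w e‖ ^ 2 := fun w => by
    have := (lp.memℓp w).summable (by norm_num)
    simpa using this
  refine memℓp_gen ?_
  have h1 : Summable fun e => (2 * C ^ 2) * (‖v e‖ ^ 2 + ‖w e‖ ^ 2) :=
    ((hsum v).add (hsum w)).mul_left _
  have h3 : Summable fun e => ‖f e‖ ^ 2 := by
    refine Summable.of_nonneg_of_le (fun e => sq_nonneg _) (fun e => ?_) h1
    have h4 : ‖f e‖ ^ 2 ≤ (C * (‖v e‖ + ‖w e‖)) ^ 2 := pow_le_pow_left₀ (norm_nonneg _) (h e) 2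
    nlinarith [mul_nonneg (sq_nonneg C) (sq_nonneg (‖v e‖ - ‖w e‖))]
  simpa using h3

/-- Regularity: weak solutions lie in the domain of the maximal operator. -/
theorem HasPositiveEdgeLength.isMax_of_isWeakAirySolution (hΓ : Γ.HasPositiveEdgeLength)
    (c : AiryCoefficients E) {v w : Γ.H}
    (h : ∀ e, IsWeakAirySolution (c.α e) (c.β e) (v e) (w e)) : Γ.IsMax c v w := by
  obtain ⟨δ', hδ', hle'⟩ := hΓ.exists_le
  obtain ⟨δ, hδ, hδ5⟩ : ∃ δ : ℝ, 0 < δ ∧ 5 * δ = δ' := ⟨δ' / 5, by positivity, by ring⟩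
  rw [← hδ5] at hle'
  obtain ⟨a, ha, hαa⟩ := c.α_lower
  obtain ⟨b, hb⟩ := c.β_bounded
  have hinv : ∀ e, 1 / c.α e ≤ 1 / a := fun e => one_div_le_one_div_of_le ha (hαa e)
  -- Dominates 1/α and |β/α| on every edge, which makes the constant `C` edge-independent.
  let κ : ℝ := 1 + 1 / a + |b| / a
  have ha' : 0 < 1 / a := by positivity
  have hb' : 0 ≤ |b| / a := by positivity
  have hκβ : ∀ e, |c.β e / c.α e| ≤ |b| / a := fun e => by
    rw [abs_div, abs_of_pos (c.α_pos e)]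
    exact div_le_div₀ (abs_nonneg _) ((hb e).trans (le_abs_self b)) ha (hαa e)
  obtain ⟨C, hC, hCe⟩ := exists_edge_derivatives hδ hle' κ (by simp only [κ]; linarith)
  choose v₁ v₂ hv1 hv2 hφ using fun e => hCe e (c.α e) (c.β e) (v e) (w e) (c.α_pos e)
    ((hinv e).trans (by simp only [κ]; linarith)) ((hκβ e).trans (by simp only [κ]; linarith))
    (h e)
  let V₁ : Γ.H := ⟨v₁, memℓp_of_norm_le hv1⟩
  let V₂ : Γ.H := ⟨v₂, memℓp_of_norm_le hv2⟩
  have hm1 : ∃ C : ℝ, ∀ e, |1 / c.α e| ≤ C := ⟨1 / a, fun e => by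
    rw [abs_of_pos (one_div_pos.2 (c.α_pos e))]; exact hinv e⟩
  have hm2 : ∃ C : ℝ, ∀ e, |c.β e / c.α e| ≤ C := ⟨_, hκβ⟩
  -- The third derivative is read off from the equation: (w − β v') / α.
  let V₃ : Γ.H := edgeMul _ hm1 w + (-1 : ℂ) • edgeMul _ hm2 V₁
  have hα : ∀ e, (c.α e : ℂ) ≠ 0 := fun e => Complex.ofReal_ne_zero.2 (c.α_pos e).ne'
  have hV3 : ∀ e, V₃ e = (1 / c.α e : ℂ) • w e + (-(c.β e / c.α e) : ℂ) • v₁ e := fun e => by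
    simp only [V₃]
    rw [H.add_apply, H.smul_apply, edgeMul_apply, edgeMul_apply, smul_smul]
    push_cast
    rw [neg_one_mul]
  refine ⟨V₁, V₂, V₃, fun e φ h1 h2 h3 => (hφ e φ h1 h2 h3).1, fun e φ h1 h2 h3 => ?_,
    fun e φ h1 h2 h3 => ?_, fun e => ?_⟩
  -- Inserting φ' into the identity for v' expresses ∫ φ'' v in terms of v₁, while the identity for
  -- v'' expresses it in terms of v₂.
  · have t1 := contDiff_deriv_of_infty h1
    have k1 := (hφ e (deriv φ) t1 h2.deriv (tsupport_deriv_subset.trans h3)).1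
    have k2 := (hφ e φ h1 h2 h3).2
    change ∫ x in Γ.edge e, deriv φ x • v₁ e x = -∫ x in Γ.edge e, φ x • v₂ e x
    rw [← k2, k1, neg_neg]
  -- Inserting φ' into the identity for v'' produces ∫ φ''' v, which the weak equation evaluates.
  · have t1 := contDiff_deriv_of_infty h1
    have k1 := (hφ e (deriv φ) t1 h2.deriv (tsupport_deriv_subset.trans h3)).2
    have k2 := (hφ e φ h1 h2 h3).1
    have k3 := h e φ h1 h2 h3
    change ∫ x in Γ.edge e, deriv φ x • v₂ e x = -∫ x in Γ.edge e, φ x • V₃ e x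
    rw [hV3, integral_test_smul_combination _ _ h1.continuous h2, ← k1]
    rw [k2] at k3
    have := hα e
    field_simp
    linear_combination k3
  · rw [hV3]
    change w e = (c.α e : ℂ) • _ + (c.β e : ℂ) • v₁ e
    rw [smul_add, smul_smul, smul_smul, mul_one_div_cancel (hα e), one_smul, add_assoc, ← add_smul,
      mul_neg, mul_div_cancel₀ _ (hα e), neg_add_cancel, zero_smul, add_zero]

end MetricGraph

/-! ### Surjectivity of the trace map. -/

section Bump

variable {χ : ℝ → ℝ}

theorem memLp_translate (h : Continuous χ) (hc : HasCompactSupport χ) (p : ℝ) :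
    MemLp (fun x => ((χ (x - p) : ℝ) : ℂ)) 2 := by
  have h1 : MemLp (fun x => ((χ x : ℝ) : ℂ)) 2 :=
    (Complex.continuous_ofReal.comp h).memLp_of_hasCompactSupport
      (hc.comp_left (g := fun r : ℝ => (r : ℂ)) Complex.ofReal_zero)
  exact h1.comp_measurePreserving (measurePreserving_sub_right volume p)

/-- The translate `x ↦ χ (x - p)` of a test function as an element of `L₂(I)`. -/
def translateLp (I : Set ℝ) (h : Continuous χ) (hc : HasCompactSupport χ) (p : ℝ) :
    Lp ℂ 2 (volume.restrict I) :=
  ((memLp_translate h hc p).restrict I).toLp _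

theorem coeFn_translateLp (I : Set ℝ) (h : Continuous χ) (hc : HasCompactSupport χ) (p : ℝ) :
    translateLp I h hc p =ᵐ[volume.restrict I] fun x => ((χ (x - p) : ℝ) : ℂ) :=
  MemLp.coeFn_toLp _

/-- One bound serves all edges and all positions, so ℓ₂-weighted translates sum to an element of the
Hilbert space. -/
theorem exists_norm_translateLp_le (h : Continuous χ) (hc : HasCompactSupport χ) :
    ∃ C : ℝ, ∀ I p, ‖translateLp I h hc p‖ ≤ C := by
  refine ⟨(eLpNorm (fun x => ((χ x : ℝ) : ℂ)) 2 volume).toReal, fun I p => ?_⟩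
  rw [translateLp, Lp.norm_toLp]
  have h0 := memLp_translate h hc 0
  simp only [sub_zero] at h0
  have h1 := eLpNorm_comp_measurePreserving (p := 2) h0.1 (measurePreserving_sub_right volume p)
  refine ENNReal.toReal_mono h0.2.ne ?_
  rw [← h1]
  exact eLpNorm_mono_measure _ Measure.restrict_le_self

theorem isWeakDeriv_translateLp (I : Set ℝ) (h : ContDiff ℝ ∞ χ) (hc : HasCompactSupport χ)
    (p : ℝ) : IsWeakDeriv (translateLp I h.continuous hc p)
      (translateLp I (h.continuous_deriv (by simp)) hc.deriv p) := by
  intro φ h1 h2 h3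
  have hp : IsPrimitive (fun x => ((χ (x - p) : ℝ) : ℂ)) (fun x => ((deriv χ (x - p) : ℝ) : ℂ)) :=
    .of_hasDerivAt (fun x => ((((h.differentiable (by simp)) (x - p)).hasDerivAt.comp_sub_const
      x p)).ofReal_comp) (Complex.continuous_ofReal.comp ((h.continuous_deriv (by simp)).comp
        (continuous_id.sub continuous_const)))
  have e : ∀ {χ : ℝ → ℝ} (ψ : ℝ → ℝ) (h : Continuous χ) (hc : HasCompactSupport χ),
      tsupport ψ ⊆ I → ∫ x in I, ψ x • translateLp I h hc p x
        = ∫ x, ψ x • ((χ (x - p) : ℝ) : ℂ) := fun ψ h hc hψ => by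
    rw [← setIntegral_eq_of_tsupport_subset hψ]
    refine integral_congr_ae ?_
    filter_upwards [coeFn_translateLp I h hc p] with x hx
    rw [hx]
  rw [e _ _ _ (tsupport_deriv_subset.trans h3), e _ _ _ h3, hp.integral_deriv_smul h1 h2]

theorem hasBoundaryValue_translateLp (I : Set ℝ) (h : Continuous χ) (hc : HasCompactSupport χ)
    {l : Filter ℝ} (p q : ℝ) (hl : l ≤ 𝓝 q) :
    HasBoundaryValue l (translateLp I h hc p) ((χ (q - p) : ℝ) : ℂ) := by
  have hcont : Continuous fun x => ((χ (x - p) : ℝ) : ℂ) :=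
    Complex.continuous_ofReal.comp (h.comp (continuous_id.sub continuous_const))
  exact ⟨_, hcont.continuousOn, coeFn_translateLp I h hc p, (hcont.tendsto q).mono_left hl⟩

end Bump

namespace MetricGraph

variable {V E : Type*} {Γ : MetricGraph V E}

theorem isMax_of_isDeriv (c : AiryCoefficients E) {u u₁ u₂ u₃ : Γ.H} (h1 : Γ.IsDeriv u u₁)
    (h2 : Γ.IsDeriv u₁ u₂) (h3 : Γ.IsDeriv u₂ u₃) : Γ.IsMax c u
      (edgeMul c.α c.α_bounded u₃ + edgeMul c.β c.β_bounded u₁) :=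
  ⟨u₁, u₂, u₃, h1, h2, h3, fun e => by rw [H.add_apply, edgeMul_apply, edgeMul_apply]⟩

section BumpSum

variable {P : E → Prop} {χ : ℝ → ℝ}

/-- The element of the Hilbert space given on the edges `e` with `P e` by
`t ↦ y e * χ (t - p e)`, and by zero on the others. -/
def bumpSum (h : Continuous χ) (hc : HasCompactSupport χ) (p : E → ℝ)
    (y : lp (fun _ : {e // P e} => ℂ) 2) : Γ.H :=
  ⟨fun e => open Classical in
      (if h : P e then y ⟨e, h⟩ else 0) • translateLp (Γ.edge e) h hc (p e), by
    classical
    obtain ⟨C, hC⟩ := exists_norm_translateLp_le h hc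
    have hsum : Summable fun e => ‖(if h : P e then y ⟨e, h⟩ else 0 : ℂ)‖ ^ 2 := by
      have h1 := (hasSum_inner_extend y y).summable.norm
      refine h1.congr fun e => ?_
      simp
    refine memℓp_gen ?_
    have h3 : Summable fun e => ‖(if h : P e then y ⟨e, h⟩ else 0 : ℂ) •
        translateLp (Γ.edge e) h hc (p e)‖ ^ 2 := by
      refine Summable.of_nonneg_of_le (fun _ => sq_nonneg _) (fun e => ?_) (hsum.mul_left (C ^ 2))
      rw [norm_smul, mul_pow, mul_comm]
      exact mul_le_mul_of_nonneg_right (pow_le_pow_left₀ (norm_nonneg _) (hC _ _) 2) (sq_nonneg _)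
    simpa using h3⟩

open Classical in
theorem bumpSum_apply (h : Continuous χ) (hc : HasCompactSupport χ) (p : E → ℝ)
    (y : lp (fun _ : {e // P e} => ℂ) 2) (e : E) : (bumpSum h hc p y : Γ.H) e =
      (if h : P e then y ⟨e, h⟩ else 0) • translateLp (Γ.edge e) h hc (p e) := rfl

theorem isDeriv_bumpSum (h : ContDiff ℝ ∞ χ) (hc : HasCompactSupport χ) (p : E → ℝ)
    (y : lp (fun _ : {e // P e} => ℂ) 2) : Γ.IsDeriv (bumpSum h.continuous hc p y)
      (bumpSum (h.continuous_deriv (by simp)) hc.deriv p y) := fun e => by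
  rw [bumpSum_apply, bumpSum_apply]
  exact (isWeakDeriv_translateLp _ h hc _).smul _

/-- The functions on the edges with finite starting point, concentrated there. -/
theorem exists_isTrace_left (c : AiryCoefficients E) {δ : ℝ} (hle : ∀ e, Γ.a e + δ ≤ Γ.b e)
    (hχ : ContDiff ℝ ∞ χ) (hc : HasCompactSupport χ) (hs : tsupport χ ⊆ Set.Ioo (-δ) δ)
    (y : lp (fun _ : Γ.El => ℂ) 2) : ∃ u f, Γ.IsMax c u f ∧ Γ.IsTrace u 0
      (WithLp.toLp 2 ![((χ 0 : ℝ) : ℂ) • y, ((deriv χ 0 : ℝ) : ℂ) • y, ((deriv (deriv χ) 0 : ℝ) : ℂ) • y]) := by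
  have h1 := contDiff_deriv_of_infty hχ
  have h2 := contDiff_deriv_of_infty h1
  let p : E → ℝ := fun e => (Γ.a e).toReal
  have hL : ∀ {ψ : ℝ → ℝ} (h : Continuous ψ) (hc : HasCompactSupport ψ),
      Γ.IsTraceL (bumpSum h hc p y) ((ψ 0 : ℂ) • y) := fun {ψ} h hc e => by
    have h3 := (hasBoundaryValue_translateLp (Γ.edge e) h hc (l := 𝓝[>] (Γ.a e).toReal) (p e) _
      nhdsWithin_le_nhds).smul (y e)
    rw [bumpSum_apply, dif_pos e.2]
    rw [sub_self, smul_eq_mul, mul_comm] at h3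
    exact h3
  have hR : ∀ {ψ : ℝ → ℝ} (h : Continuous ψ) (hc : HasCompactSupport ψ),
      tsupport ψ ⊆ Set.Ioo (-δ) δ → Γ.IsTraceR (bumpSum h hc p y) 0 := fun {ψ} h hc hs e => by
    classical
    rw [bumpSum_apply]
    by_cases ha : ⊥ < Γ.a e
    · rw [dif_pos ha]
      have h3 := (hasBoundaryValue_translateLp (Γ.edge e) h hc (l := 𝓝[<] (Γ.b e).toReal) (p e) _
        nhdsWithin_le_nhds).smul (y ⟨e, ha⟩)
      -- The edge has length at least δ, so its other end is outside the support of the bump.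
      have h4 : (Γ.b e).toReal - p e ∉ tsupport ψ := fun hmem => by
        have h5 := (hs hmem).2
        have h6 := hle e
        rw [← coe_toReal_a ha, ← coe_toReal_b e.2, ← EReal.coe_add, EReal.coe_le_coe_iff] at h6
        simp only [p] at h5
        linarith
      rw [image_eq_zero_of_notMem_tsupport h4, Complex.ofReal_zero, smul_zero] at h3
      exact h3
    · rw [dif_neg ha, zero_smul]
      exact HasBoundaryValue.zero
  have s1 : tsupport (deriv χ) ⊆ Set.Ioo (-δ) δ := tsupport_deriv_subset.trans hs
  have s2 : tsupport (deriv (deriv χ)) ⊆ Set.Ioo (-δ) δ := tsupport_deriv_subset.trans s1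
  exact ⟨_, _, isMax_of_isDeriv c (isDeriv_bumpSum hχ hc p y)
    (isDeriv_bumpSum h1 hc.deriv p y) (isDeriv_bumpSum h2 hc.deriv.deriv p y),
    _, _, isDeriv_bumpSum hχ hc p y, isDeriv_bumpSum h1 hc.deriv p y,
    ⟨hR _ _ hs, hR _ _ s1, hR _ _ s2⟩, ⟨hL _ _, hL _ _, hL _ _⟩⟩

/-- The functions on the edges with finite termination point, concentrated there. -/
theorem exists_isTrace_right (c : AiryCoefficients E) {δ : ℝ} (hle : ∀ e, Γ.a e + δ ≤ Γ.b e)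
    (hχ : ContDiff ℝ ∞ χ) (hc : HasCompactSupport χ) (hs : tsupport χ ⊆ Set.Ioo (-δ) δ)
    (x : lp (fun _ : Γ.Er => ℂ) 2) : ∃ u f, Γ.IsMax c u f ∧ Γ.IsTrace u
      (WithLp.toLp 2 ![((χ 0 : ℝ) : ℂ) • x, ((deriv χ 0 : ℝ) : ℂ) • x, ((deriv (deriv χ) 0 : ℝ) : ℂ) • x]) 0 := by
  have h1 := contDiff_deriv_of_infty hχ
  have h2 := contDiff_deriv_of_infty h1
  let p : E → ℝ := fun e => (Γ.b e).toReal
  have hR : ∀ {ψ : ℝ → ℝ} (h : Continuous ψ) (hc : HasCompactSupport ψ),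
      Γ.IsTraceR (bumpSum h hc p x) ((ψ 0 : ℂ) • x) := fun {ψ} h hc e => by
    have h3 := (hasBoundaryValue_translateLp (Γ.edge e) h hc (l := 𝓝[<] (Γ.b e).toReal) (p e) _
      nhdsWithin_le_nhds).smul (x e)
    rw [bumpSum_apply, dif_pos e.2]
    rw [sub_self, smul_eq_mul, mul_comm] at h3
    exact h3
  have hL : ∀ {ψ : ℝ → ℝ} (h : Continuous ψ) (hc : HasCompactSupport ψ),
      tsupport ψ ⊆ Set.Ioo (-δ) δ → Γ.IsTraceL (bumpSum h hc p x) 0 := fun {ψ} h hc hs e => by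
    classical
    rw [bumpSum_apply]
    by_cases hb : Γ.b e < ⊤
    · rw [dif_pos hb]
      have h3 := (hasBoundaryValue_translateLp (Γ.edge e) h hc (l := 𝓝[>] (Γ.a e).toReal) (p e) _
        nhdsWithin_le_nhds).smul (x ⟨e, hb⟩)
      have h4 : (Γ.a e).toReal - p e ∉ tsupport ψ := fun hmem => by
        have h5 := (hs hmem).1
        have h6 := hle e
        rw [← coe_toReal_a e.2, ← coe_toReal_b hb, ← EReal.coe_add, EReal.coe_le_coe_iff] at h6
        simp only [p] at h5
        linarith
      rw [image_eq_zero_of_notMem_tsupport h4, Complex.ofReal_zero, smul_zero] at h3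
      exact h3
    · rw [dif_neg hb, zero_smul]
      exact HasBoundaryValue.zero
  have s1 : tsupport (deriv χ) ⊆ Set.Ioo (-δ) δ := tsupport_deriv_subset.trans hs
  have s2 : tsupport (deriv (deriv χ)) ⊆ Set.Ioo (-δ) δ := tsupport_deriv_subset.trans s1
  exact ⟨_, _, isMax_of_isDeriv c (isDeriv_bumpSum hχ hc p x)
    (isDeriv_bumpSum h1 hc.deriv p x) (isDeriv_bumpSum h2 hc.deriv.deriv p x),
    _, _, isDeriv_bumpSum hχ hc p x, isDeriv_bumpSum h1 hc.deriv p x,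
    ⟨hR _ _, hR _ _, hR _ _⟩, ⟨hL _ _ hs, hL _ _ s1, hL _ _ s2⟩⟩

end BumpSum

theorem IsMax.add {c : AiryCoefficients E} {u f v g : Γ.H} (h : Γ.IsMax c u f)
    (h' : Γ.IsMax c v g) : Γ.IsMax c (u + v) (f + g) :=
  (Γ.maxGraph c).add_mem (x := (u, f)) (y := (v, g)) h h'

/-- All boundary values are attained on the domain of the maximal operator. -/
theorem HasPositiveEdgeLength.exists_isMax_isTrace (hΓ : Γ.HasPositiveEdgeLength)
    (c : AiryCoefficients E) (x : L2Cube Γ.Er) (y : L2Cube Γ.El) :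
    ∃ u f, Γ.IsMax c u f ∧ Γ.IsTrace u x y := by
  obtain ⟨δ, hδ, hle⟩ := hΓ.exists_le
  obtain ⟨χ, hχ⟩ := exists_jet_cutoff hδ
  choose u f hu ht using fun j => exists_isTrace_left c hle (hχ j).1 (hχ j).2.1 (hχ j).2.2.1 (y j)
  choose v g hv hs using fun j =>
    exists_isTrace_right c hle (hχ j).1 (hχ j).2.1 (hχ j).2.2.1 (x j)
  -- One bump family for each end and each order of derivative; the jets make the six contributions
  -- independent.
  refine ⟨_, _, (((hu 0).add (hu 1)).add (hu 2)).add (((hv 0).add (hv 1)).add (hv 2)), ?_⟩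
  convert! (((ht 0).add (ht 1)).add (ht 2)).add (((hs 0).add (hs 1)).add (hs 2)) using 1
  · ext j : 1
    fin_cases j <;> simp [(hχ _).2.2.2.1, (hχ _).2.2.2.2.1, (hχ _).2.2.2.2.2]
  · ext j : 1
    fin_cases j <;> simp [(hχ _).2.2.2.1, (hχ _).2.2.2.2.1, (hχ _).2.2.2.2.2]

/-! ### Test functions on a single edge. -/

section TestElements

variable {φ : ℝ → ℝ}

/-- The element given by the test function `φ` on the edge `e`, and by zero on the others. -/
def testElement (e : E) (h : Continuous φ) (hc : HasCompactSupport φ) : Γ.H :=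
  open Classical in lp.single 2 e (translateLp (Γ.edge e) h hc 0)

theorem isDeriv_testElement (e : E) (h : ContDiff ℝ ∞ φ) (hc : HasCompactSupport φ) :
    Γ.IsDeriv (testElement e h.continuous hc)
      (testElement e (h.continuous_deriv (by simp)) hc.deriv) := fun e' => by
  classical
  rw [testElement, testElement, lp.single_apply, lp.single_apply]
  by_cases he : e' = e
  · subst he
    rw [Pi.single_eq_same, Pi.single_eq_same]
    exact isWeakDeriv_translateLp _ h hc 0
  · rw [Pi.single_eq_of_ne he, Pi.single_eq_of_ne he]
    exact IsWeakDeriv.zero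

theorem hasBoundaryValue_testElement (e : E) (h : Continuous φ) (hc : HasCompactSupport φ)
    (e' : E) {q : ℝ} (hq : q ∉ Γ.edge e') (hs : tsupport φ ⊆ Γ.edge e) {l : Filter ℝ}
    (hl : l ≤ 𝓝 q) : HasBoundaryValue l ((testElement e h hc : Γ.H) e') 0 := by
  classical
  rw [testElement, lp.single_apply]
  by_cases he : e' = e
  · subst he
    rw [Pi.single_eq_same]
    have h3 := hasBoundaryValue_translateLp (Γ.edge e') h hc 0 q hl
    rwa [sub_zero, image_eq_zero_of_notMem_tsupport fun h => hq (hs h), Complex.ofReal_zero] at h3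
  · rw [Pi.single_eq_of_ne he]
    exact HasBoundaryValue.zero

theorem isTrace_testElement (e : E) (h : ContDiff ℝ ∞ φ) (hc : HasCompactSupport φ)
    (hs : tsupport φ ⊆ Γ.edge e) : Γ.IsTrace (testElement e h.continuous hc) 0 0 := by
  have h1 := contDiff_deriv_of_infty h
  have s1 : tsupport (deriv φ) ⊆ Γ.edge e := tsupport_deriv_subset.trans hs
  have s2 : tsupport (deriv (deriv φ)) ⊆ Γ.edge e := tsupport_deriv_subset.trans s1
  have hR : ∀ {ψ : ℝ → ℝ} (h : Continuous ψ) (hc : HasCompactSupport ψ), tsupport ψ ⊆ Γ.edge e →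
      Γ.IsTraceR (testElement e h hc) 0 := fun h hc hs e' =>
    hasBoundaryValue_testElement e h hc e' (q := (Γ.b e').toReal)
      (fun hq => hq.2.ne (coe_toReal_b e'.2)) hs nhdsWithin_le_nhds
  have hL : ∀ {ψ : ℝ → ℝ} (h : Continuous ψ) (hc : HasCompactSupport ψ), tsupport ψ ⊆ Γ.edge e →
      Γ.IsTraceL (testElement e h hc) 0 := fun h hc hs e' =>
    hasBoundaryValue_testElement e h hc e' (q := (Γ.a e').toReal)
      (fun hq => hq.1.ne' (coe_toReal_a e'.2)) hs nhdsWithin_le_nhds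
  exact ⟨_, _, isDeriv_testElement e h hc, isDeriv_testElement e h1 hc.deriv,
    ⟨hR _ _ hs, hR _ _ s1, hR _ _ s2⟩, ⟨hL _ _ hs, hL _ _ s1, hL _ _ s2⟩⟩

theorem inner_testElement (e : E) (h : Continuous φ) (hc : HasCompactSupport φ) (v : Γ.H) :
    inner ℂ (testElement e h hc) v = ∫ x in Γ.edge e, φ x • v e x := by
  classical
  rw [testElement, lp.inner_single_left, L2.inner_def]
  refine integral_congr_ae ?_
  filter_upwards [coeFn_translateLp (Γ.edge e) h hc 0] with x hx
  rw [hx, sub_zero, RCLike.inner_apply, Complex.conj_ofReal, mul_comm, Complex.real_smul]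

/-- Vanishing of all these pairings says that `v` is a weak derivative of zero. -/
theorem eq_zero_of_inner_testElement {v : Γ.H} (hv : ∀ (e : E) (φ : ℝ → ℝ) (h : ContDiff ℝ ∞ φ)
    (hc : HasCompactSupport φ), tsupport φ ⊆ Γ.edge e →
      inner ℂ (testElement e h.continuous hc : Γ.H) v = 0) : v = 0 := by
  have h : Γ.IsDeriv 0 v := fun e φ h1 h2 h3 => by
    rw [← inner_testElement e h1.continuous h2, hv e φ h1 h2 h3, neg_zero]
    rw [← inner_testElement e (h1.continuous_deriv (by simp)) h2.deriv, inner_zero_right]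
  exact h.eq_zero

theorem isMax_testElement (c : AiryCoefficients E) (e : E) (h : ContDiff ℝ ∞ φ)
    (hc : HasCompactSupport φ) : Γ.IsMax c (testElement e h.continuous hc)
      ((c.α e : ℂ) • testElement e (contDiff_deriv_of_infty (contDiff_deriv_of_infty
        (contDiff_deriv_of_infty h))).continuous hc.deriv.deriv.deriv
        + (c.β e : ℂ) • testElement e (contDiff_deriv_of_infty h).continuous hc.deriv) := by
  have h1 := contDiff_deriv_of_infty h
  have h2 := contDiff_deriv_of_infty h1
  refine ⟨_, _, _, isDeriv_testElement e h hc, isDeriv_testElement e h1 hc.deriv,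
    isDeriv_testElement e h2 hc.deriv.deriv, fun e' => ?_⟩
  classical
  rw [H.add_apply, H.smul_apply, H.smul_apply]
  by_cases he : e' = e
  · subst he; rfl
  · simp only [testElement, lp.single_apply, Pi.single_eq_of_ne he, smul_zero]

end TestElements

end MetricGraph

/-! ### Closed relations and their annihilators under the indefinite forms. -/

section Krein

variable {K K' : Type*} [NormedAddCommGroup K] [InnerProductSpace ℂ K]
  [NormedAddCommGroup K'] [InnerProductSpace ℂ K'] {B : K →ₗ[ℂ] K} {B' : K' →ₗ[ℂ] K'}

/-- A bipolar argument. By Riesz and the surjectivity of the Gram operators, every functional on K ×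
K' has the form (x, y) ↦ ⟨y | y'⟩ − ⟨x | x'⟩, and those vanishing on the graph are given by the
elements of the adjoint graph. -/
theorem mem_graph_of_forall_kreinForm_eq [CompleteSpace K] [CompleteSpace K'] {L : K →ₗ.[ℂ] K'}
    (hL : L.IsClosed) (hB : B.IsSymmetric) (hB' : B'.IsSymmetric) (sB : Function.Surjective B)
    (sB' : Function.Surjective B') {x : K} {y : K'}
    (h : ∀ y' x', (y', x') ∈ kreinAdjointGraph B B' L → kreinForm B' y y' = kreinForm B x x') :
    (x, y) ∈ L.graph := by
  by_contra hxy
  have : IsClosed (L.graph : Set (K × K')) := hL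
  -- A functional on the quotient by the closed graph separates (x, y) from the graph.
  obtain ⟨g, hg⟩ := SeparatingDual.exists_ne_zero (R := ℂ)
    (mt (Submodule.Quotient.mk_eq_zero L.graph).1 hxy)
  let f : StrongDual ℂ (K × K') := g.comp L.graph.mkQL
  have hf : f (x, y) ≠ 0 := hg
  have hle : ∀ p ∈ L.graph, f p = 0 := fun p hp =>
    (congrArg g ((Submodule.Quotient.mk_eq_zero L.graph).2 hp)).trans (_root_.map_zero g)
  let f₁ : StrongDual ℂ K := f.comp (ContinuousLinearMap.inl ℂ K K')
  let f₂ : StrongDual ℂ K' := f.comp (ContinuousLinearMap.inr ℂ K K')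
  obtain ⟨x', hx'⟩ := sB (-(InnerProductSpace.toDual ℂ K).symm f₁)
  obtain ⟨y', hy'⟩ := sB' ((InnerProductSpace.toDual ℂ K').symm f₂)
  have key : ∀ p : K × K', f p = kreinForm B' p.2 y' - kreinForm B p.1 x' := fun p => by
    rw [kreinForm, kreinForm, ← hB, ← hB', hx', hy', inner_neg_left,
      InnerProductSpace.toDual_symm_apply, InnerProductSpace.toDual_symm_apply, sub_neg_eq_add]
    simp only [f₁, f₂, ContinuousLinearMap.comp_apply, ContinuousLinearMap.inl_apply,
      ContinuousLinearMap.inr_apply]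
    rw [← _root_.map_add]
    simp
  refine hf ?_
  rw [key, sub_eq_zero]
  refine h y' x' fun z => ?_
  have h1 := hle _ (L.mem_graph z)
  rw [← sub_eq_zero]
  exact (key _).symm.trans h1

end Krein

section Boundary

variable {ι E : Type*}

/-- The block matrix is inverted by hand; 1/α is a bounded multiplier because α is bounded away from
zero. -/
theorem gramOp_surjective (c : AiryCoefficients E) (s : ι → E) :
    Function.Surjective (gramOp c s) := by
  intro z
  have hα : ∀ i, (c.α (s i) : ℂ) ≠ 0 := fun i =>
    Complex.ofReal_ne_zero.2 (c.α_pos (s i)).ne'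
  have hinv : ∃ C : ℝ, ∀ i, |1 / c.α (s i)| ≤ C := by
    obtain ⟨k, hk, h⟩ := c.α_lower
    refine ⟨1 / k, fun i => ?_⟩
    rw [abs_of_pos (one_div_pos.2 (c.α_pos _))]
    exact one_div_le_one_div_of_le hk (h _)
  let R := mulOp (fun i => 1 / c.α (s i)) hinv
  let β := mulOp (fun i => c.β (s i)) (c.β_bounded.imp fun _ h i => h (s i))
  refine ⟨WithLp.toLp 2 ![-R (z 2), R (z 1), R (β (R (z 2)) - z 0)], ?_⟩
  ext j : 1
  apply lp.ext
  funext i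
  have := hα i
  fin_cases j <;> simp [gramOp, R, β, mulOp_apply] <;> field_simp
  ring

end Boundary

/-! ### The operator A_L: closedness, adjoint, dissipativity, and the theorem. -/

namespace MetricGraph

variable {V E : Type*} {Γ : MetricGraph V E} {c : AiryCoefficients E}
  {L : L2Cube Γ.Er →ₗ.[ℂ] L2Cube Γ.El}

theorem mem_graph_airyOperator {u f : Γ.H} : (u, f) ∈ (airyOperator c L).graph ↔
    Γ.IsMax c u f ∧ ∃ x : L.domain, Γ.IsTrace u x (L x) := by
  have hmax : (u, f) ∈ (Γ.maxOperator c).graph ↔ Γ.IsMax c u f := by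
    rw [maxOperator_graph]; rfl
  rw [← hmax, LinearPMap.mem_graph_iff, LinearPMap.mem_graph_iff]
  constructor
  · rintro ⟨z, rfl, hz⟩
    refine ⟨⟨⟨z, z.2.2⟩, rfl, ?_⟩, z.2.1⟩
    rw [← hz]
    exact (LinearPMap.domRestrict_apply rfl).symm
  · rintro ⟨⟨z, rfl, hz⟩, hx⟩
    refine ⟨⟨z, hx, z.2⟩, rfl, ?_⟩
    rw [← hz]
    exact LinearPMap.domRestrict_apply rfl

theorem mem_graph_airyOperator_of_isTrace_zero {u f : Γ.H} (h : Γ.IsMax c u f)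
    (ht : Γ.IsTrace u 0 0) : (u, f) ∈ (airyOperator c L).graph :=
  mem_graph_airyOperator.2 ⟨h, 0, by rw [LinearPMap.map_zero]; exact ht⟩

/-- The adjoint of the minimal operator is contained in −Â: against test functions the hypothesis is
the weak Airy equation, and regularity applies. -/
theorem HasPositiveEdgeLength.isMax_of_forall_inner (hΓ : Γ.HasPositiveEdgeLength) {u f : Γ.H}
    (h : ∀ v g, Γ.IsMax c v g → Γ.IsTrace v 0 0 → inner ℂ v f + inner ℂ g u = 0) :
    Γ.IsMax c u f := by
  refine hΓ.isMax_of_isWeakAirySolution c fun e φ h1 h2 h3 => ?_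
  have h4 := h _ _ (isMax_testElement c e h1 h2) (isTrace_testElement e h1 h2 h3)
  rw [inner_add_left, inner_smul_left, inner_smul_left, inner_testElement, inner_testElement,
    inner_testElement, Complex.conj_ofReal, Complex.conj_ofReal] at h4
  exact eq_neg_of_add_eq_zero_right h4

theorem HasPositiveEdgeLength.exists_isTrace_of_isMax (hΓ : Γ.HasPositiveEdgeLength) {u f : Γ.H}
    (h : Γ.IsMax c u f) : ∃ x y, Γ.IsTrace u x y := by
  obtain ⟨u₁, u₂, u₃, h1, h2, h3, -⟩ := h
  exact hΓ.exists_isTrace h1 h2 h3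

theorem IsMax.two_mul_re_inner {u f : Γ.H} (h : Γ.IsMax c u f) {x : L2Cube Γ.Er}
    {y : L2Cube Γ.El} (ht : Γ.IsTrace u x y) : 2 * (inner ℂ u f).re
      = (kreinForm (Γ.Bl c) y y).re - (kreinForm (Γ.Br c) x x).re := by
  have h1 := congrArg Complex.re (h.lagrange h ht ht)
  rw [Complex.add_re, Complex.sub_re, ← inner_conj_symm f u, Complex.conj_re] at h1
  linarith

/-- Test functions have zero traces and so satisfy the boundary condition for every `L`. -/
theorem dense_domain_airyOperator :
    Dense ((airyOperator c L).domain : Set Γ.H) := by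
  rw [Submodule.dense_iff_topologicalClosure_eq_top, Submodule.topologicalClosure_eq_top_iff,
    Submodule.eq_bot_iff]
  intro v hv
  refine eq_zero_of_inner_testElement fun e φ h hc hs => hv _ ?_
  exact LinearPMap.mem_domain_iff.2 ⟨_, mem_graph_airyOperator_of_isTrace_zero
    (isMax_testElement c e h hc) (isTrace_testElement e h hc hs)⟩

theorem Bl_isSymmetric : (Γ.Bl c).IsSymmetric := gramOp_symmetric c _

theorem Br_isSymmetric : (Γ.Br c).IsSymmetric := gramOp_symmetric c _

theorem mem_graph_kreinAdjoint (hL : Dense (L.domain : Set (L2Cube Γ.Er))) {y : L2Cube Γ.El}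
    {x : L2Cube Γ.Er} : (y, x) ∈ (kreinAdjoint (Γ.Br c) (Γ.Bl c) L).graph ↔
      (y, x) ∈ kreinAdjointGraph (Γ.Br c) (Γ.Bl c) L := by
  rw [kreinAdjoint_graph Br_isSymmetric (gramOp_injective c _) hL]

theorem inner_add_inner_eq_zero {u f v g : Γ.H} (hu : (u, f) ∈ (airyOperator c L).graph)
    (hv : Γ.IsMax c v g) {x : L2Cube Γ.Er} {y : L2Cube Γ.El} (ht : Γ.IsTrace v x y)
    (h : (y, x) ∈ kreinAdjointGraph (Γ.Br c) (Γ.Bl c) L) : inner ℂ v f + inner ℂ g u = 0 := by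
  obtain ⟨h1, z, hz⟩ := mem_graph_airyOperator.1 hu
  rw [h1.lagrange hv hz ht, sub_eq_zero]
  exact h z

/-- The graph is cut out by the closed conditions (f | v) + (u | g) = 0, where g = Âv and the traces
of v lie in the graph of L^♯. Those with zero traces force u into D(Â). The others force its traces
into the graph of `L`, by the Lagrange identity and the bipolar argument. -/
theorem HasPositiveEdgeLength.isClosed_airyOperator (hΓ : Γ.HasPositiveEdgeLength)
    (hL : L.IsClosed) : (airyOperator c L).IsClosed := by
  refine isClosed_of_closure_subset ?_
  rintro ⟨u, f⟩ huf
  have key : ∀ v g x y, Γ.IsMax c v g → Γ.IsTrace v x y →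
      (y, x) ∈ kreinAdjointGraph (Γ.Br c) (Γ.Bl c) L → inner ℂ v f + inner ℂ g u = 0 := by
    intro v g x y hv ht h
    have hc : IsClosed {p : Γ.H × Γ.H | inner ℂ v p.2 + inner ℂ g p.1 = 0} :=
      isClosed_eq (by fun_prop) continuous_const
    exact closure_minimal (fun p hp => inner_add_inner_eq_zero hp hv ht h) hc huf
  have hm : Γ.IsMax c u f := hΓ.isMax_of_forall_inner fun v g hv ht =>
    key v g 0 0 hv ht (Submodule.zero_mem _)
  obtain ⟨x, y, hxy⟩ := hΓ.exists_isTrace_of_isMax hm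
  have hg : (x, y) ∈ L.graph := by
    refine mem_graph_of_forall_kreinForm_eq hL (Br_isSymmetric (c := c)) (Bl_isSymmetric (c := c))
      (gramOp_surjective c _) (gramOp_surjective c _) fun y' x' h => ?_
    obtain ⟨v, g, hv, ht⟩ := hΓ.exists_isMax_isTrace c x' y'
    rw [← sub_eq_zero]
    exact (hm.lagrange hv hxy ht).symm.trans (key v g x' y' hv ht h)
  obtain ⟨z, rfl, rfl⟩ := (LinearPMap.mem_graph_iff _).1 hg
  exact mem_graph_airyOperator.2 ⟨hm, z, hxy⟩

/-- The adjoint of `A_L` is the restriction of `-Â` to the functions whose boundary values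
lie in the graph of `L^♯`. -/
theorem HasPositiveEdgeLength.adjoint_airyOperator (hΓ : Γ.HasPositiveEdgeLength) {v w : Γ.H}
    (h : ∀ u : (airyOperator c L).domain,
      inner ℂ v (airyOperator c L u) = inner ℂ w (u : Γ.H)) :
    Γ.IsMax c v (-w) ∧ ∃ x y, Γ.IsTrace v x y ∧
      (y, x) ∈ kreinAdjointGraph (Γ.Br c) (Γ.Bl c) L := by
  have h' : ∀ u f, (u, f) ∈ (airyOperator c L).graph → inner ℂ v f = inner ℂ w u := by
    intro u f hu
    obtain ⟨z, rfl, rfl⟩ := (LinearPMap.mem_graph_iff _).1 hu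
    exact h z
  have hm : Γ.IsMax c v (-w) := hΓ.isMax_of_forall_inner fun u f hu ht => by
    have h1 := congrArg (starRingEnd ℂ) (h' u f (mem_graph_airyOperator_of_isTrace_zero hu ht))
    rw [inner_conj_symm, inner_conj_symm] at h1
    rw [inner_neg_right, h1, neg_add_cancel]
  obtain ⟨x, y, hxy⟩ := hΓ.exists_isTrace_of_isMax hm
  refine ⟨hm, x, y, hxy, fun z => ?_⟩
  -- Every point of the graph of `L` is the trace of some u in D(A_L), so the vanishing boundary
  -- form in the Lagrange identity is the defining relation of L^♯.
  obtain ⟨u, f, hu, ht⟩ := hΓ.exists_isMax_isTrace c (z : L2Cube Γ.Er) (L z)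
  have h1 := hu.lagrange hm ht hxy
  rw [h' u f (mem_graph_airyOperator.2 ⟨hu, z, ht⟩), inner_neg_left, add_neg_cancel] at h1
  exact sub_eq_zero.1 h1.symm

theorem dissipative_airyOperator (h : IsKreinContraction (Γ.Br c) (Γ.Bl c) L) :
    (airyOperator c L).Dissipative := fun u => by
  obtain ⟨hm, z, hz⟩ := mem_graph_airyOperator.1 ((airyOperator c L).mem_graph u)
  have h1 := hm.two_mul_re_inner hz
  have h2 := h z
  linarith

theorem HasPositiveEdgeLength.isKreinContraction_of_dissipative (hΓ : Γ.HasPositiveEdgeLength)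
    (h : (airyOperator c L).Dissipative) : IsKreinContraction (Γ.Br c) (Γ.Bl c) L := fun z => by
  obtain ⟨u, f, hu, ht⟩ := hΓ.exists_isMax_isTrace c (z : L2Cube Γ.Er) (L z)
  obtain ⟨p, hp, hp'⟩ := (LinearPMap.mem_graph_iff _).1 (mem_graph_airyOperator.2 ⟨hu, z, ht⟩)
  simp only at hp hp'
  have h1 := hu.two_mul_re_inner ht
  have h2 := h p
  rw [hp, hp'] at h2
  linarith

end MetricGraph

end

theorem mainTheorem2 {V E : Type*} (Γ : MetricGraph V E) (hΓ : Γ.HasPositiveEdgeLength)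
    (c : AiryCoefficients E) (L : L2Cube Γ.Er →ₗ.[ℂ] L2Cube Γ.El)
    (hdense : Dense (L.domain : Set (L2Cube Γ.Er))) (hclosed : L.IsClosed) :
    GeneratesContractionSemigroup (MetricGraph.airyOperator c L) ↔
      IsKreinContraction (Γ.Br c) (Γ.Bl c) L ∧
        IsKreinContraction (Γ.Bl c) (Γ.Br c) (kreinAdjoint (Γ.Br c) (Γ.Bl c) L) := by
  have hD : Dense ((MetricGraph.airyOperator c L).domain : Set Γ.H) :=
    MetricGraph.dense_domain_airyOperator
  constructor
  · rintro ⟨S, hS⟩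
    refine ⟨hΓ.isKreinContraction_of_dissipative hS.dissipative, fun y => ?_⟩
    have hy := (MetricGraph.mem_graph_kreinAdjoint hdense).1 (LinearPMap.mem_graph _ y)
    -- Realize (L^♯ y, y) as the traces of some v. Then v lies in the domain of the adjoint of A_L,
    -- with value −g, and dissipativity of the adjoint is the contraction inequality at y.
    obtain ⟨v, g, hv, ht⟩ := hΓ.exists_isMax_isTrace c
      (kreinAdjoint (Γ.Br c) (Γ.Bl c) L y) (y : L2Cube Γ.El)
    have h1 := hS.re_inner_adjoint_nonpos hD (v := v) (w := -g) fun u => by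
      have h2 := MetricGraph.inner_add_inner_eq_zero (LinearPMap.mem_graph _ u) hv ht hy
      rw [inner_neg_left]
      exact eq_neg_of_add_eq_zero_left h2
    have h2 := hv.two_mul_re_inner ht
    rw [inner_neg_right, Complex.neg_re] at h1
    linarith
  · rintro ⟨h1, h2⟩
    have hA := MetricGraph.dissipative_airyOperator h1
    refine hA.generatesContractionSemigroup hD fun r hr => hA.exists_smul_sub_eq
      (hΓ.isClosed_airyOperator hclosed) hr fun v hv => ?_
    -- A vector orthogonal to the range of r − A_L satisfies Âv = −r v with traces related by L^♯.
    -- Then −2r ‖v‖² = ⟨y | y⟩_l − ⟨x | x⟩_r ≥ 0 by contractivity of L^♯, so v = 0.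
    obtain ⟨hm, x, y, ht, hxy⟩ := hΓ.adjoint_airyOperator (v := v) (w := (r : ℂ) • v) fun u => by
      have h3 := hv u
      rw [inner_sub_right, inner_smul_right, sub_eq_zero] at h3
      rw [← h3, inner_smul_left, Complex.conj_ofReal]
    obtain ⟨z, hz, hz'⟩ := (LinearPMap.mem_graph_iff _).1
      ((MetricGraph.mem_graph_kreinAdjoint hdense).2 hxy)
    simp only at hz hz'
    have h3 := h2 z
    have h4 := hm.two_mul_re_inner ht
    rw [hz, hz'] at h3
    rw [inner_neg_right, inner_smul_right, inner_self_eq_norm_sq_to_K, Complex.neg_re] at h4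
    have h5 : ((r : ℂ) * ((‖v‖ : ℂ) ^ 2)).re = r * ‖v‖ ^ 2 := by
      rw [← Complex.ofReal_pow, ← Complex.ofReal_mul, Complex.ofReal_re]
    have h6 : 2 * -(r * ‖v‖ ^ 2) = 2 * -((r : ℂ) * ((‖v‖ : ℂ) ^ 2)).re := by rw [h5]
    have h7 : 0 ≤ 2 * -(r * ‖v‖ ^ 2) := by
      rw [h6]
      exact (sub_nonneg.2 h3).trans_eq h4.symm
    have h8 : ‖v‖ ^ 2 ≤ 0 := by
      by_contra hcon
      have := mul_pos hr (not_le.1 hcon)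
      linarith
    exact norm_eq_zero.1 (pow_eq_zero_iff two_ne_zero |>.1 (le_antisymm h8 (sq_nonneg _)))
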